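/- Let $\zeta$ be a random element with distribution $\Pi$, let $F(x,\zeta)$, $x\in\mathbb R^d$, be a stochastic function, and let $f(x)=\mathbb E[F(x,\zeta)]$. Assume: 1. (oracle) for every $x$, $F(x,\zeta)$ is integrable, $\mathbb E[\nabla F(x,\zeta)]=\nabla f(x)$ and $\mathbb E\|\nabla F(x,\zeta)-\nabla f(x)\|^2\le\sigma^2$; 2. $f$ is twice continuously differentiable and $\mu I_d\preceq\nabla^2 f(x)\preceq L I_d$ for all $x$, with $\mu,L>0$; $x^*$ denotes its minimizer; 3. $F(\cdot,\zeta)$ is continuously differentiable, $\|\nabla F(x,\zeta)\|$ is integrable for every $x$, and there is a constant $K_0>0$ with $\mathbb E\|\nabla F(x,\zeta)-\nabla f(x)\|^2+\|\nabla f(x)\|^2\le K_0(1+\|x-x^*\|^2)$ for all $x$; 4. $F(\cdot,\zeta)$ is twice differentiable and $\|\nabla^2F(x,\zeta)\|\le H(\zeta)$ for all $x$, where $\mathbb E[H(\zeta)^4]<\infty$; moreover $\mathbb E\|\nabla F(x^*,\zeta)\|^4<\infty$. Let $(\zeta_i,u_i)_{i\ge1}$ be i.i.d. with $\zeta_i\sim\Pi$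 and $u_i\sim N(0,I_d)$ independent. For $\nu>0$ put $G_\nu(x,\zeta,u)=\frac{F(x+\nu u,\zeta)-F(x,\zeta)}{\nu}\,u$, let $f_\nu(x)=\mathbb E[F(x+\nu u,\zeta)]$ with minimizer $x_\nu^*$, let $S_\nu=\mathbb E[G_\nu(x_\nu^*,\zeta,u)G_\nu(x_\nu^*,\zeta,u)^T]$ and $\tilde V=(\nabla^2f_\nu(x_\nu^*))^{-1}S_\nu(\nabla^2f_\nu(x_\nu^*))^{-1}$. From a deterministic $x_0\in\mathbb R^d$ run $$x_i=x_{i-1}-\eta_i\,G_\nu(x_{i-1},\zeta_i,u_i),\qquad \eta_i=\eta\, i^{-\alpha},\quad \eta>0,\ \tfrac12<\alpha<1,\qquad \bar x_n=\frac1n\sum_{i=0}^{n-1}x_i .$$ Let $a_1=1$ and $a_k=\lfloor Ck^{2/(1-\alpha)}\rfloor$ for $k\ge2$, where $C>0$ is a constant such that $(a_k)_{k\ge1}$ is strictly increasing; let $t_i=a_m$ when $a_m\le i<a_{m+1}$, let $l_i=i-t_i+1$, and let $$\widehat\Sigma_n=\Big(\sum_{i=1}^n l_i\Big)^{-1}\sum_{i=1}^n\Big(\sum_{k=t_i}^i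 x_k-l_i\bar x_n\Big)\Big(\sum_{k=t_i}^i x_k-l_i\bar x_n\Big)^T .$$ Then there is a constant $K>0$, independent of $n$ and of $\nu$, such that for every $\nu>0$ there is an $N$ (which may depend on $\nu$) such that for all $n\ge N$, in operator norm, $$\mathbb E\big\|\widehat\Sigma_n-\tilde V\big\|\le K\,\frac{\sqrt{1+\nu^2+\nu^4}+\sqrt{1+\nu+\nu^2}}{n^{(1-\alpha)/4}},$$ where the expectation is finite; and the same bound holds with $n$ replaced by the number of evaluations of $F$ made to compute $x_1,\dots,x_n$ (two per iteration). -/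

import Mathlib

open MeasureTheory ProbabilityTheory

noncomputable section

namespace ZOSGD

variable {d : ℕ} {Z : Type*}

/-- The gradient in `x` of the stochastic function `F(x, z)`. -/
def gradF (F : EuclideanSpace ℝ (Fin d) → Z → ℝ) (x : EuclideanSpace ℝ (Fin d)) (z : Z) :
    EuclideanSpace ℝ (Fin d) :=
  gradient (fun y => F y z) x

/-- The Hessian of `g` at `x`, as an operator. -/
def hessian (g : EuclideanSpace ℝ (Fin d) → ℝ) (x : EuclideanSpace ℝ (Fin d)) :
    EuclideanSpace ℝ (Fin d) →L[ℝ] EuclideanSpace ℝ (Fin d) :=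
  fderiv ℝ (gradient g) x

/-- The objective `f(x) = E[F(x, ζ)]`, where `ζ` has distribution `Q`. -/
def objective [MeasurableSpace Z] (F : EuclideanSpace ℝ (Fin d) → Z → ℝ) (Q : Measure Z)
    (x : EuclideanSpace ℝ (Fin d)) : ℝ :=
  ∫ z, F x z ∂Q

/-- The surrogate objective `f_ν(x) = E[F(x + ν u, ζ)]`, with `ζ ∼ Q` and `u ∼ N(0, I_d)`
independent. -/
def surrogate [MeasurableSpace Z] (F : EuclideanSpace ℝ (Fin d) → Z → ℝ) (Q : Measure Z)
    (ν : ℝ) (x : EuclideanSpace ℝ (Fin d)) : ℝ :=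
  ∫ p, F (x + ν • p.2) p.1 ∂(Q.prod (stdGaussian (EuclideanSpace ℝ (Fin d))))

/-- The two-point gradient estimator `G_ν(x, z, u) = (F(x + ν u, z) - F(x, z)) / ν * u`. -/
def gradEst (F : EuclideanSpace ℝ (Fin d) → Z → ℝ) (ν : ℝ)
    (x : EuclideanSpace ℝ (Fin d)) (z : Z) (u : EuclideanSpace ℝ (Fin d)) :
    EuclideanSpace ℝ (Fin d) :=
  ((F (x + ν • u) z - F x z) / ν) • u

/-- The outer product `v vᵀ`, as an operator. -/
def outer (v : EuclideanSpace ℝ (Fin d)) :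
    EuclideanSpace ℝ (Fin d) →L[ℝ] EuclideanSpace ℝ (Fin d) :=
  InnerProductSpace.rankOne ℝ v v

/-! ### Assumptions on the problem -/

/-- The stochastic zeroth-order oracle: `F(x, ζ)` is an unbiased estimator of `f(x)`, its gradient
is an unbiased estimator of `∇f(x)`, and the variance of the gradient is at most `σ²`. -/
structure IsOracle [MeasurableSpace Z] (F : EuclideanSpace ℝ (Fin d) → Z → ℝ) (Q : Measure Z)
    (σ : ℝ) : Prop where
  measurable : ∀ x, Measurable (F x)
  integrable : ∀ x, Integrable (F x) Q
  grad_unbiased : ∀ x, ∫ z, gradF F x z ∂Q = gradient (objective F Q) x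
  variance_integrable :
    ∀ x, Integrable (fun z => ‖gradF F x z - gradient (objective F Q) x‖ ^ 2) Q
  variance_le : ∀ x, ∫ z, ‖gradF F x z - gradient (objective F Q) x‖ ^ 2 ∂Q ≤ σ ^ 2

/-- `f` is twice continuously differentiable with `μ I ≤ ∇²f(x) ≤ L I` for all `x`. -/
structure IsSmoothStronglyConvex (f : EuclideanSpace ℝ (Fin d) → ℝ) (μ L : ℝ) : Prop where
  contDiff : ContDiff ℝ 2 f
  lower : ∀ x v, μ * ‖v‖ ^ 2 ≤ inner ℝ (hessian f x v) v
  upper : ∀ x v, inner ℝ (hessian f x v) v ≤ L * ‖v‖ ^ 2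

/-- Regularity of the noise: `F(·, z)` is continuously differentiable, `‖∇F(x, ζ)‖` is integrable,
and `E‖∇F(x, ζ) - ∇f(x)‖² + ‖∇f(x)‖²` grows at most quadratically in the distance from `x`
to the minimizer `xs` of `f`. -/
structure IsRegularNoise [MeasurableSpace Z] (F : EuclideanSpace ℝ (Fin d) → Z → ℝ)
    (Q : Measure Z) (xs : EuclideanSpace ℝ (Fin d)) : Prop where
  contDiff : ∀ z, ContDiff ℝ 1 (fun x => F x z)
  grad_integrable : ∀ x, Integrable (gradF F x) Q
  growth : ∃ K : ℝ, 0 < K ∧ ∀ x,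
    ∫ z, ‖gradF F x z - gradient (objective F Q) x‖ ^ 2 ∂Q + ‖gradient (objective F Q) x‖ ^ 2
      ≤ K * (1 + ‖x - xs‖ ^ 2)

/-- `F(·, z)` is twice differentiable and `‖∇²F(x, z)‖ ≤ H(z)` for all `x`, where `H(ζ)` has a
finite fourth moment. -/
structure HasHessianBound [MeasurableSpace Z] (F : EuclideanSpace ℝ (Fin d) → Z → ℝ)
    (Q : Measure Z) (H : Z → ℝ) : Prop where
  differentiable : ∀ z, Differentiable ℝ (fun x => gradF F x z)
  hessian_le : ∀ x z, ‖hessian (fun y => F y z) x‖ ≤ H z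
  memLp : MemLp H 4 Q

/-! ### The algorithm, along one realization of the randomness -/

/-- The iterates `x_i = x_{i-1} - η_i G_ν(x_{i-1}, ζ_i, u_i)` with `η_i = η i^{-α}`. -/
def iterate (F : EuclideanSpace ℝ (Fin d) → Z → ℝ) (ν η α : ℝ)
    (x₀ : EuclideanSpace ℝ (Fin d)) (ζ : ℕ → Z) (u : ℕ → EuclideanSpace ℝ (Fin d)) :
    ℕ → EuclideanSpace ℝ (Fin d)
  | 0 => x₀
  | i + 1 => iterate F ν η α x₀ ζ u i
      - (η * ((i + 1 : ℕ) : ℝ) ^ (-α)) •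
        gradEst F ν (iterate F ν η α x₀ ζ u i) (ζ (i + 1)) (u (i + 1))

/-- The queries `(x, z)` made to the oracle `F` while computing `x_1, …, x_n`. -/
def queries (F : EuclideanSpace ℝ (Fin d) → Z → ℝ) (ν η α : ℝ)
    (x₀ : EuclideanSpace ℝ (Fin d)) (ζ : ℕ → Z) (u : ℕ → EuclideanSpace ℝ (Fin d)) :
    ℕ → List (EuclideanSpace ℝ (Fin d) × Z)
  | 0 => []
  | i + 1 => queries F ν η α x₀ ζ u i ++
      [(iterate F ν η α x₀ ζ u i + ν • u (i + 1), ζ (i + 1)),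
        (iterate F ν η α x₀ ζ u i, ζ (i + 1))]

/-- The averaged iterate `(x_0 + … + x_{n-1}) / n`. -/
def average (x : ℕ → EuclideanSpace ℝ (Fin d)) (n : ℕ) : EuclideanSpace ℝ (Fin d) :=
  (n : ℝ)⁻¹ • ∑ i ∈ Finset.range n, x i

/-- The batch boundaries: `a_1 = 1` and `a_k = ⌊C k^{2/(1-α)}⌋` for `k ≥ 2`
(the value at `k = 0` is never used). -/
def batchSeq (C α : ℝ) (k : ℕ) : ℕ :=
  if k ≤ 1 then 1 else ⌊C * (k : ℝ) ^ (2 / (1 - α))⌋₊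

open Classical in
/-- `t_i`: the largest batch boundary `a_m` (`m ≥ 1`) with `a_m ≤ i`. -/
def batchStart (a : ℕ → ℕ) (i : ℕ) : ℕ :=
  Nat.findGreatest (fun t => ∃ m, 1 ≤ m ∧ a m = t) i

/-- `t_i = a_m` whenever `a_m ≤ i < a_{m+1}`. -/
theorem batchStart_eq {a : ℕ → ℕ} (ha : StrictMonoOn a (Set.Ici 1)) {m i : ℕ} (hm : 1 ≤ m)
    (h₁ : a m ≤ i) (h₂ : i < a (m + 1)) : batchStart a i = a m := by
  classical
  unfold batchStart
  rw [Nat.findGreatest_eq_iff]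
  refine ⟨h₁, fun _ => ⟨m, hm, rfl⟩, ?_⟩
  rintro t ht hti ⟨k, hk, rfl⟩
  have hmk : m < k := (ha.lt_iff_lt (Set.mem_Ici.2 hm) (Set.mem_Ici.2 hk)).1 ht
  have : a (m + 1) ≤ a k :=
    (ha.le_iff_le (Set.mem_Ici.2 (by omega)) (Set.mem_Ici.2 hk)).2 (by omega)
  omega

/-- The batch length `l_i = i - t_i + 1`. -/
def batchLen (a : ℕ → ℕ) (i : ℕ) : ℕ := i - batchStart a i + 1

/-- The online covariance estimator
`Σ̂_n = (∑_{i=1}^n l_i)⁻¹ ∑_{i=1}^n (∑_{k=t_i}^i x_k - l_i x̄_n) (∑_{k=t_i}^i x_k - l_i x̄_n)ᵀ`. -/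
def covEst (a : ℕ → ℕ) (x : ℕ → EuclideanSpace ℝ (Fin d)) (n : ℕ) :
    EuclideanSpace ℝ (Fin d) →L[ℝ] EuclideanSpace ℝ (Fin d) :=
  (∑ i ∈ Finset.Icc 1 n, (batchLen a i : ℝ))⁻¹ •
    ∑ i ∈ Finset.Icc 1 n,
      outer ((∑ k ∈ Finset.Icc (batchStart a i) i, x k) - (batchLen a i : ℝ) • average x n)

/-! ### The asymptotic covariance -/

/-- `S_ν = E[G_ν(x, ζ, u) G_ν(x, ζ, u)ᵀ]`, to be taken at the minimizer `x` of `f_ν`. -/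
def noiseCov [MeasurableSpace Z] (F : EuclideanSpace ℝ (Fin d) → Z → ℝ) (Q : Measure Z)
    (ν : ℝ) (x : EuclideanSpace ℝ (Fin d)) :
    EuclideanSpace ℝ (Fin d) →L[ℝ] EuclideanSpace ℝ (Fin d) :=
  ∫ p, outer (gradEst F ν x p.1 p.2) ∂(Q.prod (stdGaussian (EuclideanSpace ℝ (Fin d))))

/-- `Ṽ = (∇²f_ν(x))⁻¹ S_ν (∇²f_ν(x))⁻¹`, to be taken at the minimizer `x` of `f_ν`. -/
def asympCov [MeasurableSpace Z] (F : EuclideanSpace ℝ (Fin d) → Z → ℝ) (Q : Measure Z)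
    (ν : ℝ) (x : EuclideanSpace ℝ (Fin d)) :
    EuclideanSpace ℝ (Fin d) →L[ℝ] EuclideanSpace ℝ (Fin d) :=
  (hessian (surrogate F Q ν) x).inverse ∘L noiseCov F Q ν x ∘L
    (hessian (surrogate F Q ν) x).inverse

end ZOSGD

end

/-! Centre the iterates at the minimizer of the smoothed function: `y_k = x_k - x_ν^*` follows a
stochastic approximation scheme `y_{k+1} = y_k - η h_k g(y_k, w_{k+1})` with `h_k = (k+1)^{-α}`
(`iterate_eq_add_descent`), and the estimator does not see the translation (`covEst_const_add`). All
that is needed of `g` is collected in `IsNoisyField`: the mean of `g(y, ·)` is `μ`-monotone and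
vanishes at `0`, `g` is Lipschitz in fourth moment with constant `κ`, and `E‖g(0, ·)‖⁴ ≤ s²`. For
the two-point estimator, `κ` does not depend on `ν` and `s` is a multiple of `1 + ν²`
(`isNoisyField_gradEst`). Since every bound for the scheme is linear in `s` with constants depending
on `μ`, `κ`, `η`, `α`, `C` and the dimension, plus a constant controlling `‖y_0‖² / s`, the final
constant is uniform in `ν`.

Strong monotonicity gives `E‖y_k‖² ≲ s h_k` and `E‖y_k‖⁴ ≲ s² h_k²` (`exists_descent_moment_bound`).
Let `A` be the Hessian of the smoothed function at its minimizer. Solving the recursion for `A y_k`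
and summing over a block gives `A ∑ y_k = -∑ g(0, w_{k+1})` plus three errors: an Abel-summed
telescoping term, a martingale from the state dependence of the noise, and the linearization error
of the mean field (`exists_block_bound`). The last is at most `c‖y‖²`, because Stein's identity
makes the Hessian of the smoothed function Lipschitz although the Hessian of `f` is merely
continuous; the price is `c` of order `1/ν`. It contributes only lower order terms in `n`, so it
affects the threshold `N` and not `K`.

Hence a centred block sum is `-A⁻¹` times a block sum of i.i.d. noise, up to a small remainder. Let
`Λ` be the sum of the `l_i`, of order at least `n^{1+(1+α)/2}`, while every `l_i` with `i ≤ n` is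
`O(n^{(1+α)/2})`. The normalized sum of outer products of noise blocks has mean `S`, and only pairs
of indices in a common batch are correlated. There are at most `2Λ` such pairs, so each entry has
variance of order `s² max l_i² / Λ ≲ s² n^{-(1-α)/2}`, that is, an `L¹` error of order `s
n^{-(1-α)/4}` (`exists_empirical_covariance_bound`). The remainders have normalized second moment
`O(s n^{-(1-α)/2})` (`exists_remainder_bound`), and Young's inequality in the cross terms turns this
into the same rate (`exists_covEst_bound`). -/

noncomputable section

namespace ZOSGD

/-! ### Polynomially decaying recursions -/

/-- The normalized step size `(k + 1)^{-α}`. -/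
def stepPow (α : ℝ) (k : ℕ) : ℝ := ((k : ℝ) + 1) ^ (-α)

theorem stepPow_pos (α : ℝ) (k : ℕ) : 0 < stepPow α k :=
  Real.rpow_pos_of_pos (by positivity) _

theorem stepPow_le_one {α : ℝ} (hα : 0 ≤ α) (k : ℕ) : stepPow α k ≤ 1 :=
  Real.rpow_le_one_of_one_le_of_nonpos (by linarith [k.cast_nonneg (α := ℝ)]) (by linarith)

theorem stepPow_antitone {α : ℝ} (hα : 0 ≤ α) : Antitone (stepPow α) := fun i j hij =>
  Real.rpow_le_rpow_of_nonpos (by positivity)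
    (by have : (i : ℝ) ≤ j := by exact_mod_cast hij
        linarith) (by linarith)

theorem tendsto_stepPow {α : ℝ} (hα : 0 < α) :
    Filter.Tendsto (stepPow α) Filter.atTop (nhds 0) :=
  (tendsto_rpow_neg_atTop hα).comp
    (Filter.tendsto_atTop_add_const_right _ _ tendsto_natCast_atTop_atTop)

theorem stepPow_mul_tendsto {α : ℝ} (hα' : α < 1) :
    Filter.Tendsto (fun k : ℕ => stepPow α k * ((k : ℝ) + 1)) Filter.atTop Filter.atTop := by
  have h := (tendsto_rpow_atTop (sub_pos.2 hα')).comp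
    (Filter.tendsto_atTop_add_const_right _ (1 : ℝ) (tendsto_natCast_atTop_atTop (R := ℝ)))
  refine h.congr fun k => ?_
  have : (0 : ℝ) < (k : ℝ) + 1 := by positivity
  simp only [Function.comp, stepPow]
  rw [← Real.rpow_add_one this.ne']
  congr 1; ring

/-- The ratio of consecutive steps is `((k+1)/(k+2))^α`, and an exponent below `1` brings a number
in `(0, 1)` closer to `1`. -/
theorem stepPow_succ_ge {α : ℝ} (hα : 0 < α) (hα' : α < 1) (k : ℕ) :
    stepPow α k * (1 - 1 / ((k : ℝ) + 2)) ≤ stepPow α (k + 1) := by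
  have hk : (0 : ℝ) < (k : ℝ) + 1 := by positivity
  have hk2 : (0 : ℝ) < (k : ℝ) + 2 := by positivity
  have h1 : (1 - 1 / ((k : ℝ) + 2)) = ((k : ℝ) + 1) / (k + 2) := by field_simp; ring
  have h2 : ((k : ℝ) + 1) / (k + 2) ≤ (((k : ℝ) + 1) / (k + 2)) ^ α := by
    conv_lhs => rw [← Real.rpow_one (((k : ℝ) + 1) / (k + 2))]
    exact Real.rpow_le_rpow_of_exponent_ge (by positivity)
      (by rw [div_le_one hk2]; linarith) hα'.le
  have h3 : stepPow α (k + 1) = stepPow α k * (((k : ℝ) + 1) / (k + 2)) ^ α := by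
    unfold stepPow
    rw [Real.div_rpow hk.le hk2.le, Real.rpow_neg hk.le]
    have : ((k + 1 : ℕ) : ℝ) + 1 = (k : ℝ) + 2 := by push_cast; ring
    rw [this, Real.rpow_neg hk2.le]
    have := Real.rpow_pos_of_pos hk α
    field_simp
  rw [h3, h1]
  exact mul_le_mul_of_nonneg_left h2 (stepPow_pos α k).le

/-- Bernoulli's inequality applied to the previous ratio bound. -/
theorem stepPow_pow_succ_ge {α : ℝ} (hα : 0 < α) (hα' : α < 1) (p k : ℕ) :
    stepPow α k ^ p * (1 - p / ((k : ℝ) + 2)) ≤ stepPow α (k + 1) ^ p := by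
  have hk2 : (0 : ℝ) < (k : ℝ) + 2 := by positivity
  have h0 : 1 / ((k : ℝ) + 2) ≤ 1 := by rw [div_le_one hk2]; linarith
  have h1 := one_add_mul_le_pow (a := -(1 / ((k : ℝ) + 2))) (by linarith) p
  calc stepPow α k ^ p * (1 - p / ((k : ℝ) + 2))
      ≤ stepPow α k ^ p * (1 - 1 / ((k : ℝ) + 2)) ^ p := by
        refine mul_le_mul_of_nonneg_left ?_ (pow_nonneg (stepPow_pos α k).le _)
        calc _ = 1 + (p : ℝ) * -(1 / ((k : ℝ) + 2)) := by ring
          _ ≤ _ := h1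
          _ = _ := by ring
    _ = (stepPow α k * (1 - 1 / ((k : ℝ) + 2))) ^ p := by rw [mul_pow]
    _ ≤ _ := pow_le_pow_left₀ (mul_nonneg (stepPow_pos α k).le (by linarith))
        (stepPow_succ_ge hα hα' k) p

/-- The contraction `1 - r h_k` balances a source `B h_k^{p+1}` at the level `h_k^p`, because
`h_k^p` decays at relative speed `O(1/k)`, which is slower than `h_k`. The crude growth bound
handles the finitely many indices before the contraction sets in, and it is linear in `B`, so `K`
serves all `B` and `v` at once. -/
theorem exists_recursion_bound {α r A : ℝ} (hα : 0 < α) (hα' : α < 1) (hr : 0 < r) (hA : 0 ≤ A)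
    (p k₀ : ℕ) :
    ∃ K : ℝ, 0 < K ∧ ∀ (B : ℝ) (v : ℕ → ℝ), 0 ≤ B → (∀ k, 0 ≤ v k) → v 0 ≤ B →
      (∀ k, v (k + 1) ≤ A * v k + A * B) →
      (∀ k, k₀ ≤ k → v (k + 1) ≤ (1 - r * stepPow α k) * v k + B * stepPow α k ^ (p + 1)) →
      ∀ k, v k ≤ K * B * stepPow α k ^ p := by
  have e1 : ∀ᶠ k : ℕ in Filter.atTop, r * stepPow α k ≤ 1 := by
    have := (tendsto_stepPow hα).const_mul r
    rw [mul_zero] at this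
    exact this.eventually_le_const one_pos
  have e2 : ∀ᶠ k : ℕ in Filter.atTop, (p : ℝ) / (r / 2) ≤ stepPow α k * ((k : ℝ) + 1) :=
    (stepPow_mul_tendsto hα').eventually_ge_atTop _
  obtain ⟨k₁, hk₁⟩ := Filter.eventually_atTop.1 ((e1.and e2).and (Filter.eventually_ge_atTop k₀))
  -- Dominates the brute-force bound `(2A+1)^k B` on every index up to `k₁`. The term `2 / r` added
  -- below makes `K r ≥ 2`.
  set S := ∑ k ∈ Finset.range (k₁ + 1), (2 * A + 1) ^ k / stepPow α k ^ p with hS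
  have hterm : ∀ k, 0 ≤ (2 * A + 1) ^ k / stepPow α k ^ p := fun k =>
    div_nonneg (by positivity) (pow_nonneg (stepPow_pos α k).le _)
  have hS0 : 0 ≤ S := Finset.sum_nonneg fun k _ => hterm k
  refine ⟨S + 2 / r, by positivity, fun B v hB hv hv0 hA' hrec => ?_⟩
  have hsmall : ∀ k, v k ≤ (2 * A + 1) ^ k * B := by
    intro k
    induction k with
    | zero => simpa using hv0
    | succ k ih =>
      have h1 : (1 : ℝ) ≤ (2 * A + 1) ^ k := one_le_pow₀ (by linarith)
      calc v (k + 1) ≤ A * v k + A * B := hA' k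
        _ ≤ A * ((2 * A + 1) ^ k * B) + A * ((2 * A + 1) ^ k * B) := by
          gcongr
          nlinarith
        _ ≤ _ := by
          rw [pow_succ]
          nlinarith [mul_nonneg (zero_le_one.trans h1) hB]
  have hfirst : ∀ k, k ≤ k₁ → v k ≤ (S + 2 / r) * B * stepPow α k ^ p := by
    intro k hk
    have h1 : (2 * A + 1) ^ k / stepPow α k ^ p ≤ S :=
      Finset.single_le_sum (f := fun k => (2 * A + 1) ^ k / stepPow α k ^ p)
        (fun k _ => hterm k) (Finset.mem_range.2 (by omega))
    have h2 : (2 * A + 1) ^ k / stepPow α k ^ p ≤ S + 2 / r := by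
      have : 0 ≤ 2 / r := by positivity
      linarith
    rw [div_le_iff₀ (pow_pos (stepPow_pos α k) _)] at h2
    calc v k ≤ _ := hsmall k
      _ ≤ (S + 2 / r) * stepPow α k ^ p * B := by gcongr
      _ = _ := by ring
  intro k
  rcases le_total k k₁ with hk | hk
  · exact hfirst k hk
  induction k, hk using Nat.le_induction with
  | base => exact hfirst k₁ le_rfl
  | succ k hk ih =>
    obtain ⟨⟨g1, g2⟩, g3⟩ := hk₁ k hk
    have hh := stepPow_pos α k
    set h := stepPow α k
    set K := S + 2 / r with hK
    have hKr : 2 ≤ K * r := by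
      have : 2 / r * r = 2 := by field_simp
      nlinarith
    have hK0 : 0 < K := by positivity
    -- Half of the contraction pays for the decrease of `h^p`; the other half, with `K r ≥ 2`, pays
    -- for the source.
    have hp2 : (p : ℝ) / ((k : ℝ) + 2) ≤ r / 2 * h := by
      rw [div_le_iff₀ (by positivity)] at g2 ⊢
      nlinarith
    have key : (1 - r * h) * K + h ≤ K * (1 - p / ((k : ℝ) + 2)) := by
      nlinarith
    calc v (k + 1) ≤ (1 - r * h) * v k + B * h ^ (p + 1) := hrec k g3
      _ ≤ (1 - r * h) * (K * B * h ^ p) + B * h ^ (p + 1) := by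
        have : 0 ≤ 1 - r * h := by linarith
        gcongr
      _ = B * h ^ p * ((1 - r * h) * K + h) := by ring
      _ ≤ B * h ^ p * (K * (1 - p / ((k : ℝ) + 2))) := by gcongr
      _ = K * B * (h ^ p * (1 - p / ((k : ℝ) + 2))) := by ring
      _ ≤ K * B * stepPow α (k + 1) ^ p := by
        gcongr
        exact stepPow_pow_succ_ge hα hα' p k

/-! ### Batches -/

theorem batchStart_le (a : ℕ → ℕ) (i : ℕ) : batchStart a i ≤ i := by
  classical
  exact Nat.findGreatest_le _

theorem card_Icc_batch (a : ℕ → ℕ) (i : ℕ) :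
    (Finset.Icc (batchStart a i) i).card = batchLen a i := by
  have := batchStart_le a i
  simp [batchLen]; omega

/-- The number of pairs of indices in a common batch is at most twice the sum of the lengths. -/
theorem card_pairs_le (a : ℕ → ℕ) (n : ℕ) :
    ∑ i ∈ Finset.Icc 1 n, ∑ j ∈ Finset.Icc 1 n,
        (if batchStart a i = batchStart a j then (1 : ℝ) else 0)
      ≤ 2 * ∑ i ∈ Finset.Icc 1 n, (batchLen a i : ℝ) := by
  -- An index `j ≤ i` in the batch of `i` lies in `[t_i, i]`, which has `l_i` elements. Ordering
  -- each pair costs the factor `2`.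
  have h1 : ∀ i ∈ Finset.Icc 1 n, ∑ j ∈ Finset.Icc 1 n,
      (if batchStart a i = batchStart a j ∧ j ≤ i then (1 : ℝ) else 0) ≤ batchLen a i := by
    intro i _
    rw [Finset.sum_boole, ← card_Icc_batch a i]
    norm_cast
    refine Finset.card_le_card fun j hj => ?_
    simp only [Finset.mem_filter, Finset.mem_Icc] at hj ⊢
    exact ⟨hj.2.1 ▸ batchStart_le a j, hj.2.2⟩
  have h2 : ∑ i ∈ Finset.Icc 1 n, ∑ j ∈ Finset.Icc 1 n,
      (if batchStart a i = batchStart a j ∧ j ≤ i then (1 : ℝ) else 0)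
      ≤ ∑ i ∈ Finset.Icc 1 n, (batchLen a i : ℝ) := Finset.sum_le_sum h1
  have h3 := h2
  rw [Finset.sum_comm] at h3
  calc _ ≤ ∑ i ∈ Finset.Icc 1 n, ∑ j ∈ Finset.Icc 1 n,
        ((if batchStart a i = batchStart a j ∧ j ≤ i then (1 : ℝ) else 0)
        + (if batchStart a j = batchStart a i ∧ i ≤ j then (1 : ℝ) else 0)) := by
        refine Finset.sum_le_sum fun i _ => Finset.sum_le_sum fun j _ => ?_
        rcases le_total i j with hij | hij <;>
          by_cases h : batchStart a i = batchStart a j <;> simp [h, hij] <;> split_ifs <;> norm_num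
    _ ≤ _ := by
        simp only [Finset.sum_add_distrib]
        linarith

/-- Cauchy-Schwarz over the batches: their sizes add up to `n`, and the sum of the squared sizes
counts pairs in a common batch. -/
theorem sq_le_card_image_mul (a : ℕ → ℕ) (n : ℕ) :
    (n : ℝ) ^ 2 ≤ ((Finset.Icc 1 n).image (batchStart a)).card *
      (2 * ∑ i ∈ Finset.Icc 1 n, (batchLen a i : ℝ)) := by
  classical
  set T := (Finset.Icc 1 n).image (batchStart a) with hT
  have h1 : (n : ℝ) = ∑ t ∈ T, ∑ i ∈ Finset.Icc 1 n,
      (if batchStart a i = t then (1 : ℝ) else 0) := by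
    rw [Finset.sum_comm]
    have : ∀ i ∈ Finset.Icc 1 n, ∑ t ∈ T, (if batchStart a i = t then (1 : ℝ) else 0) = 1 := by
      intro i hi
      rw [Finset.sum_ite_eq, if_pos (Finset.mem_image_of_mem _ hi)]
    rw [Finset.sum_congr rfl this]; simp
  have h2 := sq_sum_le_card_mul_sum_sq (s := T)
    (f := fun t => ∑ i ∈ Finset.Icc 1 n, (if batchStart a i = t then (1 : ℝ) else 0))
  rw [← h1] at h2
  refine h2.trans (mul_le_mul_of_nonneg_left ?_ (Nat.cast_nonneg _))
  refine le_trans (le_of_eq ?_) (card_pairs_le a n)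
  simp only [sq, Finset.sum_mul_sum]
  rw [Finset.sum_comm]
  refine Finset.sum_congr rfl fun i hi => ?_
  rw [Finset.sum_comm]
  refine Finset.sum_congr rfl fun j hj => ?_
  simp only [ite_mul, one_mul, zero_mul]
  rw [Finset.sum_ite_eq, if_pos (Finset.mem_image_of_mem _ hi)]
  simp [eq_comm]

theorem exists_batch {a : ℕ → ℕ} (ha : StrictMonoOn a (Set.Ici 1)) (h1 : a 1 = 1) {i : ℕ}
    (hi : 1 ≤ i) : ∃ m, 1 ≤ m ∧ a m ≤ i ∧ i < a (m + 1) := by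
  have hlt : ∀ m, 1 ≤ m → a m < a (m + 1) := fun m hm =>
    ha (Set.mem_Ici.2 hm) (Set.mem_Ici.2 (by omega)) (by omega)
  induction i, hi using Nat.le_induction with
  | base => exact ⟨1, le_rfl, h1.le, by have := hlt 1 le_rfl; omega⟩
  | succ i hi ih =>
    obtain ⟨m, hm, h2, h3⟩ := ih
    by_cases h : i + 1 < a (m + 1)
    · exact ⟨m, hm, by omega, h⟩
    · exact ⟨m + 1, by omega, by omega, by have := hlt (m + 1) (by omega); omega⟩

theorem batchSeq_one (C α : ℝ) : batchSeq C α 1 = 1 := by simp [batchSeq]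

/-! ### Growth of the batch boundaries and lengths -/

section growth

variable {C α : ℝ}

theorem one_le_batchSeq (hbatch : StrictMonoOn (batchSeq C α) (Set.Ici 1)) {m : ℕ} (hm : 1 ≤ m) :
    1 ≤ batchSeq C α m := by
  have := hbatch.monotoneOn (Set.mem_Ici.2 le_rfl) (Set.mem_Ici.2 hm) hm
  rwa [batchSeq_one] at this

/-- Strict monotonicity forces the floor to be at least `1`, so rounding down loses at most a factor
`2`; the `1` in the minimum covers the first boundary, which is set by hand. -/
theorem batchSeq_ge (hbatch : StrictMonoOn (batchSeq C α) (Set.Ici 1)) {m : ℕ}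
    (hm : 1 ≤ m) : min 1 (C / 2) * (m : ℝ) ^ (2 / (1 - α)) ≤ batchSeq C α m := by
  rcases hm.eq_or_lt with rfl | hm2
  · simp [batchSeq_one]
  · have h1 := one_le_batchSeq hbatch hm
    have hm' : ¬ m ≤ 1 := by omega
    simp only [batchSeq, hm', if_false] at h1 ⊢
    set y := C * (m : ℝ) ^ (2 / (1 - α)) with hy
    have h2 : 1 ≤ y := by
      by_contra h
      rw [Nat.floor_eq_zero.2 (by linarith)] at h1
      omega
    have h3 := Nat.lt_floor_add_one y
    have h4 : (1 : ℝ) ≤ ⌊y⌋₊ := by exact_mod_cast h1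
    have h5 : min 1 (C / 2) * (m : ℝ) ^ (2 / (1 - α)) ≤ y / 2 := by
      have : 0 ≤ (m : ℝ) ^ (2 / (1 - α)) := by positivity
      calc _ ≤ (C / 2) * (m : ℝ) ^ (2 / (1 - α)) := by gcongr; exact min_le_right _ _
        _ = _ := by rw [hy]; ring
    linarith

theorem batchSeq_succ_le (hC : 0 < C) (hα' : α < 1) {m : ℕ} (hm : 1 ≤ m) :
    (batchSeq C α (m + 1) : ℝ) ≤ C * 2 ^ (2 / (1 - α)) * (m : ℝ) ^ (2 / (1 - α)) := by
  have hm' : ¬ m + 1 ≤ 1 := by omega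
  have hβ : 0 < 2 / (1 - α) := div_pos two_pos (by linarith)
  have hm1 : (1 : ℝ) ≤ m := by exact_mod_cast hm
  simp only [batchSeq, hm', if_false]
  refine (Nat.floor_le (by positivity)).trans ?_
  rw [mul_assoc, ← Real.mul_rpow (by norm_num) (by positivity)]
  gcongr
  push_cast; linarith

/-- Bernoulli's inequality at `-1/(m+1)` replaces the mean value theorem for `m^β`, `β = 2/(1-α) >
1`. In the constant, `+ 1` absorbs the floor and `C 2^β` the case `m = 1`. -/
theorem batchSeq_diff_le (hC : 0 < C) (hα : 0 < α) (hα' : α < 1) :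
    ∃ c : ℝ, 0 < c ∧ ∀ m : ℕ, 1 ≤ m →
      (batchSeq C α (m + 1) : ℝ) - batchSeq C α m ≤ c * (m : ℝ) ^ (2 / (1 - α) - 1) := by
  set β := 2 / (1 - α) with hβdef
  have hβ : 1 < β := by rw [hβdef, lt_div_iff₀ (by linarith)]; linarith
  refine ⟨C * β * 2 ^ (β - 1) + 1 + C * 2 ^ β, by positivity, fun m hm => ?_⟩
  have hm1 : (1 : ℝ) ≤ m := by exact_mod_cast hm
  have hp : 1 ≤ (m : ℝ) ^ (β - 1) := Real.one_le_rpow hm1 (by linarith)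
  rcases hm.eq_or_lt with rfl | hm2
  · have := batchSeq_succ_le hC hα' (m := 1) le_rfl
    simp only [Nat.cast_one, Real.one_rpow, mul_one] at this ⊢
    have h2 : 0 < C * β * 2 ^ (β - 1) := by positivity
    have h3 : (0 : ℝ) ≤ batchSeq C α 1 := Nat.cast_nonneg _
    linarith
  · have hm' : ¬ m ≤ 1 := by omega
    have hm'' : ¬ m + 1 ≤ 1 := by omega
    simp only [batchSeq, hm', hm'', if_false]
    have h1 : (⌊C * ((m + 1 : ℕ) : ℝ) ^ β⌋₊ : ℝ) ≤ C * ((m + 1 : ℕ) : ℝ) ^ β :=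
      Nat.floor_le (by positivity)
    have h2 := Nat.lt_floor_add_one (C * (m : ℝ) ^ β)
    have hmp : (0 : ℝ) < (m : ℝ) + 1 := by positivity
    have h3 : ((m : ℝ) + 1) ^ β - (m : ℝ) ^ β ≤ β * ((m : ℝ) + 1) ^ (β - 1) := by
      have hb := one_add_mul_self_le_rpow_one_add (s := -(1 / ((m : ℝ) + 1)))
        (by rw [neg_le_neg_iff, div_le_one hmp]; linarith) hβ.le
      have e1 : 1 + -(1 / ((m : ℝ) + 1)) = m / (m + 1) := by field_simp; ring
      rw [e1, Real.div_rpow (by positivity) hmp.le, le_div_iff₀ (by positivity)] at hb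
      have e2 : ((m : ℝ) + 1) ^ (β - 1) = ((m : ℝ) + 1) ^ β / (m + 1) := Real.rpow_sub_one hmp.ne' β
      rw [e2]
      have e3 : (1 + β * -(1 / ((m : ℝ) + 1))) * ((m : ℝ) + 1) ^ β
        = ((m : ℝ) + 1) ^ β - β * (((m : ℝ) + 1) ^ β / (m + 1)) := by ring
      rw [e3] at hb
      linarith
    have h4 : ((m : ℝ) + 1) ^ (β - 1) ≤ 2 ^ (β - 1) * (m : ℝ) ^ (β - 1) := by
      rw [← Real.mul_rpow (by norm_num) (by positivity)]
      refine Real.rpow_le_rpow hmp.le (by linarith) (by linarith)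
    push_cast at h1
    have h5 : 0 ≤ C * 2 ^ β * (m : ℝ) ^ (β - 1) := by positivity
    have h6 : C * (((m : ℝ) + 1) ^ β - (m : ℝ) ^ β)
        ≤ C * (β * (2 ^ (β - 1) * (m : ℝ) ^ (β - 1))) := by
      gcongr
      exact h3.trans (by gcongr)
    push_cast
    nlinarith

theorem natCast_le_of_batchSeq_le (hC : 0 < C) (hα' : α < 1)
    (hbatch : StrictMonoOn (batchSeq C α) (Set.Ici 1)) {m i : ℕ} (hm : 1 ≤ m)
    (h : batchSeq C α m ≤ i) :
    (m : ℝ) ≤ ((i : ℝ) / min 1 (C / 2)) ^ ((1 - α) / 2) := by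
  have hc : 0 < min 1 (C / 2) := lt_min one_pos (by positivity)
  have h1 : min 1 (C / 2) * (m : ℝ) ^ (2 / (1 - α)) ≤ i :=
    (batchSeq_ge hbatch hm).trans (by exact_mod_cast h)
  have h2 : (m : ℝ) ^ (2 / (1 - α)) ≤ i / min 1 (C / 2) := by
    rw [le_div_iff₀ hc]; linarith
  calc (m : ℝ) = ((m : ℝ) ^ (2 / (1 - α))) ^ ((1 - α) / 2) := by
        rw [← Real.rpow_mul (by positivity)]
        have : 2 / (1 - α) * ((1 - α) / 2) = 1 := by
          have : 1 - α ≠ 0 := by linarith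
          field_simp
        rw [this, Real.rpow_one]
    _ ≤ _ := Real.rpow_le_rpow (by positivity) h2 (by linarith)

/-- With `β = 2/(1-α)`, an index in batch `m` satisfies `m ≲ i^{1/β}`, and that batch has length
`O(m^{β-1})`; finally `1 - 1/β = (1+α)/2`. -/
theorem exists_batchLen_le (hC : 0 < C) (hα : 0 < α) (hα' : α < 1)
    (hbatch : StrictMonoOn (batchSeq C α) (Set.Ici 1)) :
    ∃ c : ℝ, 0 < c ∧ ∀ i : ℕ, 1 ≤ i →
      (batchLen (batchSeq C α) i : ℝ) ≤ c * (i : ℝ) ^ ((1 + α) / 2) := by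
  obtain ⟨c, hc, h⟩ := batchSeq_diff_le hC hα hα'
  set c₀ := min 1 (C / 2) with hc₀
  have hc₀' : 0 < c₀ := lt_min one_pos (by positivity)
  refine ⟨c * (c₀⁻¹) ^ ((1 + α) / 2), by positivity, fun i hi => ?_⟩
  obtain ⟨m, hm, h1, h2⟩ := exists_batch hbatch (batchSeq_one C α) hi
  have h3 := batchStart_eq hbatch hm h1 h2
  have h4 : (batchLen (batchSeq C α) i : ℝ) ≤ batchSeq C α (m + 1) - batchSeq C α m := by
    unfold batchLen
    rw [h3, le_sub_iff_add_le]
    norm_cast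
    omega
  refine h4.trans ((h m hm).trans ?_)
  rw [mul_assoc]
  gcongr
  have h5 := natCast_le_of_batchSeq_le hC hα' hbatch hm h1
  have hne : 1 - α ≠ 0 := by linarith
  have hβ : 0 ≤ 2 / (1 - α) - 1 := by
    rw [sub_nonneg, le_div_iff₀ (by linarith)]; linarith
  calc (m : ℝ) ^ (2 / (1 - α) - 1)
      ≤ (((i : ℝ) / c₀) ^ ((1 - α) / 2)) ^ (2 / (1 - α) - 1) :=
        Real.rpow_le_rpow (by positivity) h5 hβ
    _ = ((i : ℝ) / c₀) ^ ((1 + α) / 2) := by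
        rw [← Real.rpow_mul (by positivity)]
        congr 1
        field_simp
        ring
    _ = _ := by
        rw [← Real.mul_rpow (by positivity) (by positivity)]
        congr 1
        field_simp

/-- Consecutive boundaries have bounded ratio, so all indices, hence all step sizes, within one
batch are comparable. -/
theorem exists_batchStart_ge (hC : 0 < C) (hα' : α < 1)
    (hbatch : StrictMonoOn (batchSeq C α) (Set.Ici 1)) :
    ∃ c : ℝ, 0 < c ∧ ∀ i : ℕ, 1 ≤ i → (i : ℝ) ≤ c * batchStart (batchSeq C α) i := by
  set c₀ := min 1 (C / 2) with hc₀
  have hc₀' : 0 < c₀ := lt_min one_pos (by positivity)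
  refine ⟨C * 2 ^ (2 / (1 - α)) / c₀, by positivity, fun i hi => ?_⟩
  obtain ⟨m, hm, h1, h2⟩ := exists_batch hbatch (batchSeq_one C α) hi
  rw [batchStart_eq hbatch hm h1 h2]
  have h3 := batchSeq_ge hbatch hm
  calc (i : ℝ) ≤ batchSeq C α (m + 1) := by exact_mod_cast h2.le
    _ ≤ C * 2 ^ (2 / (1 - α)) * (m : ℝ) ^ (2 / (1 - α)) := batchSeq_succ_le hC hα' hm
    _ = C * 2 ^ (2 / (1 - α)) / c₀ * (c₀ * (m : ℝ) ^ (2 / (1 - α))) := by field_simp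
    _ ≤ _ := by gcongr

/-- At most `O(n^{(1-α)/2})` batches meet `[1, n]`, so `sq_le_card_image_mul` forces the lengths to
have a sum of order at least `n² / n^{(1-α)/2}`. -/
theorem exists_sum_batchLen_ge (hC : 0 < C) (hα' : α < 1)
    (hbatch : StrictMonoOn (batchSeq C α) (Set.Ici 1)) :
    ∃ c : ℝ, 0 < c ∧ ∀ n : ℕ, 1 ≤ n →
      c * (n : ℝ) ^ (1 + (1 + α) / 2) ≤ ∑ i ∈ Finset.Icc 1 n, (batchLen (batchSeq C α) i : ℝ) := by
  set c₀ := min 1 (C / 2) with hc₀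
  have hc₀' : 0 < c₀ := lt_min one_pos (by positivity)
  refine ⟨(2 * (c₀⁻¹) ^ ((1 - α) / 2))⁻¹, by positivity, fun n hn => ?_⟩
  have hn0 : (0 : ℝ) < n := by exact_mod_cast hn
  set Λ := ∑ i ∈ Finset.Icc 1 n, (batchLen (batchSeq C α) i : ℝ) with hΛ
  have hΛ0 : 0 ≤ Λ := Finset.sum_nonneg fun _ _ => Nat.cast_nonneg _
  set M := ⌊((n : ℝ) / c₀) ^ ((1 - α) / 2)⌋₊ with hM
  have hsub : (Finset.Icc 1 n).image (batchStart (batchSeq C α)) ⊆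
      (Finset.Icc 1 M).image (batchSeq C α) := by
    intro t ht
    obtain ⟨i, hi, rfl⟩ := Finset.mem_image.1 ht
    rw [Finset.mem_Icc] at hi
    obtain ⟨m, hm, h1, h2⟩ := exists_batch hbatch (batchSeq_one C α) hi.1
    rw [batchStart_eq hbatch hm h1 h2]
    refine Finset.mem_image_of_mem _ (Finset.mem_Icc.2 ⟨hm, Nat.le_floor ?_⟩)
    exact natCast_le_of_batchSeq_le hC hα' hbatch hm (h1.trans hi.2)
  have hcard : (((Finset.Icc 1 n).image (batchStart (batchSeq C α))).card : ℝ)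
      ≤ ((n : ℝ) / c₀) ^ ((1 - α) / 2) := by
    have h1 : ((Finset.Icc 1 n).image (batchStart (batchSeq C α))).card ≤ M :=
      (Finset.card_le_card hsub).trans (Finset.card_image_le.trans (by simp))
    exact (Nat.cast_le.2 h1).trans (Nat.floor_le (by positivity))
  have h := sq_le_card_image_mul (batchSeq C α) n
  have h' : (n : ℝ) ^ 2 ≤ (n : ℝ) ^ ((1 - α) / 2) * ((2 * (c₀⁻¹) ^ ((1 - α) / 2)) * Λ) := by
    refine h.trans ?_
    calc _ ≤ ((n : ℝ) / c₀) ^ ((1 - α) / 2) * (2 * Λ) := by gcongr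
      _ = _ := by rw [div_eq_mul_inv, Real.mul_rpow hn0.le (by positivity)]; ring
  rw [inv_mul_le_iff₀ (by positivity)]
  have e : (n : ℝ) ^ (1 + (1 + α) / 2) = (n : ℝ) ^ 2 / (n : ℝ) ^ ((1 - α) / 2) := by
    rw [← Real.rpow_natCast, ← Real.rpow_sub hn0]
    congr 1; push_cast; ring
  rw [e, div_le_iff₀ (by positivity)]
  linarith

end growth

/-! ### Gaussian integration by parts -/

section Stein

/-- Growth of a function whose derivative grows at most linearly. -/
theorem norm_le_of_fderiv_growth {E V : Type*} [NormedAddCommGroup E] [NormedSpace ℝ E]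
    [NormedAddCommGroup V] [NormedSpace ℝ V] {φ : E → V} {φ' : E → E →L[ℝ] V}
    (hφ : ∀ x, HasFDerivAt φ (φ' x) x) {c : ℝ} (hc : ∀ x, ‖φ' x‖ ≤ c * (1 + ‖x‖)) (x : E) :
    ‖φ x‖ ≤ (‖φ 0‖ + c) * (1 + ‖x‖) ^ 2 := by
  have hc0 : 0 ≤ c := by have := (norm_nonneg _).trans (hc 0); simpa using this
  have h := (convex_closedBall (0 : E) ‖x‖).norm_image_sub_le_of_norm_hasFDerivWithin_le
    (f := φ) (f' := φ') (C := c * (1 + ‖x‖)) (fun y _ => (hφ y).hasFDerivWithinAt)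
    (fun y hy => (hc y).trans (by
      have : ‖y‖ ≤ ‖x‖ := by simpa using hy
      gcongr)) (Metric.mem_closedBall_self (norm_nonneg x)) (y := x) (by simp)
  rw [sub_zero] at h
  have h1 : ‖φ x‖ ≤ ‖φ 0‖ + c * (1 + ‖x‖) * ‖x‖ := by
    calc ‖φ x‖ = ‖φ 0 + (φ x - φ 0)‖ := by congr 1; abel
      _ ≤ _ := (norm_add_le _ _).trans (by linarith)
  have h2 := norm_nonneg x
  nlinarith [norm_nonneg (φ 0), mul_nonneg hc0 h2, mul_nonneg (norm_nonneg (φ 0)) h2,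
    mul_nonneg (mul_nonneg (norm_nonneg (φ 0)) h2) h2]

variable {E : Type*} [NormedAddCommGroup E] [InnerProductSpace ℝ E] [FiniteDimensional ℝ E]
  [MeasurableSpace E] [BorelSpace E]
  {V : Type*} [NormedAddCommGroup V]

theorem integrable_one_add_norm_pow_stdGaussian (k : ℕ) :
    Integrable (fun u : E => (1 + ‖u‖) ^ k) (stdGaussian E) := by
  have h : MemLp (fun u : E => 1 + ‖u‖) k (stdGaussian E) :=
    (memLp_const (1 : ℝ)).add (IsGaussian.memLp_id (stdGaussian E) k (by simp)).norm
  have := h.integrable_norm_pow' (p := k)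
  refine this.congr (Filter.Eventually.of_forall fun u => ?_)
  simp only [Real.norm_eq_abs]
  rw [abs_of_nonneg (by positivity)]

theorem integrable_of_le_pow_stdGaussian {f : E → V} (hf : AEStronglyMeasurable f (stdGaussian E))
    (c : ℝ) (k : ℕ) (h : ∀ u, ‖f u‖ ≤ c * (1 + ‖u‖) ^ k) : Integrable f (stdGaussian E) :=
  ((integrable_one_add_norm_pow_stdGaussian k).const_mul c).mono' hf (Filter.Eventually.of_forall h)

theorem integrable_one_add_norm_pow_stdGaussian_prod (k : ℕ) :
    Integrable (fun p : E × E => (1 + ‖p.1‖ + ‖p.2‖) ^ k)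
      ((stdGaussian E).prod (stdGaussian E)) := by
  have h0 := (IsGaussian.memLp_id (stdGaussian E) k (by simp)).norm
  have h : MemLp (fun p : E × E => 1 + ‖p.1‖ + ‖p.2‖) k
      ((stdGaussian E).prod (stdGaussian E)) :=
    ((memLp_const (1 : ℝ)).add (h0.comp_fst _)).add (h0.comp_snd _)
  have := h.integrable_norm_pow' (p := k)
  refine this.congr (Filter.Eventually.of_forall fun u => ?_)
  simp only [Real.norm_eq_abs]
  rw [abs_of_nonneg (by positivity)]

theorem integrable_of_le_pow_stdGaussian_prod {f : E × E → V}
    (hf : AEStronglyMeasurable f ((stdGaussian E).prod (stdGaussian E)))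
    (c : ℝ) (k : ℕ) (h : ∀ u, ‖f u‖ ≤ c * (1 + ‖u.1‖ + ‖u.2‖) ^ k) :
    Integrable f ((stdGaussian E).prod (stdGaussian E)) :=
  ((integrable_one_add_norm_pow_stdGaussian_prod k).const_mul c).mono' hf
    (Filter.Eventually.of_forall h)

theorem integrable_inner_smul_stdGaussian (v : E) :
    Integrable (fun u : E => inner ℝ u v • u) (stdGaussian E) := by
  refine integrable_of_le_pow_stdGaussian (by fun_prop) ‖v‖ 2 fun u => ?_
  rw [norm_smul]
  have := norm_inner_le_norm (𝕜 := ℝ) u v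
  have h1 := norm_nonneg u
  have h2 := norm_nonneg v
  calc _ ≤ ‖u‖ * ‖v‖ * ‖u‖ := by gcongr
    _ = ‖v‖ * ‖u‖ ^ 2 := by ring
    _ ≤ _ := by gcongr; linarith

theorem integral_inner_smul_stdGaussian (v : E) :
    ∫ u, inner ℝ u v • u ∂(stdGaussian E) = v := by
  refine ext_inner_right ℝ fun w => ?_
  have h := integral_inner (𝕜 := ℝ) (integrable_inner_smul_stdGaussian v) w
  rw [real_inner_comm, ← h]
  have h2 := covarianceBilin_apply (μ := stdGaussian E) IsGaussian.memLp_two_id v w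
  rw [covarianceBilin_stdGaussian] at h2
  simp only [id_eq, integral_id_stdGaussian, sub_zero] at h2
  refine Eq.trans ?_ (Eq.symm (show inner ℝ v w = _ from h2))
  refine integral_congr_ae (Filter.Eventually.of_forall fun u => ?_)
  simp only [inner_smul_right, real_inner_comm]

variable [NormedSpace ℝ V] [CompleteSpace V]

/-- **Stein's identity** for the standard Gaussian measure. -/
theorem integral_inner_smul_eq_integral_fderiv {φ : E → V} {φ' : E → E →L[ℝ] V}
    (hφ : ∀ x, HasFDerivAt φ (φ' x) x) (hcont : Continuous φ') {c : ℝ}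
    (hc : ∀ x, ‖φ' x‖ ≤ c * (1 + ‖x‖)) (v : E) :
    ∫ u, inner ℝ u v • φ u ∂(stdGaussian E) = ∫ u, φ' u v ∂(stdGaussian E) := by
  set γ := stdGaussian E with hγ
  have hc0 : 0 ≤ c := by have := (norm_nonneg _).trans (hc 0); simpa using this
  have hφc : Continuous φ := continuous_iff_continuousAt.2 fun x => (hφ x).continuousAt
  have hφg := norm_le_of_fderiv_growth hφ hc
  set I := ∫ u, inner ℝ u v • φ u ∂γ with hI
  -- Rotation argument: `K` is computed exactly by rotation invariance of the Gaussian pair and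
  -- differentiated at `0` in two ways.
  set K : ℝ → V := fun θ => ∫ p : E × E, inner ℝ p.2 v • φ (Real.cos θ • p.1 + Real.sin θ • p.2)
    ∂(γ.prod γ) with hK
  have hint1 : Integrable (fun u : E => inner ℝ u v • φ u) γ := by
    refine integrable_of_le_pow_stdGaussian (by fun_prop) (‖v‖ * (‖φ 0‖ + c)) 3 fun u => ?_
    rw [norm_smul]
    calc _ ≤ (‖u‖ * ‖v‖) * ((‖φ 0‖ + c) * (1 + ‖u‖) ^ 2) := by
          gcongr
          · exact norm_inner_le_norm u v
          · exact hφg u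
      _ ≤ ((1 + ‖u‖) * ‖v‖) * ((‖φ 0‖ + c) * (1 + ‖u‖) ^ 2) := by gcongr; linarith
      _ = _ := by ring
  have hφint : Integrable φ γ := integrable_of_le_pow_stdGaussian (by fun_prop) _ 2 hφg
  -- In rotated coordinates the argument of `φ` becomes the first coordinate, and the old second
  -- coordinate is `sin θ • p.1 + cos θ • p.2`. The cosine part drops out since it is centred and
  -- independent of the first coordinate.
  have hK1 : ∀ θ, K θ = Real.sin θ • I := by
    intro θ
    have hrot := IsGaussian.map_rotation_eq_self (μ := γ) (by simp [hγ]) θ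
    have hK' : K θ = ∫ p : E × E, (inner ℝ (Real.sin θ • p.1 + Real.cos θ • p.2) v) • φ p.1
        ∂(γ.prod γ) := by
      conv_rhs => rw [← hrot]
      rw [integral_map (by fun_prop) (by fun_prop)]
      refine integral_congr_ae (Filter.Eventually.of_forall fun p => ?_)
      have e : Real.sin θ • (Real.cos θ • p.1 + Real.sin θ • p.2)
          + Real.cos θ • (-Real.sin θ • p.1 + Real.cos θ • p.2) = p.2 := by
        have h1 := Real.sin_sq_add_cos_sq θ
        have : p.2 = (Real.sin θ ^ 2 + Real.cos θ ^ 2) • p.2 := by rw [h1, one_smul]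
        conv_rhs => rw [this]
        module
      simp only [ContinuousLinearMap.rotation_apply, e]
    rw [hK']
    have e1 : Integrable (fun p : E × E => Real.sin θ • ((inner ℝ p.1 v) • φ p.1)) (γ.prod γ) :=
      (hint1.comp_fst γ).smul _
    have hinn : Integrable (fun u : E => inner ℝ u v) γ := by
      refine integrable_of_le_pow_stdGaussian (by fun_prop) ‖v‖ 1 fun u => ?_
      have := norm_inner_le_norm (𝕜 := ℝ) u v
      nlinarith [norm_nonneg v]
    have e2 : Integrable (fun p : E × E => Real.cos θ • ((inner ℝ p.2 v) • φ p.1)) (γ.prod γ) := by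
      refine Integrable.smul _ ?_
      exact (Integrable.smul_prod hinn hφint).swap
    have e3 : ∫ p : E × E, (inner ℝ p.2 v) • φ p.1 ∂(γ.prod γ) = 0 := by
      have hi : Integrable (fun p : E × E => (inner ℝ p.2 v) • φ p.1) (γ.prod γ) :=
        (Integrable.smul_prod hinn hφint).swap
      rw [integral_prod _ hi]
      have h0 : ∫ u, inner ℝ u v ∂γ = 0 := by
        have := integral_strongDual_stdGaussian (E := E) (innerSL ℝ v)
        simp only [innerSL_apply_apply] at this
        rw [← this]
        exact integral_congr_ae (Filter.Eventually.of_forall fun u => real_inner_comm _ _)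
      simp [integral_smul_const, h0]
    calc _ = ∫ p : E × E, (Real.sin θ • ((inner ℝ p.1 v) • φ p.1) +
            Real.cos θ • ((inner ℝ p.2 v) • φ p.1)) ∂(γ.prod γ) := by
          refine integral_congr_ae (Filter.Eventually.of_forall fun p => ?_)
          simp only [inner_add_left, real_inner_smul_left]
          module
      _ = Real.sin θ • I := by
          rw [integral_add e1 e2, integral_smul, integral_smul, e3, smul_zero, add_zero,
            integral_fun_fst (f := fun u : E => inner ℝ u v • φ u)]
          simp [hI]
  -- Differentiation under the integral sign; the linear growth of `φ'` gives a cubic majorant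
  -- uniform in `θ`.
  have hK2 : HasDerivAt K (∫ p : E × E, inner ℝ p.2 v • φ' p.1 p.2 ∂(γ.prod γ)) 0 := by
    have h := (hasDerivAt_integral_of_dominated_loc_of_deriv_le (μ := γ.prod γ) (𝕜 := ℝ)
      (F := fun θ p => inner ℝ p.2 v • φ (Real.cos θ • p.1 + Real.sin θ • p.2))
      (F' := fun θ p => inner ℝ p.2 v • φ' (Real.cos θ • p.1 + Real.sin θ • p.2)
        (-Real.sin θ • p.1 + Real.cos θ • p.2)) (x₀ := 0)
      (bound := fun p => (‖v‖ * c) * (1 + ‖p.1‖ + ‖p.2‖) ^ 3)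
      Filter.univ_mem (Filter.Eventually.of_forall fun θ => by fun_prop) ?_ (by fun_prop) ?_
      ((integrable_one_add_norm_pow_stdGaussian_prod 3).const_mul _) ?_).2
    · simpa using h
    · simp only [Real.cos_zero, Real.sin_zero, one_smul, zero_smul, add_zero]
      refine integrable_of_le_pow_stdGaussian_prod (by fun_prop) (‖v‖ * (‖φ 0‖ + c)) 3 fun p => ?_
      rw [norm_smul]
      have n1 := norm_nonneg p.1
      have n2 := norm_nonneg p.2
      calc _ ≤ (‖p.2‖ * ‖v‖) * ((‖φ 0‖ + c) * (1 + ‖p.1‖) ^ 2) := by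
            gcongr
            · exact norm_inner_le_norm _ v
            · exact hφg _
        _ ≤ ((1 + ‖p.1‖ + ‖p.2‖) * ‖v‖) * ((‖φ 0‖ + c) * (1 + ‖p.1‖ + ‖p.2‖) ^ 2) := by
            have m1 : 1 + ‖p.1‖ ≤ 1 + ‖p.1‖ + ‖p.2‖ := by linarith
            have m2 : ‖p.2‖ ≤ 1 + ‖p.1‖ + ‖p.2‖ := by linarith
            gcongr ?_ * _ * (_ * ?_ ^ 2)
        _ = _ := by ring
    · refine Filter.Eventually.of_forall fun p θ _ => ?_
      have n1 := norm_nonneg p.1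
      have n2 := norm_nonneg p.2
      have b1 : ‖Real.cos θ • p.1 + Real.sin θ • p.2‖ ≤ ‖p.1‖ + ‖p.2‖ := by
        refine (norm_add_le _ _).trans ?_
        simp only [norm_smul, Real.norm_eq_abs]
        nlinarith [Real.abs_cos_le_one θ, Real.abs_sin_le_one θ]
      have b2 : ‖-Real.sin θ • p.1 + Real.cos θ • p.2‖ ≤ ‖p.1‖ + ‖p.2‖ := by
        refine (norm_add_le _ _).trans ?_
        simp only [norm_smul, Real.norm_eq_abs, abs_neg]
        nlinarith [Real.abs_cos_le_one θ, Real.abs_sin_le_one θ]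
      rw [norm_smul]
      calc _ ≤ (‖p.2‖ * ‖v‖) * ((c * (1 + (‖p.1‖ + ‖p.2‖))) * (‖p.1‖ + ‖p.2‖)) := by
            gcongr
            · exact norm_inner_le_norm _ v
            · refine (ContinuousLinearMap.le_opNorm _ _).trans ?_
              gcongr
              exact (hc _).trans (by gcongr)
        _ ≤ ((1 + ‖p.1‖ + ‖p.2‖) * ‖v‖) *
            ((c * (1 + (‖p.1‖ + ‖p.2‖))) * (1 + ‖p.1‖ + ‖p.2‖)) := by
            gcongr <;> linarith
        _ = _ := by ring
    · refine Filter.Eventually.of_forall fun p θ _ => ?_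
      have d1 : HasDerivAt (fun θ : ℝ => Real.cos θ • p.1 + Real.sin θ • p.2)
          (-Real.sin θ • p.1 + Real.cos θ • p.2) θ :=
        ((Real.hasDerivAt_cos θ).smul_const _).add ((Real.hasDerivAt_sin θ).smul_const _)
      exact ((hφ _).comp_hasDerivAt θ d1).const_smul _
  have hK3 : HasDerivAt K I 0 := by
    have := (Real.hasDerivAt_sin 0).smul_const I
    rw [Real.cos_zero, one_smul] at this
    exact this.congr_of_eventuallyEq (Filter.Eventually.of_forall hK1)
  -- Integrating out the second coordinate replaces `⟨u', v⟩ u'` by its mean `v`, the covariance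
  -- being the identity.
  rw [hK3.unique hK2, integral_prod]
  · refine integral_congr_ae (Filter.Eventually.of_forall fun u => ?_)
    have := (φ' u).integral_comp_comm (integrable_inner_smul_stdGaussian v)
    rw [integral_inner_smul_stdGaussian] at this
    refine Eq.trans ?_ this
    refine integral_congr_ae (Filter.Eventually.of_forall fun u' => ?_)
    simp
  · refine integrable_of_le_pow_stdGaussian_prod (by fun_prop) (‖v‖ * c) 3 fun p => ?_
    have n1 := norm_nonneg p.1
    have n2 := norm_nonneg p.2
    rw [norm_smul]
    calc _ ≤ (‖p.2‖ * ‖v‖) * ((c * (1 + ‖p.1‖)) * ‖p.2‖) := by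
          gcongr
          · exact norm_inner_le_norm _ v
          · refine (ContinuousLinearMap.le_opNorm _ _).trans ?_
            gcongr
            exact hc _
      _ ≤ ((1 + ‖p.1‖ + ‖p.2‖) * ‖v‖) * ((c * (1 + ‖p.1‖ + ‖p.2‖)) * (1 + ‖p.1‖ + ‖p.2‖)) := by
          have m1 : 1 + ‖p.1‖ ≤ 1 + ‖p.1‖ + ‖p.2‖ := by linarith
          have m2 : ‖p.2‖ ≤ 1 + ‖p.1‖ + ‖p.2‖ := by linarith
          gcongr ?_ * _ * (_ * ?_ * ?_)
      _ = _ := by ring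

end Stein

/-! ### Gaussian smoothing -/

section Smoothing

variable {E : Type*} [NormedAddCommGroup E] [InnerProductSpace ℝ E]

/-- Mean value theorem for `t ↦ ⟨g(y + t(x-y)), x-y⟩` on `[0, 1]`. -/
theorem inner_gradient_sub_ge {g : E → E} {h : E → E →L[ℝ] E} {μ : ℝ}
    (hg : ∀ x, HasFDerivAt g (h x) x) (hμ : ∀ x v, μ * ‖v‖ ^ 2 ≤ inner ℝ (h x v) v) (x y : E) :
    μ * ‖x - y‖ ^ 2 ≤ inner ℝ (g x - g y) (x - y) := by
  have hd : ∀ t : ℝ, HasDerivAt (fun t : ℝ => inner ℝ (g (y + t • (x - y))) (x - y))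
      (inner ℝ (h (y + t • (x - y)) (x - y)) (x - y)) t := by
    intro t
    have h1 : HasDerivAt (fun t : ℝ => y + t • (x - y)) (x - y) t := by
      simpa using ((hasDerivAt_id t).smul_const (x - y)).const_add y
    have h2 := (hg (y + t • (x - y))).comp_hasDerivAt t h1
    simpa using h2.inner ℝ (hasDerivAt_const t (x - y))
  obtain ⟨t, -, ht⟩ := exists_hasDerivAt_eq_slope
    (fun t : ℝ => inner ℝ (g (y + t • (x - y))) (x - y)) _ zero_lt_one
    (fun t _ => (hd t).continuousAt.continuousWithinAt) (fun t _ => hd t)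
  have h1 := hμ (y + t • (x - y)) (x - y)
  rw [ht] at h1
  simpa [inner_sub_left] using h1

variable {f : E → ℝ} {g : E → E} {h : E → E →L[ℝ] E} {M : ℝ}

theorem norm_sub_le_of_hasFDerivAt (hg : ∀ x, HasFDerivAt g (h x) x) (hM : ∀ x, ‖h x‖ ≤ M)
    (x y : E) : ‖g x - g y‖ ≤ M * ‖x - y‖ :=
  (convex_univ (𝕜 := ℝ) (E := E)).norm_image_sub_le_of_norm_hasFDerivWithin_le
    (fun z _ => (hg z).hasFDerivWithinAt) (fun z _ => hM z) (Set.mem_univ y) (Set.mem_univ x)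

theorem norm_le_one_add_norm (hg : ∀ x, HasFDerivAt g (h x) x) (hM : ∀ x, ‖h x‖ ≤ M) (x : E) :
    ‖g x‖ ≤ (‖g 0‖ + M) * (1 + ‖x‖) := by
  have h1 := norm_sub_le_of_hasFDerivAt hg hM x 0
  rw [sub_zero] at h1
  have h2 : ‖g x‖ ≤ ‖g 0‖ + ‖g x - g 0‖ := by
    calc ‖g x‖ = ‖g 0 + (g x - g 0)‖ := by congr 1; abel
      _ ≤ _ := norm_add_le _ _
  have h3 : 0 ≤ M := (norm_nonneg _).trans (hM 0)
  nlinarith [norm_nonneg (g 0), norm_nonneg x, mul_nonneg (norm_nonneg (g 0)) (norm_nonneg x)]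

theorem one_add_norm_add_smul_le (x u : E) (ν : ℝ) :
    1 + ‖x + ν • u‖ ≤ (1 + ‖x‖ + |ν|) * (1 + ‖u‖) := by
  have := norm_add_le x (ν • u)
  rw [norm_smul, Real.norm_eq_abs] at this
  nlinarith [norm_nonneg x, norm_nonneg u, abs_nonneg ν, mul_nonneg (norm_nonneg x) (norm_nonneg u)]

variable [FiniteDimensional ℝ E]

theorem continuous_toDual_comp {X : Type*} [TopologicalSpace X] {k : X → E} (hk : Continuous k) :
    Continuous (fun x => InnerProductSpace.toDual ℝ E (k x)) :=
  (InnerProductSpace.toDual ℝ E).continuous.comp hk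

theorem abs_le_of_hasGradientAt (hf : ∀ x, HasGradientAt f (g x) x)
    (hg : ∀ x, HasFDerivAt g (h x) x) (hM : ∀ x, ‖h x‖ ≤ M) (x : E) :
    ‖f x‖ ≤ (‖f 0‖ + (‖g 0‖ + M)) * (1 + ‖x‖) ^ 2 :=
  norm_le_of_fderiv_growth (φ' := fun x => InnerProductSpace.toDual ℝ E (g x)) hf
    (fun y => by
      rw [LinearIsometryEquiv.norm_map]
      exact norm_le_one_add_norm hg hM y) x

theorem continuous_of_hasGradientAt (hf : ∀ x, HasGradientAt f (g x) x) : Continuous f :=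
  continuous_iff_continuousAt.2 fun x => (hf x).continuousAt

variable [MeasurableSpace E] [BorelSpace E]

theorem integrable_comp_add_smul (hg : ∀ x, HasFDerivAt g (h x) x) (hM : ∀ x, ‖h x‖ ≤ M)
    (ν : ℝ) (x : E) : Integrable (fun u => g (x + ν • u)) (stdGaussian E) := by
  have hgc : Continuous g := continuous_iff_continuousAt.2 fun x => (hg x).continuousAt
  refine integrable_of_le_pow_stdGaussian (by fun_prop) ((‖g 0‖ + M) * (1 + ‖x‖ + |ν|)) 1
    fun u => ?_
  have hM0 : 0 ≤ M := (norm_nonneg _).trans (hM 0)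
  calc _ ≤ (‖g 0‖ + M) * (1 + ‖x + ν • u‖) := norm_le_one_add_norm hg hM _
    _ ≤ (‖g 0‖ + M) * ((1 + ‖x‖ + |ν|) * (1 + ‖u‖)) := by
      gcongr; exact one_add_norm_add_smul_le x u ν
    _ = _ := by ring

theorem integrable_hessian_comp_add_smul (hcont : Continuous h) (hM : ∀ x, ‖h x‖ ≤ M)
    (ν : ℝ) (x : E) : Integrable (fun u => h (x + ν • u)) (stdGaussian E) :=
  integrable_of_le_pow_stdGaussian (by fun_prop) M 0 fun u => by simpa using hM _

theorem hasFDerivAt_integral_comp_add_smul (hg : ∀ x, HasFDerivAt g (h x) x) (hcont : Continuous h)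
    (hM : ∀ x, ‖h x‖ ≤ M) (ν : ℝ) (x : E) :
    HasFDerivAt (fun x => ∫ u, g (x + ν • u) ∂(stdGaussian E))
      (∫ u, h (x + ν • u) ∂(stdGaussian E)) x := by
  have hgc : Continuous g := continuous_iff_continuousAt.2 fun x => (hg x).continuousAt
  refine hasFDerivAt_integral_of_dominated_of_fderiv_le (F := fun x u => g (x + ν • u))
    (F' := fun x u => h (x + ν • u)) (bound := fun _ => M) Filter.univ_mem
    (Filter.Eventually.of_forall fun y => by fun_prop) (integrable_comp_add_smul hg hM ν x)
    (by fun_prop) (Filter.Eventually.of_forall fun u y _ => hM _) (integrable_const _)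
    (Filter.Eventually.of_forall fun u y _ => ?_)
  have := (hg (y + ν • u)).comp y ((hasFDerivAt_id y).add_const (ν • u))
  simpa [Function.comp_def] using this

theorem hasGradientAt_integral_comp_add_smul (hf : ∀ x, HasGradientAt f (g x) x)
    (hg : ∀ x, HasFDerivAt g (h x) x) (hM : ∀ x, ‖h x‖ ≤ M) (ν : ℝ) (x : E) :
    HasGradientAt (fun x => ∫ u, f (x + ν • u) ∂(stdGaussian E))
      (∫ u, g (x + ν • u) ∂(stdGaussian E)) x := by
  have hM0 : 0 ≤ M := (norm_nonneg _).trans (hM 0)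
  have hgc : Continuous g := continuous_iff_continuousAt.2 fun x => (hg x).continuousAt
  have hfc : Continuous f := continuous_of_hasGradientAt hf
  have hD : Continuous (fun x => InnerProductSpace.toDual ℝ E (g x)) := continuous_toDual_comp hgc
  rw [hasGradientAt_iff_hasFDerivAt]
  have e : InnerProductSpace.toDual ℝ E (∫ u, g (x + ν • u) ∂(stdGaussian E))
      = ∫ u, InnerProductSpace.toDual ℝ E (g (x + ν • u)) ∂(stdGaussian E) :=
    ((InnerProductSpace.toDual ℝ E).toContinuousLinearEquiv.toContinuousLinearMap.integral_comp_comm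
      (integrable_comp_add_smul hg hM ν x)).symm
  rw [e]
  refine hasFDerivAt_integral_of_dominated_of_fderiv_le (F := fun x u => f (x + ν • u))
    (F' := fun x u => InnerProductSpace.toDual ℝ E (g (x + ν • u)))
    (bound := fun u => (‖g 0‖ + M) * (2 + ‖x‖ + |ν|) * (1 + ‖u‖) ^ 1)
    (Metric.ball_mem_nhds x one_pos)
    (Filter.Eventually.of_forall fun y => by fun_prop) ?_
    (Continuous.aestronglyMeasurable (by fun_prop)) (Filter.Eventually.of_forall fun u y hy => ?_)
    ((integrable_one_add_norm_pow_stdGaussian 1).const_mul _)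
    (Filter.Eventually.of_forall fun u y _ => ?_)
  · refine integrable_of_le_pow_stdGaussian (by fun_prop)
      ((‖f 0‖ + (‖g 0‖ + M)) * (1 + ‖x‖ + |ν|) ^ 2) 2 fun u => ?_
    calc _ ≤ (‖f 0‖ + (‖g 0‖ + M)) * (1 + ‖x + ν • u‖) ^ 2 := abs_le_of_hasGradientAt hf hg hM _
      _ ≤ (‖f 0‖ + (‖g 0‖ + M)) * ((1 + ‖x‖ + |ν|) * (1 + ‖u‖)) ^ 2 := by
        gcongr; exact one_add_norm_add_smul_le x u ν
      _ = _ := by ring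
  · rw [LinearIsometryEquiv.norm_map]
    have hyx : ‖y‖ ≤ 1 + ‖x‖ := by
      have h1 := norm_add_le (y - x) x
      rw [Metric.mem_ball, dist_eq_norm] at hy
      rw [sub_add_cancel] at h1
      linarith
    calc _ ≤ (‖g 0‖ + M) * (1 + ‖y + ν • u‖) := norm_le_one_add_norm hg hM _
      _ ≤ (‖g 0‖ + M) * ((1 + ‖y‖ + |ν|) * (1 + ‖u‖)) := by
        gcongr; exact one_add_norm_add_smul_le y u ν
      _ ≤ (‖g 0‖ + M) * ((1 + (1 + ‖x‖) + |ν|) * (1 + ‖u‖)) := by gcongr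
      _ = _ := by ring
  · have := (hf (y + ν • u)).hasFDerivAt.comp y ((hasFDerivAt_id y).add_const (ν • u))
    simpa [Function.comp_def] using this

/-- The two-point estimator is unbiased for the gradient of the smoothed function. -/
theorem integral_two_point_eq (hf : ∀ x, HasGradientAt f (g x) x)
    (hg : ∀ x, HasFDerivAt g (h x) x) (hM : ∀ x, ‖h x‖ ≤ M) {ν : ℝ} (hν : ν ≠ 0) (x : E) :
    Integrable (fun u => ((f (x + ν • u) - f x) / ν) • u) (stdGaussian E) ∧
    ∫ u, ((f (x + ν • u) - f x) / ν) • u ∂(stdGaussian E)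
      = ∫ u, g (x + ν • u) ∂(stdGaussian E) := by
  have hM0 : 0 ≤ M := (norm_nonneg _).trans (hM 0)
  have hgc : Continuous g := continuous_iff_continuousAt.2 fun x => (hg x).continuousAt
  have hfc : Continuous f := continuous_of_hasGradientAt hf
  set c := (‖f 0‖ + (‖g 0‖ + M)) * (1 + ‖x‖ + |ν|) ^ 2 with hc
  have hfb : ∀ u, ‖f (x + ν • u)‖ ≤ c * (1 + ‖u‖) ^ 2 := fun u => by
    calc _ ≤ (‖f 0‖ + (‖g 0‖ + M)) * (1 + ‖x + ν • u‖) ^ 2 := abs_le_of_hasGradientAt hf hg hM _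
      _ ≤ (‖f 0‖ + (‖g 0‖ + M)) * ((1 + ‖x‖ + |ν|) * (1 + ‖u‖)) ^ 2 := by
        gcongr; exact one_add_norm_add_smul_le x u ν
      _ = _ := by rw [hc]; ring
  have hfx : ‖f x‖ ≤ c := by simpa using hfb 0
  have hc0 : 0 ≤ c := (norm_nonneg _).trans hfx
  have hint : Integrable (fun u => ((f (x + ν • u) - f x) / ν) • u) (stdGaussian E) := by
    refine integrable_of_le_pow_stdGaussian (by fun_prop) (2 * c * |ν|⁻¹) 3 fun u => ?_
    rw [norm_smul, norm_div, Real.norm_eq_abs ν, div_eq_mul_inv]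
    have hu := norm_nonneg u
    calc _ ≤ (c * (1 + ‖u‖) ^ 2 + c * (1 + ‖u‖) ^ 2) * |ν|⁻¹ * (1 + ‖u‖) := by
          gcongr
          · refine (norm_sub_le _ _).trans (add_le_add (hfb u) (hfx.trans ?_))
            exact le_mul_of_one_le_right hc0 (one_le_pow₀ (by linarith))
          · linarith
      _ = _ := by ring
  refine ⟨hint, ext_inner_right ℝ fun v => ?_⟩
  rw [real_inner_comm, ← integral_inner (𝕜 := ℝ) hint v, real_inner_comm,
    ← integral_inner (𝕜 := ℝ) (integrable_comp_add_smul hg hM ν x) v]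
  have hφ : ∀ u, HasFDerivAt (fun u => f (x + ν • u))
      (ν • InnerProductSpace.toDual ℝ E (g (x + ν • u))) u := fun u => by
    have h1 : HasFDerivAt (fun u : E => x + ν • u) (ν • ContinuousLinearMap.id ℝ E) u :=
      ((hasFDerivAt_id u).const_smul ν).const_add x
    have := (hf (x + ν • u)).hasFDerivAt.comp u h1
    simpa [Function.comp_def, ContinuousLinearMap.comp_smul] using this
  -- Stein's identity for `u ↦ f (x + ν • u)`: the chain rule yields a factor `ν`, which cancels the
  -- division in the estimator. The term with `f x` vanishes because `u` is centred.
  have hst := integral_inner_smul_eq_integral_fderiv hφ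
    ((continuous_toDual_comp (by fun_prop)).const_smul ν)
    (c := |ν| * ((‖g 0‖ + M) * (1 + ‖x‖ + |ν|))) (fun u => by
      rw [norm_smul, LinearIsometryEquiv.norm_map, Real.norm_eq_abs, mul_assoc]
      gcongr
      calc _ ≤ (‖g 0‖ + M) * (1 + ‖x + ν • u‖) := norm_le_one_add_norm hg hM _
        _ ≤ (‖g 0‖ + M) * ((1 + ‖x‖ + |ν|) * (1 + ‖u‖)) := by
          gcongr; exact one_add_norm_add_smul_le x u ν
        _ = _ := by ring) v
  have h0 : ∫ u, inner ℝ u v ∂(stdGaussian E) = 0 := by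
    have := integral_strongDual_stdGaussian (E := E) (innerSL ℝ v)
    refine Eq.trans ?_ this
    exact integral_congr_ae (Filter.Eventually.of_forall fun u => real_inner_comm _ _)
  have i0 : Integrable (fun u => inner ℝ u v * f x) (stdGaussian E) := by
    refine Integrable.mul_const ?_ _
    refine integrable_of_le_pow_stdGaussian (by fun_prop) ‖v‖ 1 fun u => ?_
    have := norm_inner_le_norm (𝕜 := ℝ) u v
    nlinarith [norm_nonneg v]
  have i1 : Integrable (fun u => inner ℝ u v * f (x + ν • u)) (stdGaussian E) := by
    refine integrable_of_le_pow_stdGaussian (by fun_prop) (‖v‖ * c) 3 fun u => ?_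
    rw [norm_mul]
    calc _ ≤ ((1 + ‖u‖) * ‖v‖) * (c * (1 + ‖u‖) ^ 2) := by
          gcongr
          · refine (norm_inner_le_norm u v).trans ?_
            gcongr; linarith
          · exact hfb u
      _ = _ := by ring
  simp only [smul_eq_mul, smul_apply, InnerProductSpace.toDual_apply_apply] at hst
  rw [integral_const_mul] at hst
  calc _ = ν⁻¹ * (∫ u, inner ℝ u v * f (x + ν • u) ∂(stdGaussian E)
        - ∫ u, inner ℝ u v * f x ∂(stdGaussian E)) := by
        rw [← integral_sub i1 i0, ← integral_const_mul]
        refine integral_congr_ae (Filter.Eventually.of_forall fun u => ?_)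
        simp only [inner_smul_right, real_inner_comm]
        ring
    _ = _ := by
        rw [integral_mul_const, h0, zero_mul, sub_zero, hst, inv_mul_cancel_left₀ hν]
        exact integral_congr_ae (Filter.Eventually.of_forall fun u => real_inner_comm _ _)

/-- Stein's identity writes `ν` times the averaged Hessian applied to `v` as the mean of `⟨u, v⟩ g(z
+ ν u)`, in which the Hessian no longer occurs. The Lipschitz bound on `g` thus suffices, with no
modulus of continuity for `h`, at the cost of `1/ν`. -/
theorem norm_integral_hessian_sub_le (hg : ∀ x, HasFDerivAt g (h x) x) (hcont : Continuous h)
    (hM : ∀ x, ‖h x‖ ≤ M) {ν : ℝ} (hν : 0 < ν) (x y : E) :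
    ‖∫ u, h (x + ν • u) ∂(stdGaussian E) - ∫ u, h (y + ν • u) ∂(stdGaussian E)‖
      ≤ M * (∫ u, ‖u‖ ∂(stdGaussian E)) / ν * ‖x - y‖ := by
  have hM0 : 0 ≤ M := (norm_nonneg _).trans (hM 0)
  have hgc : Continuous g := continuous_iff_continuousAt.2 fun x => (hg x).continuousAt
  have hI0 : 0 ≤ ∫ u, ‖u‖ ∂(stdGaussian E) := integral_nonneg fun _ => norm_nonneg _
  refine ContinuousLinearMap.opNorm_le_bound _ (by positivity) fun v => ?_
  have hst : ∀ z : E, ∫ u, inner ℝ u v • g (z + ν • u) ∂(stdGaussian E)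
      = ν • (∫ u, h (z + ν • u) ∂(stdGaussian E)) v := by
    intro z
    have hφ : ∀ u, HasFDerivAt (fun u => g (z + ν • u)) (ν • h (z + ν • u)) u := fun u => by
      have h1 : HasFDerivAt (fun u : E => z + ν • u) (ν • ContinuousLinearMap.id ℝ E) u :=
        ((hasFDerivAt_id u).const_smul ν).const_add z
      have := (hg (z + ν • u)).comp u h1
      simpa [Function.comp_def, ContinuousLinearMap.comp_smul] using this
    rw [integral_inner_smul_eq_integral_fderiv hφ (by fun_prop) (c := |ν| * M) (fun u => by
      rw [norm_smul, Real.norm_eq_abs]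
      have := norm_nonneg u
      calc _ ≤ |ν| * M := by gcongr; exact hM _
        _ ≤ _ := le_mul_of_one_le_right (by positivity) (by linarith)) v]
    rw [ContinuousLinearMap.integral_apply (integrable_hessian_comp_add_smul hcont hM ν z),
      ← integral_smul]
    rfl
  have hint : ∀ z : E, Integrable (fun u => inner ℝ u v • g (z + ν • u)) (stdGaussian E) := by
    intro z
    refine integrable_of_le_pow_stdGaussian (by fun_prop)
      (‖v‖ * ((‖g 0‖ + M) * (1 + ‖z‖ + |ν|))) 2 fun u => ?_
    rw [norm_smul]
    calc _ ≤ ((1 + ‖u‖) * ‖v‖) * ((‖g 0‖ + M) * ((1 + ‖z‖ + |ν|) * (1 + ‖u‖))) := by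
          gcongr
          · refine (norm_inner_le_norm u v).trans ?_
            gcongr; linarith
          · refine (norm_le_one_add_norm hg hM _).trans ?_
            gcongr; exact one_add_norm_add_smul_le z u ν
      _ = _ := by ring
  have hnu : Integrable (fun u : E => ‖u‖) (stdGaussian E) := IsGaussian.integrable_id.norm
  have key : ν * ‖(∫ u, h (x + ν • u) ∂(stdGaussian E) - ∫ u, h (y + ν • u) ∂(stdGaussian E)) v‖
      ≤ M * ‖x - y‖ * ‖v‖ * ∫ u, ‖u‖ ∂(stdGaussian E) := by
    calc _ = ‖∫ u, (inner ℝ u v • g (x + ν • u) - inner ℝ u v • g (y + ν • u))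
            ∂(stdGaussian E)‖ := by
          rw [integral_sub (hint x) (hint y), hst, hst, ← smul_sub, norm_smul, Real.norm_eq_abs,
            abs_of_pos hν]
          rfl
      _ ≤ ∫ u, M * ‖x - y‖ * ‖v‖ * ‖u‖ ∂(stdGaussian E) := by
          refine norm_integral_le_of_norm_le (hnu.const_mul _)
            (Filter.Eventually.of_forall fun u => ?_)
          rw [← smul_sub, norm_smul]
          have h1 := norm_sub_le_of_hasFDerivAt hg hM (x + ν • u) (y + ν • u)
          rw [add_sub_add_right_eq_sub] at h1
          calc _ ≤ (‖u‖ * ‖v‖) * (M * ‖x - y‖) := by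
                gcongr; exact norm_inner_le_norm u v
            _ = _ := by ring
      _ = _ := integral_const_mul _ _
  calc _ = (ν * ‖(∫ u, h (x + ν • u) ∂(stdGaussian E)
        - ∫ u, h (y + ν • u) ∂(stdGaussian E)) v‖) / ν := by field_simp
    _ ≤ (M * ‖x - y‖ * ‖v‖ * ∫ u, ‖u‖ ∂(stdGaussian E)) / ν := by gcongr
    _ = _ := by ring

/-- Taylor's formula with the Lipschitz Hessian of the smoothed function. This supplies the
quadratic linearization error of the mean field, and its constant is the only one that blows up as
`ν → 0`. -/
theorem norm_integral_gradient_sub_le (hg : ∀ x, HasFDerivAt g (h x) x) (hcont : Continuous h)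
    (hM : ∀ x, ‖h x‖ ≤ M) {ν : ℝ} (hν : 0 < ν) (x v : E) :
    ‖∫ u, g (x + v + ν • u) ∂(stdGaussian E) - ∫ u, g (x + ν • u) ∂(stdGaussian E)
      - (∫ u, h (x + ν • u) ∂(stdGaussian E)) v‖
      ≤ M * (∫ u, ‖u‖ ∂(stdGaussian E)) / ν * ‖v‖ ^ 2 := by
  have hM0 : 0 ≤ M := (norm_nonneg _).trans (hM 0)
  have hI0 : 0 ≤ ∫ u, ‖u‖ ∂(stdGaussian E) := integral_nonneg fun _ => norm_nonneg _
  have := (convex_closedBall x ‖v‖).norm_image_sub_le_of_norm_hasFDerivWithin_le'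
    (f := fun x => ∫ u, g (x + ν • u) ∂(stdGaussian E))
    (f' := fun x => ∫ u, h (x + ν • u) ∂(stdGaussian E))
    (φ := ∫ u, h (x + ν • u) ∂(stdGaussian E))
    (C := M * (∫ u, ‖u‖ ∂(stdGaussian E)) / ν * ‖v‖)
    (fun y _ => (hasFDerivAt_integral_comp_add_smul hg hcont hM ν y).hasFDerivWithinAt)
    (fun y hy => (norm_integral_hessian_sub_le hg hcont hM hν y x).trans (by
      rw [Metric.mem_closedBall, dist_eq_norm] at hy
      gcongr)) (Metric.mem_closedBall_self (norm_nonneg v)) (y := x + v) (by simp)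
  rw [add_sub_cancel_left] at this
  refine this.trans (le_of_eq (by ring))

theorem inner_integral_gradient_sub_ge {μ : ℝ} (hg : ∀ x, HasFDerivAt g (h x) x)
    (hM : ∀ x, ‖h x‖ ≤ M) (hμ : ∀ x v, μ * ‖v‖ ^ 2 ≤ inner ℝ (h x v) v) (ν : ℝ) (x y : E) :
    μ * ‖x - y‖ ^ 2 ≤ inner ℝ (∫ u, g (x + ν • u) ∂(stdGaussian E)
      - ∫ u, g (y + ν • u) ∂(stdGaussian E)) (x - y) := by
  have i1 := integrable_comp_add_smul hg hM ν x
  have i2 := integrable_comp_add_smul hg hM ν y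
  have i3 : Integrable (fun u => g (x + ν • u) - g (y + ν • u)) (stdGaussian E) := i1.sub i2
  rw [← integral_sub i1 i2, real_inner_comm, ← integral_inner (𝕜 := ℝ) i3]
  have h1 : ∫ _ : E, μ * ‖x - y‖ ^ 2 ∂(stdGaussian E) = μ * ‖x - y‖ ^ 2 := by simp
  rw [← h1]
  refine integral_mono (integrable_const _) (i3.const_inner _) fun u => ?_
  have := inner_gradient_sub_ge hg hμ (x + ν • u) (y + ν • u)
  rw [add_sub_add_right_eq_sub, real_inner_comm] at this
  exact this

theorem inner_integral_hessian_ge {μ : ℝ} (hcont : Continuous h)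
    (hM : ∀ x, ‖h x‖ ≤ M) (hμ : ∀ x v, μ * ‖v‖ ^ 2 ≤ inner ℝ (h x v) v) (ν : ℝ) (x v : E) :
    μ * ‖v‖ ^ 2 ≤ inner ℝ ((∫ u, h (x + ν • u) ∂(stdGaussian E)) v) v := by
  have i1 := integrable_hessian_comp_add_smul hcont hM ν x
  have i2 : Integrable (fun u => h (x + ν • u) v) (stdGaussian E) := i1.apply_continuousLinearMap v
  rw [ContinuousLinearMap.integral_apply i1, real_inner_comm, ← integral_inner (𝕜 := ℝ) i2]
  have h1 : ∫ _ : E, μ * ‖v‖ ^ 2 ∂(stdGaussian E) = μ * ‖v‖ ^ 2 := by simp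
  rw [← h1]
  refine integral_mono (integrable_const _) (i2.const_inner _) fun u => ?_
  have := hμ (x + ν • u) v
  rwa [real_inner_comm] at this

theorem inner_integral_hessian_symm (hcont : Continuous h)
    (hM : ∀ x, ‖h x‖ ≤ M) (hs : ∀ x v w, inner ℝ (h x v) w = inner ℝ v (h x w)) (ν : ℝ)
    (x v w : E) :
    inner ℝ ((∫ u, h (x + ν • u) ∂(stdGaussian E)) v) w
      = inner ℝ v ((∫ u, h (x + ν • u) ∂(stdGaussian E)) w) := by
  have i1 := integrable_hessian_comp_add_smul hcont hM ν x
  rw [ContinuousLinearMap.integral_apply i1, ContinuousLinearMap.integral_apply i1,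
    real_inner_comm, ← integral_inner (𝕜 := ℝ) (i1.apply_continuousLinearMap v),
    ← integral_inner (𝕜 := ℝ) (i1.apply_continuousLinearMap w)]
  refine integral_congr_ae (Filter.Eventually.of_forall fun u => ?_)
  simp only
  rw [← hs, real_inner_comm]

end Smoothing

/-! ### Independence -/

section Independence

variable {Ω W : Type*} [MeasurableSpace W]

/-- The σ-algebra generated by the random elements `w i`, `i ∈ S`. -/
abbrev sigmaOf (w : ℕ → Ω → W) (S : Set ℕ) : MeasurableSpace Ω :=
  ⨆ i ∈ S, MeasurableSpace.comap (w i) inferInstance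

theorem sigmaOf_mono (w : ℕ → Ω → W) {S T : Set ℕ} (h : S ⊆ T) : sigmaOf w S ≤ sigmaOf w T :=
  biSup_mono h

theorem measurable_sigmaOf (w : ℕ → Ω → W) {S : Set ℕ} {i : ℕ} (hi : i ∈ S) :
    Measurable[sigmaOf w S] (w i) :=
  Measurable.mono (comap_measurable (w i))
    (le_iSup₂_of_le (f := fun i (_ : i ∈ S) => MeasurableSpace.comap (w i) inferInstance) i hi
      le_rfl)
    le_rfl

variable [mΩ : MeasurableSpace Ω] {P : Measure Ω} {w : ℕ → Ω → W}

theorem sigmaOf_le (hw : ∀ i, Measurable (w i)) (S : Set ℕ) : sigmaOf w S ≤ mΩ :=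
  iSup₂_le fun i _ => (hw i).comap_le

theorem indepFun_of_sigmaOf (hw : ∀ i, Measurable (w i)) (hindep : iIndepFun w P) {S T : Set ℕ}
    (hST : Disjoint S T) {A B : Type*} [MeasurableSpace A] [MeasurableSpace B] {X : Ω → A}
    {Y : Ω → B} (hX : Measurable[sigmaOf w S] X) (hY : Measurable[sigmaOf w T] Y) :
    IndepFun X Y P := by
  rw [IndepFun_iff_Indep]
  have h := indep_iSup_of_disjoint (fun i => (hw i).comap_le) hindep hST
  exact indep_of_indep_of_le_left (indep_of_indep_of_le_right h hY.comap_le) hX.comap_le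

variable {A B V : Type*} [MeasurableSpace A] [MeasurableSpace B] [NormedAddCommGroup V]
  [IsProbabilityMeasure P] {X : Ω → A} {Y : Ω → B} {π : Measure B} [IsProbabilityMeasure π]

/-- Fubini for a function of two independent random elements. -/
theorem integral_comp_indepFun [NormedSpace ℝ V] (hX : Measurable X) (hY : HasLaw Y π P)
    (hXY : IndepFun X Y P) {Φ : A → B → V} (hΦ : StronglyMeasurable (Function.uncurry Φ))
    (hint : Integrable (fun ω => Φ (X ω) (Y ω)) P) :
    ∫ ω, Φ (X ω) (Y ω) ∂P = ∫ ω, ∫ y, Φ (X ω) y ∂π ∂P := by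
  have hmap := (indepFun_iff_map_prod_eq_prod_map_map hX.aemeasurable hY.aemeasurable).1 hXY
  rw [hY.map_eq] at hmap
  have hXYm : AEMeasurable (fun ω => (X ω, Y ω)) P := hX.aemeasurable.prodMk hY.aemeasurable
  have : IsProbabilityMeasure (P.map X) := Measure.isProbabilityMeasure_map hX.aemeasurable
  have h1 : ∫ ω, Φ (X ω) (Y ω) ∂P
      = ∫ p, Function.uncurry Φ p ∂(P.map fun ω => (X ω, Y ω)) :=
    (integral_map hXYm hΦ.aestronglyMeasurable).symm
  have hi : Integrable (Function.uncurry Φ) ((P.map X).prod π) := by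
    rw [← hmap]
    exact (integrable_map_measure hΦ.aestronglyMeasurable hXYm).2 hint
  rw [h1, hmap, integral_prod _ hi, integral_map hX.aemeasurable]
  · rfl
  · exact (hΦ.integral_prod_right (ν := π)).aestronglyMeasurable

/-- Tonelli conditionally on `X`: a moment bound for every frozen value of `X` integrates to a bound
on the joint moment, with integrability as a conclusion. -/
theorem integrable_comp_indepFun (hX : Measurable X) (hY : HasLaw Y π P)
    (hXY : IndepFun X Y P) {Φ : A → B → ℝ} (hΦ : Measurable (Function.uncurry Φ))
    (h0 : ∀ x y, 0 ≤ Φ x y) (hi : ∀ x, Integrable (Φ x) π) {ψ : A → ℝ}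
    (hψ : ∀ x, ∫ y, Φ x y ∂π ≤ ψ x) (hψi : Integrable (fun ω => ψ (X ω)) P) :
    Integrable (fun ω => Φ (X ω) (Y ω)) P ∧
      ∫ ω, Φ (X ω) (Y ω) ∂P ≤ ∫ ω, ψ (X ω) ∂P := by
  have hmap := (indepFun_iff_map_prod_eq_prod_map_map hX.aemeasurable hY.aemeasurable).1 hXY
  rw [hY.map_eq] at hmap
  have hXYm : AEMeasurable (fun ω => (X ω, Y ω)) P := hX.aemeasurable.prodMk hY.aemeasurable
  have : IsProbabilityMeasure (P.map X) := Measure.isProbabilityMeasure_map hX.aemeasurable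
  have hsm : StronglyMeasurable (fun x => ∫ y, Φ x y ∂π) :=
    hΦ.stronglyMeasurable.integral_prod_right (ν := π)
  have hm : Integrable (fun ω => ∫ y, Φ (X ω) y ∂π) P := by
    refine hψi.mono' (hsm.comp_measurable hX).aestronglyMeasurable
      (Filter.Eventually.of_forall fun ω => ?_)
    rw [Real.norm_eq_abs, abs_of_nonneg (integral_nonneg (h0 _))]
    exact hψ _
  have hint : Integrable (fun ω => Φ (X ω) (Y ω)) P := by
    have : Integrable (Function.uncurry Φ) ((P.map X).prod π) := by
      rw [integrable_prod_iff hΦ.aestronglyMeasurable]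
      refine ⟨Filter.Eventually.of_forall hi, ?_⟩
      rw [integrable_map_measure _ hX.aemeasurable]
      · refine hm.congr (Filter.Eventually.of_forall fun ω => ?_)
        refine integral_congr_ae (Filter.Eventually.of_forall fun y => ?_)
        simp [abs_of_nonneg (h0 (X ω) y)]
      · exact (hΦ.norm.stronglyMeasurable.integral_prod_right (ν := π)).aestronglyMeasurable
    rw [← hmap] at this
    exact (integrable_map_measure hΦ.aestronglyMeasurable hXYm).1 this
  refine ⟨hint, ?_⟩
  rw [integral_comp_indepFun hX hY hXY hΦ.stronglyMeasurable hint]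
  exact integral_mono hm hψi fun ω => hψ _

end Independence

/-! ### Moments -/

section Moments

variable {Ω : Type*} [MeasurableSpace Ω] {P : Measure Ω} [IsProbabilityMeasure P]
  {E : Type*} [NormedAddCommGroup E]

theorem integrable_norm_pow_of_le {X : Ω → E} (hX : AEStronglyMeasurable X P) {m k : ℕ}
    (hmk : m ≤ k) (h : Integrable (fun ω => ‖X ω‖ ^ k) P) : Integrable (fun ω => ‖X ω‖ ^ m) P := by
  refine ((integrable_const (1 : ℝ)).add h).mono' (hX.norm.pow m)
    (Filter.Eventually.of_forall fun ω => ?_)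
  simp only [Pi.add_apply]
  rw [Real.norm_eq_abs, abs_of_nonneg (by positivity)]
  rcases le_total ‖X ω‖ 1 with h1 | h1
  · have := pow_le_one₀ (n := m) (norm_nonneg _) h1
    have := pow_nonneg (norm_nonneg (X ω)) k
    linarith
  · have := pow_le_pow_right₀ h1 hmk
    linarith

theorem sq_integral_le_integral_sq {Z : Ω → ℝ} (h1 : Integrable Z P)
    (h2 : Integrable (fun ω => Z ω ^ 2) P) : (∫ ω, Z ω ∂P) ^ 2 ≤ ∫ ω, Z ω ^ 2 ∂P := by
  set m := ∫ ω, Z ω ∂P with hm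
  have h : 0 ≤ ∫ ω, (Z ω - m) ^ 2 ∂P := integral_nonneg fun ω => sq_nonneg _
  have e : ∫ ω, (Z ω - m) ^ 2 ∂P = ∫ ω, Z ω ^ 2 ∂P - 2 * m * m + m ^ 2 := by
    have : ∀ ω, (Z ω - m) ^ 2 = Z ω ^ 2 - 2 * m * Z ω + m ^ 2 := fun ω => by ring
    simp_rw [this]
    have i1 : Integrable (fun ω => Z ω ^ 2 - 2 * m * Z ω) P := h2.sub (h1.const_mul _)
    rw [integral_add i1 (integrable_const _), integral_sub h2 (h1.const_mul _),
      integral_const_mul]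
    simp [hm]
  nlinarith

theorem second_moment_le_of_fourth {X : Ω → E} (hX : AEStronglyMeasurable X P)
    (h : Integrable (fun ω => ‖X ω‖ ^ 4) P) {b : ℝ} (hb : 0 ≤ b)
    (hle : ∫ ω, ‖X ω‖ ^ 4 ∂P ≤ b ^ 2) : ∫ ω, ‖X ω‖ ^ 2 ∂P ≤ b := by
  have h2 := integrable_norm_pow_of_le hX (by norm_num : 2 ≤ 4) h
  have e : ∀ ω, (‖X ω‖ ^ 2) ^ 2 = ‖X ω‖ ^ 4 := fun ω => by ring
  have := sq_integral_le_integral_sq h2 (by simpa only [e] using h)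
  simp only [e] at this
  exact le_of_sq_le_sq (this.trans hle) hb

theorem sq_norm_integral_le [NormedSpace ℝ E] {X : Ω → E} (hX : AEStronglyMeasurable X P)
    (h : Integrable (fun ω => ‖X ω‖ ^ 2) P) : ‖∫ ω, X ω ∂P‖ ^ 2 ≤ ∫ ω, ‖X ω‖ ^ 2 ∂P := by
  have h1 : Integrable (fun ω => ‖X ω‖) P := by
    simpa using integrable_norm_pow_of_le hX (by norm_num : 1 ≤ 2) h
  refine le_trans ?_ (sq_integral_le_integral_sq h1 h)
  exact pow_le_pow_left₀ (norm_nonneg _) (norm_integral_le_integral_norm _) 2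

theorem add_sq_le_two (a b : ℝ) : (a + b) ^ 2 ≤ 2 * a ^ 2 + 2 * b ^ 2 := by
  nlinarith [sq_nonneg (a - b)]

theorem add_pow_four_le (a b : ℝ) : (a + b) ^ 4 ≤ 8 * a ^ 4 + 8 * b ^ 4 := by
  have h1 := add_sq_le_two a b
  have h2 := add_sq_le_two (a ^ 2) (b ^ 2)
  have : ((a + b) ^ 2) ^ 2 ≤ (2 * a ^ 2 + 2 * b ^ 2) ^ 2 :=
    pow_le_pow_left₀ (sq_nonneg _) h1 2
  nlinarith

theorem norm_add_sq_le_two (a b : E) : ‖a + b‖ ^ 2 ≤ 2 * ‖a‖ ^ 2 + 2 * ‖b‖ ^ 2 :=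
  (pow_le_pow_left₀ (norm_nonneg _) (norm_add_le a b) 2).trans (add_sq_le_two _ _)

theorem norm_add_pow_four_le (a b : E) : ‖a + b‖ ^ 4 ≤ 8 * ‖a‖ ^ 4 + 8 * ‖b‖ ^ 4 :=
  (pow_le_pow_left₀ (norm_nonneg _) (norm_add_le a b) 4).trans (add_pow_four_le _ _)

/-- Only the first-order term is kept exactly, since it carries the drift; the other inner products
in the expansion are absorbed by Cauchy-Schwarz and Young. -/
theorem norm_sub_pow_four_le [InnerProductSpace ℝ E] (a b : E) :
    ‖a - b‖ ^ 4 ≤ ‖a‖ ^ 4 - 4 * (‖a‖ ^ 2 * inner ℝ a b) + 8 * (‖a‖ ^ 2 * ‖b‖ ^ 2)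
      + 3 * ‖b‖ ^ 4 := by
  have e : ‖a - b‖ ^ 4 = (‖a - b‖ ^ 2) ^ 2 := by ring
  rw [e, norm_sub_sq_real]
  have h := abs_le.1 (abs_real_inner_le_norm a b)
  set i := inner ℝ a b
  have hi : i ^ 2 ≤ ‖a‖ ^ 2 * ‖b‖ ^ 2 := by
    rw [← mul_pow]; exact sq_le_sq' h.1 h.2
  have h2 : -(i * ‖b‖ ^ 2) * 2 ≤ ‖a‖ ^ 2 * ‖b‖ ^ 2 + ‖b‖ ^ 4 := by
    nlinarith [sq_nonneg (i + ‖b‖ ^ 2)]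
  nlinarith

end Moments

/-! ### The stochastic recursion -/

/-- A random field `g`, with noise of law `π`, whose mean is `μ`-monotone and vanishes at `0`, with
fourth moments controlled by the noise level `s` and the Lipschitz constant `κ`. -/
structure IsNoisyField {E W : Type*} [NormedAddCommGroup E] [InnerProductSpace ℝ E]
    [MeasurableSpace E] [MeasurableSpace W] (g : E → W → E) (π : Measure W) (μ κ s : ℝ) :
    Prop where
  measurable : Measurable (Function.uncurry g)
  s_pos : 0 < s
  integrable_zero : Integrable (fun w => ‖g 0 w‖ ^ 4) π
  fourth_zero : ∫ w, ‖g 0 w‖ ^ 4 ∂π ≤ s ^ 2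
  integrable_sub : ∀ y, Integrable (fun w => ‖g y w - g 0 w‖ ^ 4) π
  fourth_sub : ∀ y, ∫ w, ‖g y w - g 0 w‖ ^ 4 ∂π ≤ (κ ^ 2 * ‖y‖ ^ 2) ^ 2
  mean_zero : ∫ w, g 0 w ∂π = 0
  mono : ∀ y, μ * ‖y‖ ^ 2 ≤ inner ℝ (∫ w, g y w ∂π) y

namespace IsNoisyField

variable {E W : Type*} [NormedAddCommGroup E] [InnerProductSpace ℝ E]
  [MeasurableSpace E] [MeasurableSpace W] {g : E → W → E} {π : Measure W} {μ κ s : ℝ}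

theorem measurable_apply (hg : IsNoisyField g π μ κ s) (y : E) : Measurable (g y) :=
  hg.measurable.comp measurable_prodMk_left

theorem measurable_comp (hg : IsNoisyField g π μ κ s) {Ω : Type*} {mΩ : MeasurableSpace Ω}
    {X : Ω → E} {Y : Ω → W} (hX : Measurable X) (hY : Measurable Y) :
    Measurable (fun ω => g (X ω) (Y ω)) :=
  hg.measurable.comp (hX.prodMk hY)

set_option linter.unusedSectionVars false

variable [FiniteDimensional ℝ E] [BorelSpace E] [IsProbabilityMeasure π]

theorem integrable_fourth (hg : IsNoisyField g π μ κ s) (y : E) :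
    Integrable (fun w => ‖g y w‖ ^ 4) π := by
  refine (((hg.integrable_sub y).const_mul 8).add (hg.integrable_zero.const_mul 8)).mono'
    ((hg.measurable_apply y).norm.pow_const 4).aestronglyMeasurable
    (Filter.Eventually.of_forall fun w => ?_)
  rw [Real.norm_eq_abs, abs_of_nonneg (by positivity)]
  simpa using norm_add_pow_four_le (g y w - g 0 w) (g 0 w)

theorem fourth_le (hg : IsNoisyField g π μ κ s) (y : E) :
    ∫ w, ‖g y w‖ ^ 4 ∂π ≤ 8 * κ ^ 4 * ‖y‖ ^ 4 + 8 * s ^ 2 := by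
  calc _ ≤ ∫ w, (8 * ‖g y w - g 0 w‖ ^ 4 + 8 * ‖g 0 w‖ ^ 4) ∂π := by
        refine integral_mono (hg.integrable_fourth y)
          (((hg.integrable_sub y).const_mul 8).add (hg.integrable_zero.const_mul 8)) fun w => ?_
        simpa using norm_add_pow_four_le (g y w - g 0 w) (g 0 w)
    _ = 8 * ∫ w, ‖g y w - g 0 w‖ ^ 4 ∂π + 8 * ∫ w, ‖g 0 w‖ ^ 4 ∂π := by
        rw [integral_add ((hg.integrable_sub y).const_mul 8) (hg.integrable_zero.const_mul 8),
          integral_const_mul, integral_const_mul]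
    _ ≤ 8 * (κ ^ 2 * ‖y‖ ^ 2) ^ 2 + 8 * s ^ 2 := by
        gcongr
        · exact hg.fourth_sub y
        · exact hg.fourth_zero
    _ = _ := by ring

theorem integrable_sq (hg : IsNoisyField g π μ κ s) (y : E) :
    Integrable (fun w => ‖g y w‖ ^ 2) π :=
  integrable_norm_pow_of_le (hg.measurable_apply y).aestronglyMeasurable (by norm_num)
    (hg.integrable_fourth y)

theorem integrable_apply (hg : IsNoisyField g π μ κ s) (y : E) : Integrable (g y) π := by
  rw [← integrable_norm_iff (hg.measurable_apply y).aestronglyMeasurable]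
  simpa using integrable_norm_pow_of_le (hg.measurable_apply y).aestronglyMeasurable
    (by norm_num : 1 ≤ 4) (hg.integrable_fourth y)

theorem second_zero (hg : IsNoisyField g π μ κ s) : ∫ w, ‖g 0 w‖ ^ 2 ∂π ≤ s :=
  second_moment_le_of_fourth (hg.measurable_apply 0).aestronglyMeasurable hg.integrable_zero
    hg.s_pos.le hg.fourth_zero

theorem aestronglyMeasurable_sub (hg : IsNoisyField g π μ κ s) (y : E) :
    AEStronglyMeasurable (fun w => g y w - g 0 w) π :=
  ((hg.measurable_apply y).sub (hg.measurable_apply 0)).aestronglyMeasurable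

theorem integrable_sub_sq (hg : IsNoisyField g π μ κ s) (y : E) :
    Integrable (fun w => ‖g y w - g 0 w‖ ^ 2) π :=
  integrable_norm_pow_of_le (hg.aestronglyMeasurable_sub y) (by norm_num) (hg.integrable_sub y)

theorem second_sub (hg : IsNoisyField g π μ κ s) (y : E) :
    ∫ w, ‖g y w - g 0 w‖ ^ 2 ∂π ≤ κ ^ 2 * ‖y‖ ^ 2 :=
  second_moment_le_of_fourth (hg.aestronglyMeasurable_sub y) (hg.integrable_sub y)
    (by positivity) (hg.fourth_sub y)

theorem second_le (hg : IsNoisyField g π μ κ s) (y : E) :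
    ∫ w, ‖g y w‖ ^ 2 ∂π ≤ 2 * κ ^ 2 * ‖y‖ ^ 2 + 2 * s := by
  have i1 := (hg.integrable_sub_sq y).const_mul 2
  have i2 := (hg.integrable_sq 0).const_mul 2
  calc _ ≤ ∫ w, (2 * ‖g y w - g 0 w‖ ^ 2 + 2 * ‖g 0 w‖ ^ 2) ∂π := by
        refine integral_mono (hg.integrable_sq y) (i1.add i2) fun w => ?_
        simpa using norm_add_sq_le_two (g y w - g 0 w) (g 0 w)
    _ = 2 * ∫ w, ‖g y w - g 0 w‖ ^ 2 ∂π + 2 * ∫ w, ‖g 0 w‖ ^ 2 ∂π := by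
        rw [integral_add i1 i2, integral_const_mul, integral_const_mul]
    _ ≤ 2 * (κ ^ 2 * ‖y‖ ^ 2) + 2 * s := by
        gcongr
        · exact hg.second_sub y
        · exact hg.second_zero
    _ = _ := by ring

/-- As the mean at `0` vanishes, the mean at `y` is the mean of the increment `g y - g 0`, so no `s`
appears. -/
theorem sq_norm_mean_le (hg : IsNoisyField g π μ κ s) (y : E) :
    ‖∫ w, g y w ∂π‖ ^ 2 ≤ κ ^ 2 * ‖y‖ ^ 2 := by
  have e : ∫ w, g y w ∂π = ∫ w, (g y w - g 0 w) ∂π := by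
    rw [integral_sub (hg.integrable_apply y) (hg.integrable_apply 0), hg.mean_zero, sub_zero]
  rw [e]
  exact (sq_norm_integral_le (hg.aestronglyMeasurable_sub y) (hg.integrable_sub_sq y)).trans
    (hg.second_sub y)

variable {Ω : Type*} [MeasurableSpace Ω] {P : Measure Ω} [IsProbabilityMeasure P]
  {X : Ω → E} {Y : Ω → W}

theorem integrable_fourth_comp (hg : IsNoisyField g π μ κ s) (hX : Measurable X)
    (hY : HasLaw Y π P) (hXY : IndepFun X Y P) (hX4 : Integrable (fun ω => ‖X ω‖ ^ 4) P) :
    Integrable (fun ω => ‖g (X ω) (Y ω)‖ ^ 4) P ∧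
      ∫ ω, ‖g (X ω) (Y ω)‖ ^ 4 ∂P ≤ 8 * κ ^ 4 * ∫ ω, ‖X ω‖ ^ 4 ∂P + 8 * s ^ 2 := by
  have i1 := hX4.const_mul (8 * κ ^ 4)
  have h := integrable_comp_indepFun hX hY hXY (Φ := fun y w => ‖g y w‖ ^ 4)
    (ψ := fun y => 8 * κ ^ 4 * ‖y‖ ^ 4 + 8 * s ^ 2) (hg.measurable.norm.pow_const 4)
    (fun _ _ => by positivity) hg.integrable_fourth hg.fourth_le (i1.add (integrable_const _))
  refine ⟨h.1, h.2.trans (le_of_eq ?_)⟩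
  rw [integral_add i1 (integrable_const _), integral_const_mul]
  simp

theorem integral_sq_comp_le (hg : IsNoisyField g π μ κ s) (hX : Measurable X)
    (hY : HasLaw Y π P) (hXY : IndepFun X Y P) (hX4 : Integrable (fun ω => ‖X ω‖ ^ 4) P) :
    ∫ ω, ‖g (X ω) (Y ω)‖ ^ 2 ∂P ≤ 2 * κ ^ 2 * ∫ ω, ‖X ω‖ ^ 2 ∂P + 2 * s := by
  have i1 := (integrable_norm_pow_of_le hX.aestronglyMeasurable (by norm_num : 2 ≤ 4)
    hX4).const_mul (2 * κ ^ 2)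
  have h := integrable_comp_indepFun hX hY hXY (Φ := fun y w => ‖g y w‖ ^ 2)
    (ψ := fun y => 2 * κ ^ 2 * ‖y‖ ^ 2 + 2 * s) (hg.measurable.norm.pow_const 2)
    (fun _ _ => by positivity) hg.integrable_sq hg.second_le (i1.add (integrable_const _))
  refine h.2.trans (le_of_eq ?_)
  rw [integral_add i1 (integrable_const _), integral_const_mul]
  simp

/-- One step of the recursion: second and fourth moments. -/
theorem step (hg : IsNoisyField g π μ κ s) (hX : Measurable X) (hYm : Measurable Y)
    (hY : HasLaw Y π P) (hXY : IndepFun X Y P) (hX4 : Integrable (fun ω => ‖X ω‖ ^ 4) P)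
    {t : ℝ} (ht : 0 ≤ t) :
    Integrable (fun ω => ‖X ω - t • g (X ω) (Y ω)‖ ^ 4) P ∧
    ∫ ω, ‖X ω - t • g (X ω) (Y ω)‖ ^ 2 ∂P
      ≤ (1 - 2 * μ * t + 2 * κ ^ 2 * t ^ 2) * ∫ ω, ‖X ω‖ ^ 2 ∂P + 2 * s * t ^ 2 ∧
    ∫ ω, ‖X ω - t • g (X ω) (Y ω)‖ ^ 4 ∂P
      ≤ (1 - 4 * μ * t + 16 * κ ^ 2 * t ^ 2 + 24 * κ ^ 4 * t ^ 4) * ∫ ω, ‖X ω‖ ^ 4 ∂P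
        + 16 * s * t ^ 2 * ∫ ω, ‖X ω‖ ^ 2 ∂P + 24 * s ^ 2 * t ^ 4 := by
  set G : Ω → E := fun ω => g (X ω) (Y ω) with hGdef
  have hG : Measurable G := hg.measurable_comp hX hYm
  have hX2 := integrable_norm_pow_of_le hX.aestronglyMeasurable (by norm_num : 2 ≤ 4) hX4
  obtain ⟨hG4, hG4le⟩ := hg.integrable_fourth_comp hX hY hXY hX4
  have hG2 := integrable_norm_pow_of_le hG.aestronglyMeasurable (by norm_num : 2 ≤ 4) hG4
  have hG2le := hg.integral_sq_comp_le hX hY hXY hX4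
  have hinn : Integrable (fun ω => inner ℝ (X ω) (G ω)) P := by
    refine (hX2.add hG2).mono' (hX.inner hG).aestronglyMeasurable
      (Filter.Eventually.of_forall fun ω => ?_)
    refine (norm_inner_le_norm _ _).trans ?_
    simp only [Pi.add_apply]
    nlinarith [sq_nonneg (‖X ω‖ - ‖G ω‖), sq_nonneg ‖X ω‖, sq_nonneg ‖G ω‖]
  have hmix : Integrable (fun ω => ‖X ω‖ ^ 2 * ‖G ω‖ ^ 2) P := by
    refine (hX4.add hG4).mono'
      ((hX.norm.pow_const 2).mul (hG.norm.pow_const 2)).aestronglyMeasurable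
      (Filter.Eventually.of_forall fun ω => ?_)
    rw [Real.norm_eq_abs, abs_of_nonneg (by positivity)]
    simp only [Pi.add_apply]
    nlinarith [sq_nonneg (‖X ω‖ ^ 2 - ‖G ω‖ ^ 2), sq_nonneg (‖X ω‖ ^ 2), sq_nonneg (‖G ω‖ ^ 2)]
  have hinn3 : Integrable (fun ω => ‖X ω‖ ^ 2 * inner ℝ (X ω) (G ω)) P := by
    refine (hX4.add hmix).mono' ((hX.norm.pow_const 2).mul (hX.inner hG)).aestronglyMeasurable
      (Filter.Eventually.of_forall fun ω => ?_)
    rw [norm_mul, Real.norm_eq_abs (‖X ω‖ ^ 2), abs_of_nonneg (by positivity)]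
    simp only [Pi.add_apply]
    have h1 : ‖inner ℝ (X ω) (G ω)‖ ≤ ‖X ω‖ ^ 2 + ‖G ω‖ ^ 2 := by
      refine (norm_inner_le_norm _ _).trans ?_
      nlinarith [sq_nonneg (‖X ω‖ - ‖G ω‖), sq_nonneg ‖X ω‖, sq_nonneg ‖G ω‖]
    calc _ ≤ ‖X ω‖ ^ 2 * (‖X ω‖ ^ 2 + ‖G ω‖ ^ 2) := by gcongr
      _ = _ := by ring
  -- Conditioning on `X` replaces the noisy direction by its mean, to which monotonicity applies.
  have hmean : μ * ∫ ω, ‖X ω‖ ^ 2 ∂P ≤ ∫ ω, inner ℝ (X ω) (G ω) ∂P := by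
    have e := integral_comp_indepFun hX hY hXY (Φ := fun y w => inner ℝ y (g y w))
      (Measurable.stronglyMeasurable (measurable_fst.inner hg.measurable)) hinn
    have e2 : ∀ y, ∫ w, inner ℝ y (g y w) ∂π = inner ℝ y (∫ w, g y w ∂π) := fun y =>
      integral_inner (hg.integrable_apply y) y
    simp only [e2] at e
    rw [hGdef, e, ← integral_const_mul]
    refine integral_mono (hX2.const_mul _) ?_ fun ω => ?_
    · refine (hX2.const_mul (1 + κ ^ 2)).mono' ?_ (Filter.Eventually.of_forall fun ω => ?_)
      · have hsm : StronglyMeasurable (fun y => ∫ w, g y w ∂π) :=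
          hg.measurable.stronglyMeasurable.integral_prod_right (ν := π)
        exact (hX.inner (hsm.measurable.comp hX)).aestronglyMeasurable
      · refine (norm_inner_le_norm _ _).trans ?_
        have := hg.sq_norm_mean_le (X ω)
        nlinarith [sq_nonneg (‖X ω‖ - ‖∫ w, g (X ω) w ∂π‖), sq_nonneg ‖X ω‖,
          sq_nonneg ‖∫ w, g (X ω) w ∂π‖]
    · have := hg.mono (X ω)
      rwa [real_inner_comm] at this
  have hmean3 : μ * ∫ ω, ‖X ω‖ ^ 4 ∂P ≤ ∫ ω, ‖X ω‖ ^ 2 * inner ℝ (X ω) (G ω) ∂P := by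
    have hm : Measurable (fun p : E × W => ‖p.1‖ ^ 2 * inner ℝ p.1 (g p.1 p.2)) :=
      (measurable_fst.norm.pow_const 2).mul (measurable_fst.inner hg.measurable)
    have e := integral_comp_indepFun hX hY hXY (Φ := fun y w => ‖y‖ ^ 2 * inner ℝ y (g y w))
      hm.stronglyMeasurable hinn3
    have e2 : ∀ y, ∫ w, ‖y‖ ^ 2 * inner ℝ y (g y w) ∂π = ‖y‖ ^ 2 * inner ℝ y (∫ w, g y w ∂π) :=
      fun y => by rw [integral_const_mul, integral_inner (hg.integrable_apply y) y]
    simp only [e2] at e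
    rw [hGdef, e, ← integral_const_mul]
    refine integral_mono (hX4.const_mul _) ?_ fun ω => ?_
    · refine (hX4.const_mul (1 + κ ^ 2)).mono' ?_ (Filter.Eventually.of_forall fun ω => ?_)
      · have hsm : StronglyMeasurable (fun y => ∫ w, g y w ∂π) :=
          hg.measurable.stronglyMeasurable.integral_prod_right (ν := π)
        exact ((hX.norm.pow_const 2).mul (hX.inner (hsm.measurable.comp hX))).aestronglyMeasurable
      · rw [norm_mul, Real.norm_eq_abs (‖X ω‖ ^ 2), abs_of_nonneg (by positivity)]
        have h1 : ‖inner ℝ (X ω) (∫ w, g (X ω) w ∂π)‖ ≤ (1 + κ ^ 2) * ‖X ω‖ ^ 2 := by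
          refine (norm_inner_le_norm _ _).trans ?_
          have := hg.sq_norm_mean_le (X ω)
          nlinarith [sq_nonneg (‖X ω‖ - ‖∫ w, g (X ω) w ∂π‖), sq_nonneg ‖X ω‖,
            sq_nonneg ‖∫ w, g (X ω) w ∂π‖]
        calc _ ≤ ‖X ω‖ ^ 2 * ((1 + κ ^ 2) * ‖X ω‖ ^ 2) := by gcongr
          _ = _ := by ring
    · have := hg.mono (X ω)
      rw [real_inner_comm] at this
      simp only
      nlinarith [mul_le_mul_of_nonneg_left this (sq_nonneg ‖X ω‖)]
  have hmixle : ∫ ω, ‖X ω‖ ^ 2 * ‖G ω‖ ^ 2 ∂P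
      ≤ 2 * κ ^ 2 * ∫ ω, ‖X ω‖ ^ 4 ∂P + 2 * s * ∫ ω, ‖X ω‖ ^ 2 ∂P := by
    have i1 := hX4.const_mul (2 * κ ^ 2)
    have i2 := hX2.const_mul (2 * s)
    have hm : Measurable (fun p : E × W => ‖p.1‖ ^ 2 * ‖g p.1 p.2‖ ^ 2) :=
      (measurable_fst.norm.pow_const 2).mul (hg.measurable.norm.pow_const 2)
    have h := integrable_comp_indepFun hX hY hXY (Φ := fun y w => ‖y‖ ^ 2 * ‖g y w‖ ^ 2)
      (ψ := fun y => 2 * κ ^ 2 * ‖y‖ ^ 4 + 2 * s * ‖y‖ ^ 2) hm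
      (fun _ _ => by positivity) (fun y => (hg.integrable_sq y).const_mul _) (fun y => by
        rw [integral_const_mul]
        calc _ ≤ ‖y‖ ^ 2 * (2 * κ ^ 2 * ‖y‖ ^ 2 + 2 * s) := by gcongr; exact hg.second_le y
          _ = _ := by ring) (i1.add i2)
    refine h.2.trans (le_of_eq ?_)
    rw [integral_add i1 i2, integral_const_mul, integral_const_mul]
  have hb : ∀ ω, ‖X ω - t • G ω‖ ^ 4 ≤ ‖X ω‖ ^ 4 - 4 * t * (‖X ω‖ ^ 2 * inner ℝ (X ω) (G ω))
      + 8 * t ^ 2 * (‖X ω‖ ^ 2 * ‖G ω‖ ^ 2) + 3 * t ^ 4 * ‖G ω‖ ^ 4 := fun ω => by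
    have := norm_sub_pow_four_le (X ω) (t • G ω)
    rw [inner_smul_right, norm_smul, Real.norm_eq_abs, abs_of_nonneg ht] at this
    linarith
  have j1 := hinn3.const_mul (4 * t)
  have j2 := hmix.const_mul (8 * t ^ 2)
  have j3 := hG4.const_mul (3 * t ^ 4)
  have jtot : Integrable (fun ω => ‖X ω‖ ^ 4 - 4 * t * (‖X ω‖ ^ 2 * inner ℝ (X ω) (G ω))
      + 8 * t ^ 2 * (‖X ω‖ ^ 2 * ‖G ω‖ ^ 2) + 3 * t ^ 4 * ‖G ω‖ ^ 4) P :=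
    ((hX4.sub j1).add j2).add j3
  have hint : Integrable (fun ω => ‖X ω - t • G ω‖ ^ 4) P := by
    refine jtot.mono' (((hX.sub (hG.const_smul t)).norm.pow_const 4).aestronglyMeasurable)
      (Filter.Eventually.of_forall fun ω => ?_)
    rw [Real.norm_eq_abs, abs_of_nonneg (by positivity)]
    exact hb ω
  refine ⟨hint, ?_, ?_⟩
  · have e : ∀ ω, ‖X ω - t • G ω‖ ^ 2 = ‖X ω‖ ^ 2 - 2 * t * inner ℝ (X ω) (G ω)
        + t ^ 2 * ‖G ω‖ ^ 2 := fun ω => by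
      rw [norm_sub_sq_real, inner_smul_right, norm_smul, Real.norm_eq_abs, abs_of_nonneg ht]
      ring
    have k1 := hinn.const_mul (2 * t)
    have k2 := hG2.const_mul (t ^ 2)
    have k3 : Integrable (fun ω => ‖X ω‖ ^ 2 - 2 * t * inner ℝ (X ω) (G ω)) P := hX2.sub k1
    rw [integral_congr_ae (Filter.Eventually.of_forall e), integral_add k3 k2,
      integral_sub hX2 k1, integral_const_mul, integral_const_mul]
    have m1 := mul_le_mul_of_nonneg_left hmean (by positivity : 0 ≤ 2 * t)
    have m2 := mul_le_mul_of_nonneg_left hG2le (by positivity : 0 ≤ t ^ 2)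
    linarith
  · refine (integral_mono hint jtot hb).trans ?_
    have k3 : Integrable (fun ω => ‖X ω‖ ^ 4 - 4 * t * (‖X ω‖ ^ 2 * inner ℝ (X ω) (G ω))) P :=
      hX4.sub j1
    have k4 : Integrable (fun ω => ‖X ω‖ ^ 4 - 4 * t * (‖X ω‖ ^ 2 * inner ℝ (X ω) (G ω))
      + 8 * t ^ 2 * (‖X ω‖ ^ 2 * ‖G ω‖ ^ 2)) P := k3.add j2
    rw [integral_add k4 j3, integral_add k3 j2, integral_sub hX4 j1, integral_const_mul,
      integral_const_mul, integral_const_mul]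
    have m1 := mul_le_mul_of_nonneg_left hmean3 (by positivity : 0 ≤ 4 * t)
    have m2 := mul_le_mul_of_nonneg_left hmixle (by positivity : 0 ≤ 8 * t ^ 2)
    have m3 := mul_le_mul_of_nonneg_left hG4le (by positivity : 0 ≤ 3 * t ^ 4)
    linarith

end IsNoisyField

/-! ### Second moments of sums -/

section Sums

variable {Ω : Type*} [MeasurableSpace Ω] {P : Measure Ω} {E : Type*} [NormedAddCommGroup E]

theorem memLp_two_of_sq {X : Ω → E} (hX : AEStronglyMeasurable X P)
    (h : Integrable (fun ω => ‖X ω‖ ^ 2) P) : MemLp X 2 P := by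
  rw [← memLp_norm_iff hX]
  exact (memLp_two_iff_integrable_sq hX.norm).2 h

theorem integrable_sq_of_memLp_two {X : Ω → E} (h : MemLp X 2 P) :
    Integrable (fun ω => ‖X ω‖ ^ 2) P :=
  (memLp_two_iff_integrable_sq h.norm.1).1 h.norm

theorem integral_norm_add_sq_le {X Y : Ω → E} (hX : MemLp X 2 P) (hY : MemLp Y 2 P) :
    ∫ ω, ‖X ω + Y ω‖ ^ 2 ∂P ≤ 2 * ∫ ω, ‖X ω‖ ^ 2 ∂P + 2 * ∫ ω, ‖Y ω‖ ^ 2 ∂P := by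
  have i1 := (integrable_sq_of_memLp_two hX).const_mul 2
  have i2 := (integrable_sq_of_memLp_two hY).const_mul 2
  rw [← integral_const_mul, ← integral_const_mul, ← integral_add i1 i2]
  exact integral_mono (integrable_sq_of_memLp_two (hX.add hY)) (i1.add i2)
    fun ω => norm_add_sq_le_two _ _

theorem integral_norm_sub_sq_le {X Y : Ω → E} (hX : MemLp X 2 P) (hY : MemLp Y 2 P) :
    ∫ ω, ‖X ω - Y ω‖ ^ 2 ∂P ≤ 2 * ∫ ω, ‖X ω‖ ^ 2 ∂P + 2 * ∫ ω, ‖Y ω‖ ^ 2 ∂P := by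
  simpa [sub_eq_add_neg] using integral_norm_add_sq_le hX hY.neg

/-- A weighted Cauchy-Schwarz bound for the second moment of a sum. -/
theorem integral_norm_sum_smul_sq_le [NormedSpace ℝ E] {ι : Type*} (S : Finset ι) {c τ : ι → ℝ}
    {X : ι → Ω → E} (hc : ∀ k ∈ S, 0 ≤ c k) (hτ : ∀ k ∈ S, 0 < τ k) (hX : ∀ k ∈ S, MemLp (X k) 2 P)
    (hle : ∀ k ∈ S, ∫ ω, ‖X k ω‖ ^ 2 ∂P ≤ τ k ^ 2) :
    ∫ ω, ‖∑ k ∈ S, c k • X k ω‖ ^ 2 ∂P ≤ (∑ k ∈ S, c k * τ k) ^ 2 := by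
  have hpt : ∀ ω, ‖∑ k ∈ S, c k • X k ω‖ ^ 2
      ≤ (∑ k ∈ S, c k * τ k) * ∑ k ∈ S, c k / τ k * ‖X k ω‖ ^ 2 := by
    intro ω
    have h1 : ‖∑ k ∈ S, c k • X k ω‖ ≤ ∑ k ∈ S, c k * ‖X k ω‖ := by
      refine (norm_sum_le _ _).trans (Finset.sum_le_sum fun k hk => ?_)
      rw [norm_smul, Real.norm_eq_abs, abs_of_nonneg (hc k hk)]
    refine (pow_le_pow_left₀ (norm_nonneg _) h1 2).trans ?_
    -- Split `c ‖X‖` as the geometric mean of `c τ` and `(c / τ) ‖X‖²`; in expectation the second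
    -- factor is again at most `∑ c τ`.
    refine Finset.sum_sq_le_sum_mul_sum_of_sq_le_mul S
      (fun k hk => mul_nonneg (hc k hk) (hτ k hk).le)
      (fun k hk => mul_nonneg (div_nonneg (hc k hk) (hτ k hk).le) (sq_nonneg _)) fun k hk => ?_
    have := (hτ k hk).ne'
    refine le_of_eq ?_
    field_simp
  have hint : ∀ k ∈ S, Integrable (fun ω => c k / τ k * ‖X k ω‖ ^ 2) P := fun k hk =>
    (integrable_sq_of_memLp_two (hX k hk)).const_mul _
  have hsum : MemLp (fun ω => ∑ k ∈ S, c k • X k ω) 2 P :=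
    memLp_finsetSum S fun k hk => (hX k hk).const_smul (c k)
  have h0 : 0 ≤ ∑ k ∈ S, c k * τ k :=
    Finset.sum_nonneg fun k hk => mul_nonneg (hc k hk) (hτ k hk).le
  calc _ ≤ ∫ ω, (∑ k ∈ S, c k * τ k) * ∑ k ∈ S, c k / τ k * ‖X k ω‖ ^ 2 ∂P :=
        integral_mono (integrable_sq_of_memLp_two hsum)
          ((integrable_finsetSum S hint).const_mul _) hpt
    _ = (∑ k ∈ S, c k * τ k) * ∑ k ∈ S, c k / τ k * ∫ ω, ‖X k ω‖ ^ 2 ∂P := by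
        rw [integral_const_mul, integral_finsetSum S hint]
        simp_rw [integral_const_mul]
    _ ≤ (∑ k ∈ S, c k * τ k) * ∑ k ∈ S, c k * τ k := by
        refine mul_le_mul_of_nonneg_left (Finset.sum_le_sum fun k hk => ?_) h0
        have h1 := hτ k hk
        calc _ ≤ c k / τ k * τ k ^ 2 :=
              mul_le_mul_of_nonneg_left (hle k hk) (div_nonneg (hc k hk) h1.le)
          _ = _ := by field_simp
    _ = _ := by ring

theorem integrable_inner_of_memLp_two [InnerProductSpace ℝ E] {X Y : Ω → E} (hX : MemLp X 2 P)
    (hY : MemLp Y 2 P) : Integrable (fun ω => inner ℝ (X ω) (Y ω)) P := by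
  refine ((integrable_sq_of_memLp_two hX).add (integrable_sq_of_memLp_two hY)).mono'
    (hX.1.inner hY.1) (Filter.Eventually.of_forall fun ω => ?_)
  refine (norm_inner_le_norm _ _).trans ?_
  simp only [Pi.add_apply]
  nlinarith [sq_nonneg (‖X ω‖ - ‖Y ω‖), sq_nonneg ‖X ω‖, sq_nonneg ‖Y ω‖]

theorem integral_norm_sum_sq_of_orthogonal [InnerProductSpace ℝ E] (S : Finset ℕ) {X : ℕ → Ω → E}
    (hX : ∀ k, MemLp (X k) 2 P) (horth : ∀ j k, j < k → ∫ ω, inner ℝ (X j ω) (X k ω) ∂P = 0) :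
    ∫ ω, ‖∑ k ∈ S, X k ω‖ ^ 2 ∂P = ∑ k ∈ S, ∫ ω, ‖X k ω‖ ^ 2 ∂P := by
  have hint : ∀ j k, Integrable (fun ω => inner ℝ (X j ω) (X k ω)) P := fun j k =>
    integrable_inner_of_memLp_two (hX j) (hX k)
  have horth' : ∀ j k, j ≠ k → ∫ ω, inner ℝ (X j ω) (X k ω) ∂P = 0 := by
    intro j k hjk
    rcases hjk.lt_or_gt with h | h
    · exact horth j k h
    · rw [← horth k j h]
      exact integral_congr_ae (Filter.Eventually.of_forall fun ω => real_inner_comm _ _)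
  have e : ∀ ω, ‖∑ k ∈ S, X k ω‖ ^ 2 = ∑ j ∈ S, ∑ k ∈ S, inner ℝ (X j ω) (X k ω) := fun ω => by
    rw [← real_inner_self_eq_norm_sq, sum_inner]
    simp_rw [inner_sum]
  simp_rw [e]
  rw [integral_finsetSum S fun j _ => integrable_finsetSum S fun k _ => hint j k]
  refine Finset.sum_congr rfl fun j hj => ?_
  rw [integral_finsetSum S fun k _ => hint j k, Finset.sum_eq_single j]
  · simp_rw [real_inner_self_eq_norm_sq]
  · exact fun k _ hk => horth' j k hk.symm
  · exact fun h => absurd hj h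

end Sums

/-! ### Sums of step sizes -/

section StepSums

variable {α : ℝ}

/-- Bernoulli's inequality for the exponent `1 - α < 1` shows that `n^{1-α}` increases by at least
`(1-α)(n+1)^{-α}`. -/
theorem sum_stepPow_le (hα : 0 < α) (hα' : α < 1) (n : ℕ) :
    ∑ k ∈ Finset.range n, stepPow α k ≤ (n : ℝ) ^ (1 - α) / (1 - α) := by
  have h1 : 0 < 1 - α := by linarith
  induction n with
  | zero => simp [Real.zero_rpow h1.ne']
  | succ n ih =>
    rw [Finset.sum_range_succ]
    refine (add_le_add_left ih _).trans ?_
    have hn : (0 : ℝ) < (n : ℝ) + 1 := by positivity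
    rw [le_div_iff₀ h1, add_mul, div_mul_cancel₀ _ h1.ne']
    have hb := rpow_one_add_le_one_add_mul_self (s := -(1 / ((n : ℝ) + 1)))
      (by rw [neg_le_neg_iff, div_le_one hn]; linarith [n.cast_nonneg (α := ℝ)]) h1.le (by linarith)
    have e1 : 1 + -(1 / ((n : ℝ) + 1)) = n / (n + 1) := by field_simp; ring
    rw [e1, Real.div_rpow (by positivity) hn.le, div_le_iff₀ (by positivity)] at hb
    have e2 : ((n : ℝ) + 1) ^ (1 - α) = stepPow α n * (n + 1) := by
      unfold stepPow
      rw [← Real.rpow_add_one hn.ne']; congr 1; ring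
    push_cast
    rw [e2] at hb ⊢
    have e3 : (1 + (1 - α) * -(1 / ((n : ℝ) + 1))) * (stepPow α n * (n + 1))
      = stepPow α n * (n + 1) - stepPow α n * (1 - α) := by field_simp; ring
    rw [e3] at hb
    linarith

theorem inv_stepPow (α : ℝ) (k : ℕ) : (stepPow α k)⁻¹ = ((k : ℝ) + 1) ^ α := by
  unfold stepPow
  rw [Real.rpow_neg (by positivity), inv_inv]

/-- Here `α > 1/2` enters as `1 - α ≤ α`: the martingale part of a block is then no larger than its
boundary terms, of order `h_i⁻¹`. -/
theorem sum_Icc_stepPow_le (hα : 1 / 2 < α) (hα' : α < 1) (t i : ℕ) :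
    ∑ k ∈ Finset.Icc t i, stepPow α k ≤ (1 - α)⁻¹ * (stepPow α i)⁻¹ := by
  have h1 : 0 < 1 - α := by linarith
  calc _ ≤ ∑ k ∈ Finset.range (i + 1), stepPow α k := by
        refine Finset.sum_le_sum_of_subset_of_nonneg (fun k hk => ?_) fun k _ _ =>
          (stepPow_pos α k).le
        rw [Finset.mem_Icc] at hk
        rw [Finset.mem_range]; omega
    _ ≤ ((i + 1 : ℕ) : ℝ) ^ (1 - α) / (1 - α) := sum_stepPow_le (by linarith) hα' _
    _ ≤ ((i : ℝ) + 1) ^ α / (1 - α) := by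
        push_cast
        gcongr
        · linarith [i.cast_nonneg (α := ℝ)]
        · linarith
    _ = _ := by rw [inv_stepPow]; ring

theorem inv_stepPow_mono (hα : 0 ≤ α) : Monotone fun k => (stepPow α k)⁻¹ := fun _ j hij =>
  inv_anti₀ (stepPow_pos α j) (stepPow_antitone hα hij)

/-- With `q_k = h_k^{-1/2}` each summand is `(q_k² - q_{k-1}²) / q_k ≤ 2 (q_k - q_{k-1})`, which
telescopes. -/
theorem sum_diff_inv_stepPow_mul_sqrt_le (hα : 0 ≤ α) {t i : ℕ} (hti : t ≤ i) :
    ∑ k ∈ Finset.Ioc t i, ((stepPow α k)⁻¹ - (stepPow α (k - 1))⁻¹) * √(stepPow α k)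
      ≤ 2 * √(stepPow α i)⁻¹ := by
  suffices h : ∑ k ∈ Finset.Ioc t i, ((stepPow α k)⁻¹ - (stepPow α (k - 1))⁻¹) * √(stepPow α k)
      ≤ 2 * √(stepPow α i)⁻¹ - 2 * √(stepPow α t)⁻¹ by
    have := Real.sqrt_nonneg (stepPow α t)⁻¹
    linarith
  induction i, hti using Nat.le_induction with
  | base => simp
  | succ i hi ih =>
    rw [Finset.sum_Ioc_succ_top hi]
    have hb : (stepPow α i)⁻¹ ≤ (stepPow α (i + 1))⁻¹ := inv_stepPow_mono hα (by omega)
    have hq := Real.sqrt_le_sqrt hb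
    have hp := stepPow_pos α (i + 1)
    have hp' := inv_pos.2 (stepPow_pos α i)
    have e1 := Real.sq_sqrt hp'.le
    have e2 := Real.sq_sqrt (inv_pos.2 hp).le
    set q := √(stepPow α i)⁻¹
    set q' := √(stepPow α (i + 1))⁻¹ with hq'
    have hq'0 : 0 < q' := Real.sqrt_pos.2 (inv_pos.2 hp)
    have e3 : √(stepPow α (i + 1)) = q'⁻¹ := by rw [hq', Real.sqrt_inv, inv_inv]
    simp only [Nat.add_sub_cancel]
    rw [e3, ← e1, ← e2, ← div_eq_mul_inv]
    have : (q' ^ 2 - q ^ 2) / q' ≤ 2 * q' - 2 * q := by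
      rw [div_le_iff₀ hq'0]; nlinarith [sq_nonneg (q' - q)]
    linarith

/-- Abel summation. -/
theorem sum_inv_smul_sub {E : Type*} [AddCommGroup E] [Module ℝ E] (b : ℕ → ℝ) (x : ℕ → E)
    {t i : ℕ} (hti : t ≤ i) :
    ∑ k ∈ Finset.Icc t i, b k • (x k - x (k + 1))
      = b t • x t - b i • x (i + 1) + ∑ k ∈ Finset.Ioc t i, (b k - b (k - 1)) • x k := by
  induction i, hti using Nat.le_induction with
  | base => simp [smul_sub]
  | succ i hi ih =>
    rw [Finset.sum_Icc_succ_top (by omega), ih, Finset.sum_Ioc_succ_top hi]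
    simp only [Nat.add_sub_cancel]
    module

end StepSums

/-! ### Stochastic approximation with decaying steps -/

section Descent

variable {E W Ω : Type*} [NormedAddCommGroup E] [InnerProductSpace ℝ E]
  [MeasurableSpace E] [MeasurableSpace W]

/-- The iterates `y_{k+1} = y_k - t_k g(y_k, w_{k+1})`. -/
def descent (g : E → W → E) (t : ℕ → ℝ) (y₀ : E) (w : ℕ → Ω → W) : ℕ → Ω → E
  | 0 => fun _ => y₀
  | k + 1 => fun ω => descent g t y₀ w k ω - t k • g (descent g t y₀ w k ω) (w (k + 1) ω)

set_option linter.unusedSectionVars false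

variable [FiniteDimensional ℝ E] [BorelSpace E] [mΩ : MeasurableSpace Ω] {P : Measure Ω}
  [IsProbabilityMeasure P] {π : Measure W} [IsProbabilityMeasure π] {w : ℕ → Ω → W}
  {g : E → W → E} {μ κ s : ℝ}

theorem measurable_descent (hg : Measurable (Function.uncurry g)) (t : ℕ → ℝ) (y₀ : E)
    (w : ℕ → Ω → W) (k : ℕ) : Measurable[sigmaOf w (Set.Iic k)] (descent g t y₀ w k) := by
  induction k with
  | zero => exact measurable_const
  | succ k ih =>
    have h1 : Measurable[sigmaOf w (Set.Iic (k + 1))] (descent g t y₀ w k) :=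
      ih.mono (sigmaOf_mono w (Set.Iic_subset_Iic.2 (by omega))) le_rfl
    have h2 : Measurable[sigmaOf w (Set.Iic (k + 1))] (w (k + 1)) :=
      measurable_sigmaOf w (Set.mem_Iic.2 le_rfl)
    exact h1.sub ((hg.comp (h1.prodMk h2)).const_smul (t k))

theorem indepFun_next (hw : ∀ i, Measurable (w i)) (hindep : iIndepFun w P) {A : Type*}
    [MeasurableSpace A] {X : Ω → A} {k : ℕ} (hX : Measurable[sigmaOf w (Set.Iic k)] X) :
    IndepFun X (w (k + 1)) P :=
  indepFun_of_sigmaOf hw hindep (S := Set.Iic k) (T := {k + 1}) (by simp) hX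
    (measurable_sigmaOf w (Set.mem_singleton _))

/-- Martingale orthogonality: given the past `(X, Z)`, the fresh noise `Y` makes `φ` centred. -/
theorem integral_inner_comp_eq_zero {X Z : Ω → E} {Y : Ω → W} (hX : Measurable X)
    (hZ : Measurable Z) (hY : HasLaw Y π P) (hXY : IndepFun (fun ω => (X ω, Z ω)) Y P)
    {φ : E → W → E} (hφ : Measurable (Function.uncurry φ)) (hφi : ∀ y, Integrable (φ y) π)
    (hφ0 : ∀ y, ∫ v, φ y v ∂π = 0) (hZ2 : MemLp Z 2 P)
    (hφ2 : MemLp (fun ω => φ (X ω) (Y ω)) 2 P) :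
    ∫ ω, inner ℝ (Z ω) (φ (X ω) (Y ω)) ∂P = 0 := by
  have hm : Measurable (fun q : (E × E) × W => inner ℝ q.1.2 (φ q.1.1 q.2)) :=
    (measurable_snd.comp measurable_fst).inner
      (hφ.comp ((measurable_fst.comp measurable_fst).prodMk measurable_snd))
  rw [integral_comp_indepFun (hX.prodMk hZ) hY hXY (Φ := fun p v => inner ℝ p.2 (φ p.1 v))
    hm.stronglyMeasurable (integrable_inner_of_memLp_two hZ2 hφ2)]
  simp_rw [integral_inner (hφi _), hφ0, inner_zero_right]
  simp

theorem exists_mul_stepPow_le {α : ℝ} (hα : 0 < α) (c : ℝ) {e : ℝ} (he : 0 < e) :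
    ∃ k₀, ∀ k, k₀ ≤ k → c * stepPow α k ≤ e := by
  have := (tendsto_stepPow hα).const_mul c
  rw [mul_zero] at this
  exact Filter.eventually_atTop.1 (this.eventually_le_const he)

/-- Uniform moment bounds for the iterates. -/
theorem exists_descent_moment_bound (hw : ∀ i, Measurable (w i)) (hindep : iIndepFun w P)
    (hlaw : ∀ i, HasLaw (w i) π P) {η α C₀ : ℝ} (hμ : 0 < μ) (hη : 0 < η) (hα : 0 < α)
    (hα' : α < 1) (hC₀ : 0 ≤ C₀) :
    ∃ K : ℝ, 0 < K ∧ ∀ (g : E → W → E) (s : ℝ), IsNoisyField g π μ κ s →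
      ∀ y₀ : E, ‖y₀‖ ^ 2 ≤ C₀ * s → ∀ k,
        Integrable (fun ω => ‖descent g (fun k => η * stepPow α k) y₀ w k ω‖ ^ 4) P ∧
        ∫ ω, ‖descent g (fun k => η * stepPow α k) y₀ w k ω‖ ^ 2 ∂P ≤ K * s * stepPow α k ∧
        ∫ ω, ‖descent g (fun k => η * stepPow α k) y₀ w k ω‖ ^ 4 ∂P
          ≤ K * s ^ 2 * stepPow α k ^ 2 := by
  -- From these indices on, the higher-order terms in the one-step bounds cost at most `μ η h_k`, so
  -- both moments contract by at least `1 - μ η h_k`.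
  obtain ⟨k₁, hk₁⟩ := exists_mul_stepPow_le hα (2 * κ ^ 2 * η ^ 2) (mul_pos hμ hη)
  obtain ⟨k₂, hk₂⟩ := exists_mul_stepPow_le hα (16 * κ ^ 2 * η ^ 2 + 24 * κ ^ 4 * η ^ 4)
    (mul_pos hμ hη)
  obtain ⟨K₁, hK₁, H₁⟩ := exists_recursion_bound hα hα' (mul_pos hμ hη)
    (by positivity : 0 ≤ 1 + 2 * κ ^ 2 * η ^ 2) 1 k₁
  obtain ⟨K₂, hK₂, H₂⟩ := exists_recursion_bound hα hα' (mul_pos hμ hη)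
    (by positivity : 0 ≤ 1 + (16 * κ ^ 2 * η ^ 2 + 24 * κ ^ 4 * η ^ 4)) 2 k₂
  set L := K₁ * (C₀ + 2 * η ^ 2) with hL
  have hL0 : 0 < L := by positivity
  -- The summands account for the initial value, the feed of the second moment into the fourth, and
  -- the fourth moment of the noise.
  set B₂ := C₀ ^ 2 + 16 * η ^ 2 * L + 24 * η ^ 4 with hB₂
  refine ⟨L + K₂ * B₂, by positivity, fun g s hg y₀ hy₀ => ?_⟩
  have hs := hg.s_pos
  set Δ := descent g (fun k => η * stepPow α k) y₀ w with hΔ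
  have hmeas : ∀ k, Measurable (Δ k) := fun k =>
    (measurable_descent hg.measurable _ y₀ w k).mono (sigmaOf_le hw _) le_rfl
  have hind : ∀ k, IndepFun (Δ k) (w (k + 1)) P := fun k =>
    indepFun_next hw hindep (measurable_descent hg.measurable _ y₀ w k)
  have hh : ∀ k, 0 < stepPow α k := stepPow_pos α
  have hh1 : ∀ k, stepPow α k ≤ 1 := stepPow_le_one hα.le
  have hstep := fun k (h4 : Integrable (fun ω => ‖Δ k ω‖ ^ 4) P) =>
    hg.step (hmeas k) (hw (k + 1)) (hlaw (k + 1)) (hind k) h4 (mul_pos hη (hh k)).le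
  have hint : ∀ k, Integrable (fun ω => ‖Δ k ω‖ ^ 4) P := by
    intro k
    induction k with
    | zero => exact integrable_const (‖y₀‖ ^ 4)
    | succ k ih => exact (hstep k ih).1
  have h2 : ∀ k, ∫ ω, ‖Δ k ω‖ ^ 2 ∂P ≤ K₁ * ((C₀ + 2 * η ^ 2) * s) * stepPow α k ^ 1 := by
    have hB0 : 0 ≤ (C₀ + 2 * η ^ 2) * s := by positivity
    refine H₁ ((C₀ + 2 * η ^ 2) * s) (fun k => ∫ ω, ‖Δ k ω‖ ^ 2 ∂P) hB0
      (fun k => integral_nonneg fun ω => sq_nonneg _) ?_ (fun k => ?_) (fun k hk => ?_)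
    · have : ∫ ω, ‖Δ 0 ω‖ ^ 2 ∂P = ‖y₀‖ ^ 2 := by simp [hΔ, descent]
      rw [this]
      nlinarith [mul_nonneg (sq_nonneg η) hs.le]
    · refine (hstep k (hint k)).2.1.trans ?_
      have hv : 0 ≤ ∫ ω, ‖Δ k ω‖ ^ 2 ∂P := integral_nonneg fun ω => sq_nonneg _
      have t2 : (η * stepPow α k) ^ 2 ≤ η ^ 2 := by
        rw [mul_pow]
        exact mul_le_of_le_one_right (sq_nonneg _) (pow_le_one₀ (hh k).le (hh1 k))
      have c1 : 1 - 2 * μ * (η * stepPow α k) + 2 * κ ^ 2 * (η * stepPow α k) ^ 2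
          ≤ 1 + 2 * κ ^ 2 * η ^ 2 := by
        have := mul_le_mul_of_nonneg_left t2 (by positivity : 0 ≤ 2 * κ ^ 2)
        have := mul_pos hμ (mul_pos hη (hh k))
        linarith
      have c2 : 2 * s * (η * stepPow α k) ^ 2 ≤ (C₀ + 2 * η ^ 2) * s := by
        have := mul_le_mul_of_nonneg_left t2 (by positivity : 0 ≤ 2 * s)
        nlinarith [mul_nonneg hC₀ hs.le]
      have c3 : (C₀ + 2 * η ^ 2) * s ≤ (1 + 2 * κ ^ 2 * η ^ 2) * ((C₀ + 2 * η ^ 2) * s) :=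
        le_mul_of_one_le_left hB0 (by nlinarith [sq_nonneg (κ * η)])
      exact add_le_add (mul_le_mul_of_nonneg_right c1 hv) (c2.trans c3)
    · refine (hstep k (hint k)).2.1.trans ?_
      have hv : 0 ≤ ∫ ω, ‖Δ k ω‖ ^ 2 ∂P := integral_nonneg fun ω => sq_nonneg _
      have hb := mul_le_mul_of_nonneg_right (hk₁ k hk) (hh k).le
      refine add_le_add (mul_le_mul_of_nonneg_right ?_ hv) ?_
      · nlinarith
      · have : 0 ≤ C₀ * s * stepPow α k ^ 2 := by have := hh k; positivity
        rw [one_add_one_eq_two]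
        nlinarith
  have h2' : ∀ k, ∫ ω, ‖Δ k ω‖ ^ 2 ∂P ≤ L * s * stepPow α k := fun k =>
    (h2 k).trans (le_of_eq (by rw [hL]; ring))
  have h4 : ∀ k, ∫ ω, ‖Δ k ω‖ ^ 4 ∂P ≤ K₂ * (B₂ * s ^ 2) * stepPow α k ^ 2 := by
    have hB0 : 0 ≤ B₂ * s ^ 2 := by positivity
    set κ' := 16 * κ ^ 2 * η ^ 2 + 24 * κ ^ 4 * η ^ 4 with hκ'
    have hκ'0 : 0 ≤ κ' := by positivity
    have hcoef : ∀ k, 16 * κ ^ 2 * (η * stepPow α k) ^ 2 + 24 * κ ^ 4 * (η * stepPow α k) ^ 4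
        ≤ κ' * stepPow α k ^ 2 := fun k => by
      have h42 : stepPow α k ^ 4 ≤ stepPow α k ^ 2 :=
        pow_le_pow_of_le_one (hh k).le (hh1 k) (by norm_num)
      have := mul_le_mul_of_nonneg_left h42 (by positivity : 0 ≤ 24 * κ ^ 4 * η ^ 4)
      rw [hκ']
      nlinarith
    -- The second moment is already `O(s h_k)`, so its feed `16 s t² E‖Δ_k‖²` is `O(s² h_k³)`: the
    -- source required for decay at rate `h_k²`.
    have hadd : ∀ k, 16 * s * (η * stepPow α k) ^ 2 * ∫ ω, ‖Δ k ω‖ ^ 2 ∂P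
        + 24 * s ^ 2 * (η * stepPow α k) ^ 4 ≤ B₂ * s ^ 2 * stepPow α k ^ (2 + 1) := fun k => by
      have h43 : stepPow α k ^ 4 ≤ stepPow α k ^ (2 + 1) :=
        pow_le_pow_of_le_one (hh k).le (hh1 k) (by norm_num)
      have e1 := mul_le_mul_of_nonneg_left h43 (by positivity : 0 ≤ 24 * s ^ 2 * η ^ 4)
      have e2 := mul_le_mul_of_nonneg_left (h2' k)
        (by have := hh k; positivity : 0 ≤ 16 * s * (η * stepPow α k) ^ 2)
      have e3 : 0 ≤ C₀ ^ 2 * s ^ 2 * stepPow α k ^ (2 + 1) := by have := hh k; positivity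
      rw [hB₂, two_add_one_eq_three] at *
      nlinarith
    refine H₂ (B₂ * s ^ 2) (fun k => ∫ ω, ‖Δ k ω‖ ^ 4 ∂P) hB0
      (fun k => integral_nonneg fun ω => by positivity) ?_ (fun k => ?_) (fun k hk => ?_)
    · have : ∫ ω, ‖Δ 0 ω‖ ^ 4 ∂P = (‖y₀‖ ^ 2) ^ 2 := by simp [hΔ, descent]; ring
      rw [this]
      have h1 := pow_le_pow_left₀ (sq_nonneg ‖y₀‖) hy₀ 2
      have h3 : 0 ≤ (16 * η ^ 2 * L + 24 * η ^ 4) * s ^ 2 := by positivity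
      rw [hB₂]
      nlinarith
    · have hv : 0 ≤ ∫ ω, ‖Δ k ω‖ ^ 4 ∂P := integral_nonneg fun ω => by positivity
      refine (hstep k (hint k)).2.2.trans ?_
      have hp2 : stepPow α k ^ 2 ≤ 1 := pow_le_one₀ (hh k).le (hh1 k)
      have hp3 : stepPow α k ^ (2 + 1) ≤ 1 := pow_le_one₀ (hh k).le (hh1 k)
      have c1 : 1 - 4 * μ * (η * stepPow α k) + 16 * κ ^ 2 * (η * stepPow α k) ^ 2
          + 24 * κ ^ 4 * (η * stepPow α k) ^ 4 ≤ 1 + κ' := by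
        have := hcoef k
        have := mul_le_mul_of_nonneg_left hp2 hκ'0
        have := mul_pos hμ (mul_pos hη (hh k))
        linarith
      have c2 := (hadd k).trans (mul_le_of_le_one_right hB0 hp3)
      have c3 : B₂ * s ^ 2 ≤ (1 + κ') * (B₂ * s ^ 2) := le_mul_of_one_le_left hB0 (by linarith)
      have c4 := mul_le_mul_of_nonneg_right c1 hv
      linarith
    · have hv : 0 ≤ ∫ ω, ‖Δ k ω‖ ^ 4 ∂P := integral_nonneg fun ω => by positivity
      refine (hstep k (hint k)).2.2.trans ?_
      have hb := mul_le_mul_of_nonneg_right (hk₂ k hk) (hh k).le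
      have c1 : 1 - 4 * μ * (η * stepPow α k) + 16 * κ ^ 2 * (η * stepPow α k) ^ 2
          + 24 * κ ^ 4 * (η * stepPow α k) ^ 4 ≤ 1 - μ * η * stepPow α k := by
        have := hcoef k
        have := mul_pos hμ (mul_pos hη (hh k))
        nlinarith
      have c2 := hadd k
      have c4 := mul_le_mul_of_nonneg_right c1 hv
      linarith
  refine fun k => ⟨hint k, (h2' k).trans ?_, (h4 k).trans ?_⟩
  · have := hh k
    have : 0 ≤ K₂ * B₂ := by positivity
    gcongr
    linarith
  · have := hh k
    calc _ = (K₂ * B₂) * s ^ 2 * stepPow α k ^ 2 := by ring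
      _ ≤ _ := by gcongr; linarith

theorem memLp_two_of_fourth {X : Ω → E} (hX : AEStronglyMeasurable X P)
    (h : Integrable (fun ω => ‖X ω‖ ^ 4) P) : MemLp X 2 P :=
  memLp_two_of_sq hX (integrable_norm_pow_of_le hX (by norm_num) h)

namespace IsNoisyField

theorem measurable_mean (hg : IsNoisyField g π μ κ s) : Measurable (fun y => ∫ v, g y v ∂π) :=
  (hg.measurable.stronglyMeasurable.integral_prod_right (ν := π)).measurable

theorem measurable_fluct (hg : IsNoisyField g π μ κ s) :
    Measurable (Function.uncurry fun y v => g y v - g 0 v - ∫ v, g y v ∂π) := by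
  have h1 : Measurable fun p : E × W => g p.1 p.2 := hg.measurable
  have h2 : Measurable fun p : E × W => g 0 p.2 := (hg.measurable_apply 0).comp measurable_snd
  have h3 : Measurable fun p : E × W => ∫ v, g p.1 v ∂π := hg.measurable_mean.comp measurable_fst
  exact (h1.sub h2).sub h3

/-- The state-dependent part of the noise has size proportional to `X`, hence is small near the
target; `4 = 2 + 2` comes from the increment and its mean. -/
theorem fluct_moment (hg : IsNoisyField g π μ κ s) {X : Ω → E} {Y : Ω → W} (hX : Measurable X)
    (hYm : Measurable Y) (hY : HasLaw Y π P) (hXY : IndepFun X Y P) (hX2 : MemLp X 2 P) :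
    MemLp (fun ω => g (X ω) (Y ω) - g 0 (Y ω) - ∫ v, g (X ω) v ∂π) 2 P ∧
    ∫ ω, ‖g (X ω) (Y ω) - g 0 (Y ω) - ∫ v, g (X ω) v ∂π‖ ^ 2 ∂P
      ≤ 4 * κ ^ 2 * ∫ ω, ‖X ω‖ ^ 2 ∂P := by
  have hi : ∀ y, MemLp (fun v => g y v - g 0 v) 2 π := fun y =>
    memLp_two_of_sq (hg.aestronglyMeasurable_sub y) (hg.integrable_sub_sq y)
  have hi' : ∀ y, MemLp (fun v => g y v - g 0 v - ∫ v, g y v ∂π) 2 π := fun y =>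
    (hi y).sub (memLp_const _)
  have h := integrable_comp_indepFun hX hY hXY
    (Φ := fun y v => ‖g y v - g 0 v - ∫ v, g y v ∂π‖ ^ 2)
    (ψ := fun y => 4 * κ ^ 2 * ‖y‖ ^ 2) (hg.measurable_fluct.norm.pow_const 2)
    (fun _ _ => sq_nonneg _) (fun y => integrable_sq_of_memLp_two (hi' y)) (fun y => by
      refine (integral_norm_sub_sq_le (hi y) (memLp_const _)).trans ?_
      have h1 := hg.second_sub y
      have h2 := hg.sq_norm_mean_le y
      simp only [integral_const, probReal_univ, one_smul]
      linarith) ((integrable_sq_of_memLp_two hX2).const_mul _)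
  have hm : Measurable (fun ω => g (X ω) (Y ω) - g 0 (Y ω) - ∫ v, g (X ω) v ∂π) :=
    hg.measurable_fluct.comp (hX.prodMk hYm)
  refine ⟨memLp_two_of_sq hm.aestronglyMeasurable h.1, h.2.trans (le_of_eq ?_)⟩
  rw [integral_const_mul]

theorem integral_fluct (hg : IsNoisyField g π μ κ s) (y : E) :
    Integrable (fun v => g y v - g 0 v - ∫ v, g y v ∂π) π ∧
    ∫ v, (g y v - g 0 v - ∫ v, g y v ∂π) ∂π = 0 := by
  have i1 : Integrable (fun v => g y v - g 0 v) π :=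
    (hg.integrable_apply y).sub (hg.integrable_apply 0)
  refine ⟨i1.sub (integrable_const _), ?_⟩
  rw [integral_sub i1 (integrable_const _),
    integral_sub (hg.integrable_apply y) (hg.integrable_apply 0), hg.mean_zero]
  simp

end IsNoisyField

/-- Block sums of the iterates are, up to lower order terms, block sums of the noise. -/
theorem exists_block_bound (hw : ∀ i, Measurable (w i)) (hindep : iIndepFun w P)
    (hlaw : ∀ i, HasLaw (w i) π P) {η α C₀ : ℝ} (hμ : 0 < μ) (hη : 0 < η) (hα : 1 / 2 < α)
    (hα' : α < 1) (hC₀ : 0 ≤ C₀) :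
    ∃ K : ℝ, 0 < K ∧ ∀ (g : E → W → E) (s : ℝ), IsNoisyField g π μ κ s →
      ∀ y₀ : E, ‖y₀‖ ^ 2 ≤ C₀ * s → ∀ (A : E →L[ℝ] E) (c : ℝ), 0 < c →
      (∀ y, ‖∫ v, g y v ∂π - A y‖ ≤ c * ‖y‖ ^ 2) → ∀ t i, t ≤ i →
      ∫ ω, ‖A (∑ k ∈ Finset.Icc t i, descent g (fun k => η * stepPow α k) y₀ w k ω)
          + ∑ k ∈ Finset.Icc t i, g 0 (w (k + 1) ω)‖ ^ 2 ∂P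
        ≤ K * (s * (stepPow α i)⁻¹ + c ^ 2 * s ^ 2 * (∑ k ∈ Finset.Icc t i, stepPow α k) ^ 2) := by
  have hα0 : 0 < α := by linarith
  obtain ⟨K, hK, H⟩ :=
    exists_descent_moment_bound (E := E) (κ := κ) hw hindep hlaw hμ hη hα0 hα' hC₀
  -- From `‖a - b - r‖² ≤ 4‖a‖² + 4‖b‖² + 2‖r‖²`, with `a` the telescoping part, `b` the martingale
  -- and `r` the linearization error.
  set K₁ := 4 * (η⁻¹ ^ 2 * (16 * K)) + 4 * (4 * κ ^ 2 * K * (1 - α)⁻¹) with hK₁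
  have h1α : 0 < 1 - α := by linarith
  refine ⟨K₁ + 2 * K, by positivity, fun g s hg y₀ hy₀ A c hc hr t i hti => ?_⟩
  have hs := hg.s_pos
  have hmom := H g s hg y₀ hy₀
  set Δ := descent g (fun k => η * stepPow α k) y₀ w with hΔ
  have hmeasp : ∀ k, Measurable[sigmaOf w (Set.Iic k)] (Δ k) :=
    measurable_descent hg.measurable _ y₀ w
  have hmeas : ∀ k, Measurable (Δ k) := fun k => (hmeasp k).mono (sigmaOf_le hw _) le_rfl
  have hind : ∀ k, IndepFun (Δ k) (w (k + 1)) P := fun k => indepFun_next hw hindep (hmeasp k)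
  have hh : ∀ k, 0 < stepPow α k := stepPow_pos α
  have hΔ2 : ∀ k, MemLp (Δ k) 2 P := fun k =>
    memLp_two_of_fourth (hmeas k).aestronglyMeasurable (hmom k).1
  -- Decomposition `g(Δ, w) = A Δ + g(0, w) + D + R`: linear drift, noise at the target, centred
  -- fluctuation, linearization error.
  set D : ℕ → Ω → E := fun k ω => g (Δ k ω) (w (k + 1) ω) - g 0 (w (k + 1) ω)
    - ∫ v, g (Δ k ω) v ∂π with hD
  set R : ℕ → Ω → E := fun k ω => ∫ v, g (Δ k ω) v ∂π - A (Δ k ω) with hR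
  have hDm := fun k => hg.fluct_moment (hmeas k) (hw (k + 1)) (hlaw (k + 1)) (hind k) (hΔ2 k)
  have hDmeas : ∀ k, Measurable[sigmaOf w (Set.Iic (k + 1))] (D k) := fun k => by
    have h1 : Measurable[sigmaOf w (Set.Iic (k + 1))] (Δ k) :=
      (hmeasp k).mono (sigmaOf_mono w (Set.Iic_subset_Iic.2 (by omega))) le_rfl
    exact hg.measurable_fluct.comp (h1.prodMk (measurable_sigmaOf w (Set.mem_Iic.2 le_rfl)))
  have hRle : ∀ k ω, ‖R k ω‖ ^ 2 ≤ c ^ 2 * ‖Δ k ω‖ ^ 4 := fun k ω => by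
    calc _ ≤ (c * ‖Δ k ω‖ ^ 2) ^ 2 := pow_le_pow_left₀ (norm_nonneg _) (hr _) 2
      _ = _ := by ring
  have hRmeas : ∀ k, Measurable (R k) := fun k =>
    (hg.measurable_mean.comp (hmeas k)).sub (A.measurable.comp (hmeas k))
  have hR2 : ∀ k, MemLp (R k) 2 P := fun k => by
    refine memLp_two_of_sq (hRmeas k).aestronglyMeasurable ?_
    refine ((hmom k).1.const_mul (c ^ 2)).mono' ((hRmeas k).norm.pow_const 2).aestronglyMeasurable
      (Filter.Eventually.of_forall fun ω => ?_)
    rw [Real.norm_eq_abs, abs_of_nonneg (sq_nonneg _)]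
    exact hRle k ω
  have hRint : ∀ k, ∫ ω, ‖R k ω‖ ^ 2 ∂P ≤ (c * (√K * s * stepPow α k)) ^ 2 := fun k => by
    calc _ ≤ ∫ ω, c ^ 2 * ‖Δ k ω‖ ^ 4 ∂P :=
          integral_mono (integrable_sq_of_memLp_two (hR2 k)) ((hmom k).1.const_mul _) (hRle k)
      _ ≤ c ^ 2 * (K * s ^ 2 * stepPow α k ^ 2) := by
          rw [integral_const_mul]
          gcongr
          exact (hmom k).2.2
      _ = _ := by rw [mul_pow, mul_pow, mul_pow, Real.sq_sqrt hK.le]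
  -- the telescoping part
  set T : Ω → E := fun ω => ∑ k ∈ Finset.Icc t i, (stepPow α k)⁻¹ • (Δ k ω - Δ (k + 1) ω) with hT
  set T₃ : Ω → E := fun ω => ∑ k ∈ Finset.Ioc t i,
    ((stepPow α k)⁻¹ - (stepPow α (k - 1))⁻¹) • Δ k ω with hT₃
  have hT₃2 : MemLp T₃ 2 P := memLp_finsetSum _ fun k _ => (hΔ2 k).const_smul _
  have hTe : ∀ ω, T ω = ((stepPow α t)⁻¹ • Δ t ω - (stepPow α i)⁻¹ • Δ (i + 1) ω) + T₃ ω :=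
    fun ω => sum_inv_smul_sub (fun k => (stepPow α k)⁻¹) (fun k => Δ k ω) hti
  have hmono : (stepPow α t)⁻¹ ≤ (stepPow α i)⁻¹ := inv_stepPow_mono hα0.le hti
  have hi0 : 0 < (stepPow α i)⁻¹ := inv_pos.2 (hh i)
  have hsm : ∀ (a : ℝ) (k : ℕ), ∫ ω, ‖a • Δ k ω‖ ^ 2 ∂P = a ^ 2 * ∫ ω, ‖Δ k ω‖ ^ 2 ∂P :=
    fun a k => by
      rw [← integral_const_mul]
      refine integral_congr_ae (Filter.Eventually.of_forall fun ω => ?_)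
      simp only [norm_smul, mul_pow, Real.norm_eq_abs, sq_abs]
  have hTt : ∫ ω, ‖(stepPow α t)⁻¹ • Δ t ω‖ ^ 2 ∂P ≤ K * s * (stepPow α i)⁻¹ := by
    rw [hsm]
    have := hh t
    calc _ ≤ (stepPow α t)⁻¹ ^ 2 * (K * s * stepPow α t) := by gcongr; exact (hmom t).2.1
      _ = K * s * (stepPow α t)⁻¹ := by field_simp
      _ ≤ _ := by gcongr
  have hTi : ∫ ω, ‖(stepPow α i)⁻¹ • Δ (i + 1) ω‖ ^ 2 ∂P ≤ K * s * (stepPow α i)⁻¹ := by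
    rw [hsm]
    have := hh i
    calc _ ≤ (stepPow α i)⁻¹ ^ 2 * (K * s * stepPow α (i + 1)) := by
          gcongr; exact (hmom (i + 1)).2.1
      _ ≤ (stepPow α i)⁻¹ ^ 2 * (K * s * stepPow α i) := by
          gcongr; exact stepPow_antitone hα0.le (by omega)
      _ = _ := by field_simp
  -- The triangle inequality in `L²` with `‖Δ_k‖₂ ≲ √(s h_k)`; independence would not help here,
  -- since the `Δ_k` are strongly correlated.
  have hT3 : ∫ ω, ‖T₃ ω‖ ^ 2 ∂P ≤ 4 * (K * s * (stepPow α i)⁻¹) := by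
    have h := integral_norm_sum_smul_sq_le (P := P) (Finset.Ioc t i)
      (c := fun k => (stepPow α k)⁻¹ - (stepPow α (k - 1))⁻¹)
      (τ := fun k => √(K * s) * √(stepPow α k)) (X := Δ)
      (fun k _ => sub_nonneg.2 (inv_stepPow_mono hα0.le (by omega)))
      (fun k _ => mul_pos (Real.sqrt_pos.2 (by positivity)) (Real.sqrt_pos.2 (hh k)))
      (fun k _ => hΔ2 k) (fun k _ => by
        rw [mul_pow, Real.sq_sqrt (by positivity), Real.sq_sqrt (hh k).le]
        exact (hmom k).2.1)
    refine h.trans ?_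
    have h0 : 0 ≤ ∑ k ∈ Finset.Ioc t i, ((stepPow α k)⁻¹ - (stepPow α (k - 1))⁻¹)
        * √(stepPow α k) := Finset.sum_nonneg fun k _ =>
      mul_nonneg (sub_nonneg.2 (inv_stepPow_mono hα0.le (by omega))) (Real.sqrt_nonneg _)
    have h1 := sum_diff_inv_stepPow_mul_sqrt_le hα0.le hti
    calc _ = (√(K * s) * ∑ k ∈ Finset.Ioc t i, ((stepPow α k)⁻¹ - (stepPow α (k - 1))⁻¹)
        * √(stepPow α k)) ^ 2 := by
          rw [Finset.mul_sum]
          congr 1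
          exact Finset.sum_congr rfl fun k _ => by ring
      _ ≤ (√(K * s) * (2 * √(stepPow α i)⁻¹)) ^ 2 := by gcongr
      _ = _ := by
          rw [mul_pow, mul_pow, Real.sq_sqrt (by positivity), Real.sq_sqrt hi0.le]
          ring
  have hTm1 : MemLp (fun ω => (stepPow α t)⁻¹ • Δ t ω - (stepPow α i)⁻¹ • Δ (i + 1) ω) 2 P :=
    ((hΔ2 t).const_smul _).sub ((hΔ2 (i + 1)).const_smul _)
  have hT2 : MemLp T 2 P := by
    rw [show T = fun ω => ((stepPow α t)⁻¹ • Δ t ω - (stepPow α i)⁻¹ • Δ (i + 1) ω) + T₃ ω from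
      funext hTe]
    exact hTm1.add hT₃2
  have hTle : ∫ ω, ‖T ω‖ ^ 2 ∂P ≤ 16 * (K * s * (stepPow α i)⁻¹) := by
    simp_rw [hTe]
    have h1 := integral_norm_add_sq_le hTm1 hT₃2
    have h2 := integral_norm_sub_sq_le ((hΔ2 t).const_smul (stepPow α t)⁻¹)
      ((hΔ2 (i + 1)).const_smul (stepPow α i)⁻¹)
    simp only [Pi.smul_apply] at h2
    linarith
  -- the martingale part
  have hDsum : ∫ ω, ‖∑ k ∈ Finset.Icc t i, D k ω‖ ^ 2 ∂P
      ≤ 4 * κ ^ 2 * K * (1 - α)⁻¹ * s * (stepPow α i)⁻¹ := by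
    rw [integral_norm_sum_sq_of_orthogonal (Finset.Icc t i) (fun k => (hDm k).1)
      fun j k hjk => ?_]
    · calc _ ≤ ∑ k ∈ Finset.Icc t i, 4 * κ ^ 2 * (K * s * stepPow α k) := by
            refine Finset.sum_le_sum fun k _ => (hDm k).2.trans ?_
            gcongr
            exact (hmom k).2.1
        _ = 4 * κ ^ 2 * K * s * ∑ k ∈ Finset.Icc t i, stepPow α k := by
            rw [Finset.mul_sum]
            exact Finset.sum_congr rfl fun k _ => by ring
        _ ≤ 4 * κ ^ 2 * K * s * ((1 - α)⁻¹ * (stepPow α i)⁻¹) := by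
            gcongr
            exact sum_Icc_stepPow_le hα hα' t i
        _ = _ := by ring
    -- `D j` uses the noise up to time `j + 1 ≤ k`, while the fresh noise in `D k` has index `k +
    -- 1`.
    · have hj : Measurable[sigmaOf w (Set.Iic k)] (D j) :=
        (hDmeas j).mono (sigmaOf_mono w (Set.Iic_subset_Iic.2 hjk)) le_rfl
      exact integral_inner_comp_eq_zero (hmeas k) (hj.mono (sigmaOf_le hw _) le_rfl)
        (hlaw (k + 1)) (indepFun_next hw hindep ((hmeasp k).prodMk hj)) hg.measurable_fluct
        (fun y => (hg.integral_fluct y).1) (fun y => (hg.integral_fluct y).2)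
        (hDm j).1 (hDm k).1
  have hDS2 : MemLp (fun ω => ∑ k ∈ Finset.Icc t i, D k ω) 2 P :=
    memLp_finsetSum _ fun k _ => (hDm k).1
  -- the remainder
  have hRS2 : MemLp (fun ω => ∑ k ∈ Finset.Icc t i, R k ω) 2 P :=
    memLp_finsetSum _ fun k _ => hR2 k
  have hRsum : ∫ ω, ‖∑ k ∈ Finset.Icc t i, R k ω‖ ^ 2 ∂P
      ≤ K * (c ^ 2 * s ^ 2 * (∑ k ∈ Finset.Icc t i, stepPow α k) ^ 2) := by
    have h := integral_norm_sum_smul_sq_le (P := P) (Finset.Icc t i) (c := fun _ => 1)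
      (τ := fun k => c * (√K * s * stepPow α k)) (X := R) (fun _ _ => zero_le_one)
      (fun k _ => by have := hh k; have := Real.sqrt_pos.2 hK; positivity)
      (fun k _ => hR2 k) (fun k _ => hRint k)
    simp only [one_smul, one_mul] at h
    refine h.trans (le_of_eq ?_)
    rw [← Finset.mul_sum, ← Finset.mul_sum, mul_pow, mul_pow, mul_pow, Real.sq_sqrt hK.le]
    ring
  -- The recursion solved for `A Δ_k + g(0, w_{k+1})`: the full noisy direction is the increment
  -- divided by `η h_k`.
  have hid : ∀ ω, A (∑ k ∈ Finset.Icc t i, Δ k ω) + ∑ k ∈ Finset.Icc t i, g 0 (w (k + 1) ω)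
      = (η⁻¹ • T ω - ∑ k ∈ Finset.Icc t i, D k ω) - ∑ k ∈ Finset.Icc t i, R k ω := by
    intro ω
    rw [map_sum, ← Finset.sum_add_distrib, hT]
    simp only
    rw [Finset.smul_sum, ← Finset.sum_sub_distrib, ← Finset.sum_sub_distrib]
    refine Finset.sum_congr rfl fun k _ => ?_
    have e : Δ k ω - Δ (k + 1) ω = (η * stepPow α k) • g (Δ k ω) (w (k + 1) ω) := by
      simp [hΔ, descent]
    rw [e, smul_smul, smul_smul]
    have e2 : η⁻¹ * (stepPow α k)⁻¹ * (η * stepPow α k) = 1 := by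
      have := (hh k).ne'
      field_simp
    rw [e2, one_smul]
    simp only [hD, hR]
    abel
  simp_rw [hid]
  have hηT : MemLp (fun ω => η⁻¹ • T ω) 2 P := hT2.const_smul _
  have h1 := integral_norm_sub_sq_le (hηT.sub hDS2) hRS2
  have h2 := integral_norm_sub_sq_le hηT hDS2
  have h3 : ∫ ω, ‖η⁻¹ • T ω‖ ^ 2 ∂P = η⁻¹ ^ 2 * ∫ ω, ‖T ω‖ ^ 2 ∂P := by
    rw [← integral_const_mul]
    refine integral_congr_ae (Filter.Eventually.of_forall fun ω => ?_)
    simp only [norm_smul, mul_pow, Real.norm_eq_abs, sq_abs]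
  simp only [Pi.sub_apply] at h1
  have h4 := mul_le_mul_of_nonneg_left hTle (sq_nonneg η⁻¹)
  rw [h3] at h2
  set Z := s * (stepPow α i)⁻¹ with hZ
  set V := c ^ 2 * s ^ 2 * (∑ k ∈ Finset.Icc t i, stepPow α k) ^ 2 with hV
  have hZ0 : 0 ≤ Z := by positivity
  have hV0 : 0 ≤ V := by positivity
  have e1 : ∫ ω, ‖η⁻¹ • T ω - ∑ k ∈ Finset.Icc t i, D k ω - ∑ k ∈ Finset.Icc t i, R k ω‖ ^ 2 ∂P
      ≤ K₁ * Z + 2 * K * V := by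
    rw [hK₁, hZ]
    linarith
  have hK₁0 : 0 ≤ K₁ := by positivity
  nlinarith [mul_nonneg hK₁0 hV0, mul_nonneg hK.le hZ0]

end Descent

set_option linter.unusedSectionVars false

/-! ### Partial sums of the noise -/

section NoiseSums

variable {E W Ω : Type*} [NormedAddCommGroup E] [InnerProductSpace ℝ E]
  [MeasurableSpace E] [MeasurableSpace W]

/-- The partial sum of the noise at `0` over the time interval `[t, j)`. -/
def noiseSum (g : E → W → E) (w : ℕ → Ω → W) (t j : ℕ) (ω : Ω) : E :=
  ∑ k ∈ Finset.Ico t j, g 0 (w (k + 1) ω)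

theorem noiseSum_succ (g : E → W → E) (w : ℕ → Ω → W) {t j : ℕ} (h : t ≤ j) (ω : Ω) :
    noiseSum g w t (j + 1) ω = noiseSum g w t j ω + g 0 (w (j + 1) ω) :=
  Finset.sum_Ico_succ_top h _

variable [FiniteDimensional ℝ E] [BorelSpace E] [mΩ : MeasurableSpace Ω] {P : Measure Ω}
  [IsProbabilityMeasure P] {π : Measure W} [IsProbabilityMeasure π] {w : ℕ → Ω → W}
  {g : E → W → E} {μ κ s : ℝ}

theorem measurable_noiseSum (hg : Measurable (g 0)) (w : ℕ → Ω → W) (t j : ℕ) :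
    Measurable[sigmaOf w (Set.Ioc t j)] (noiseSum g w t j) := by
  unfold noiseSum
  refine Finset.measurable_fun_sum _ fun k hk => ?_
  rw [Finset.mem_Ico] at hk
  exact hg.comp (measurable_sigmaOf w (Set.mem_Ioc.2 ⟨by omega, by omega⟩))

/-- The noise at `0`, with the sign changed, is a noisy field without drift. -/
theorem IsNoisyField.neg_const (hg : IsNoisyField g π μ κ s) :
    IsNoisyField (fun _ v => -g 0 v) π 0 0 s where
  measurable := ((hg.measurable_apply 0).comp measurable_snd).neg
  s_pos := hg.s_pos
  integrable_zero := by simpa using hg.integrable_zero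
  fourth_zero := by simpa using hg.fourth_zero
  integrable_sub := by simp
  fourth_sub := by simp
  mean_zero := by rw [integral_neg, hg.mean_zero, neg_zero]
  mono y := by rw [integral_neg, hg.mean_zero]; simp

/-- A noise sum is a random walk, and each increment is one step of the scheme with step size `1`,
no drift and `κ = 0`. The constant `40` closes the fourth-moment induction: the increment `32 s² l +
24 s²` is below `40 s² (2l + 1)`. -/
theorem noiseSum_moments (hw : ∀ i, Measurable (w i)) (hindep : iIndepFun w P)
    (hlaw : ∀ i, HasLaw (w i) π P) (hg : IsNoisyField g π μ κ s) {t j : ℕ} (h : t ≤ j) :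
    Integrable (fun ω => ‖noiseSum g w t j ω‖ ^ 4) P ∧
    ∫ ω, ‖noiseSum g w t j ω‖ ^ 2 ∂P ≤ 2 * s * ((j : ℝ) - t) ∧
    ∫ ω, ‖noiseSum g w t j ω‖ ^ 4 ∂P ≤ 40 * s ^ 2 * ((j : ℝ) - t) ^ 2 := by
  induction j, h using Nat.le_induction with
  | base => simp [noiseSum]
  | succ j hj ih =>
    obtain ⟨i1, i2, i3⟩ := ih
    have hm0 := measurable_noiseSum (hg.measurable_apply 0) w t j
    have hm := hm0.mono (sigmaOf_mono w (Set.Ioc_subset_Iic_self)) le_rfl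
    have hstep := hg.neg_const.step (hm0.mono (sigmaOf_le hw _) le_rfl) (hw (j + 1))
      (hlaw (j + 1)) (indepFun_next hw hindep hm) i1 (t := 1) zero_le_one
    simp only [one_smul, sub_neg_eq_add, ← noiseSum_succ g w hj] at hstep
    refine ⟨hstep.1, hstep.2.1.trans ?_, hstep.2.2.trans ?_⟩
    · push_cast; linarith
    · have hs := hg.s_pos
      have hjt : (0 : ℝ) ≤ (j : ℝ) - t := by
        have : (t : ℝ) ≤ j := by exact_mod_cast hj
        linarith
      have := mul_le_mul_of_nonneg_left i2 (by positivity : 0 ≤ 16 * s)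
      push_cast
      nlinarith [mul_nonneg (sq_nonneg s) hjt]

theorem memLp_noiseSum (hw : ∀ i, Measurable (w i)) (hindep : iIndepFun w P)
    (hlaw : ∀ i, HasLaw (w i) π P) (hg : IsNoisyField g π μ κ s) {t j : ℕ} (h : t ≤ j) :
    MemLp (noiseSum g w t j) 2 P :=
  memLp_two_of_fourth ((measurable_noiseSum (hg.measurable_apply 0) w t j).mono
    (sigmaOf_le hw _) le_rfl).aestronglyMeasurable (noiseSum_moments hw hindep hlaw hg h).1

theorem integrable_inner_mul_inner {X Y : Ω → E} (hX : MemLp X 2 P) (hY : MemLp Y 2 P) (a b : E) :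
    Integrable (fun ω => inner ℝ a (X ω) * inner ℝ b (Y ω)) P :=
  MemLp.integrable_mul (hX.const_inner a) (hY.const_inner b)

/-- Covariances of independent centred increments add up, so a block of length `l` has covariance
exactly `l` times that of one noise vector. This is why dividing by the sum of the lengths is the
right normalization. -/
theorem integral_inner_noiseSum (hw : ∀ i, Measurable (w i)) (hindep : iIndepFun w P)
    (hlaw : ∀ i, HasLaw (w i) π P) (hg : IsNoisyField g π μ κ s) (a b : E) {t j : ℕ}
    (h : t ≤ j) :
    ∫ ω, inner ℝ a (noiseSum g w t j ω) * inner ℝ b (noiseSum g w t j ω) ∂P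
      = ((j : ℝ) - t) * ∫ v, inner ℝ a (g 0 v) * inner ℝ b (g 0 v) ∂π := by
  induction j, h using Nat.le_induction with
  | base => simp [noiseSum]
  | succ j hj ih =>
    set X := noiseSum g w t j with hX
    set G : Ω → E := fun ω => g 0 (w (j + 1) ω) with hG
    have hXm := (measurable_noiseSum (hg.measurable_apply 0) w t j).mono
      (sigmaOf_mono w (Set.Ioc_subset_Iic_self)) le_rfl
    have hind : IndepFun X (w (j + 1)) P := indepFun_next hw hindep hXm
    have hX2 : MemLp X 2 P := memLp_noiseSum hw hindep hlaw hg hj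
    have hXmeas : Measurable X := hXm.mono (sigmaOf_le hw _) le_rfl
    have hm := hg.measurable_apply 0
    have hGm : Measurable G := hm.comp (hw (j + 1))
    have hG2 : MemLp G 2 P := by
      refine memLp_two_of_sq hGm.aestronglyMeasurable ?_
      have := hg.integrable_sq 0
      rw [← (hlaw (j + 1)).map_eq] at this
      exact this.comp_measurable (hw (j + 1))
    have hG0 : ∀ c : E, ∫ ω, inner ℝ c (G ω) ∂P = 0 := fun c => by
      have e := (hlaw (j + 1)).integral_comp (f := fun v => inner ℝ c (g 0 v))
        (hm.const_inner (c := c)).aestronglyMeasurable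
      have e2 : ∫ v, inner ℝ c (g 0 v) ∂π = 0 := by
        rw [integral_inner (hg.integrable_apply 0), hg.mean_zero, inner_zero_right]
      rw [e2] at e
      exact e
    have hGG : ∫ ω, inner ℝ a (G ω) * inner ℝ b (G ω) ∂P
        = ∫ v, inner ℝ a (g 0 v) * inner ℝ b (g 0 v) ∂π :=
      (hlaw (j + 1)).integral_comp (f := fun v => inner ℝ a (g 0 v) * inner ℝ b (g 0 v))
        ((hm.const_inner (c := a)).mul (hm.const_inner (c := b))).aestronglyMeasurable
    have hcross : ∀ c c' : E, ∫ ω, inner ℝ c (X ω) * inner ℝ c' (G ω) ∂P = 0 := fun c c' => by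
      have hi : IndepFun (fun ω => inner ℝ c (X ω)) (fun ω => inner ℝ c' (G ω)) P :=
        hind.comp (φ := fun y => inner ℝ c y) (ψ := fun v => inner ℝ c' (g 0 v)) (by fun_prop)
          (hm.const_inner (c := c'))
      have := hi.integral_fun_mul_eq_mul_integral (hXmeas.const_inner (c := c)).aestronglyMeasurable
        (hGm.const_inner (c := c')).aestronglyMeasurable
      rw [this, hG0, mul_zero]
    have e : ∀ ω, inner ℝ a (noiseSum g w t (j + 1) ω) * inner ℝ b (noiseSum g w t (j + 1) ω)
        = (inner ℝ a (X ω) * inner ℝ b (X ω) + inner ℝ a (X ω) * inner ℝ b (G ω))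
          + (inner ℝ b (X ω) * inner ℝ a (G ω) + inner ℝ a (G ω) * inner ℝ b (G ω)) := fun ω => by
      rw [noiseSum_succ g w hj, inner_add_right, inner_add_right]
      ring
    simp_rw [e]
    have k1 := integrable_inner_mul_inner hX2 hX2 a b
    have k2 := integrable_inner_mul_inner hX2 hG2 a b
    have k3 := integrable_inner_mul_inner hX2 hG2 b a
    have k4 := integrable_inner_mul_inner hG2 hG2 a b
    have k12 : Integrable (fun ω => inner ℝ a (X ω) * inner ℝ b (X ω)
      + inner ℝ a (X ω) * inner ℝ b (G ω)) P := k1.add k2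
    have k34 : Integrable (fun ω => inner ℝ b (X ω) * inner ℝ a (G ω)
      + inner ℝ a (G ω) * inner ℝ b (G ω)) P := k3.add k4
    rw [integral_add k12 k34, integral_add k1 k2, integral_add k3 k4, hcross, hcross, hGG, ih]
    push_cast
    ring

/-- The centered `(a, b)` entry of the outer product of a noise sum. -/
def centeredEntry (g : E → W → E) (w : ℕ → Ω → W) (π : Measure W) (a b : E) (t j : ℕ) (ω : Ω) : ℝ :=
  inner ℝ a (noiseSum g w t j ω) * inner ℝ b (noiseSum g w t j ω)
    - ((j : ℝ) - t) * ∫ v, inner ℝ a (g 0 v) * inner ℝ b (g 0 v) ∂π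

theorem measurable_centeredEntry (hg : IsNoisyField g π μ κ s) (w : ℕ → Ω → W) (a b : E) (t j : ℕ) :
    Measurable[sigmaOf w (Set.Ioc t j)] (centeredEntry g w π a b t j) := by
  have hm := measurable_noiseSum (hg.measurable_apply 0) w t j
  exact ((hm.const_inner (c := a)).mul (hm.const_inner (c := b))).sub_const _

/-- The constant is `82 = 2 · 40 + 2`: fourth moment of the noise sum plus the squared centring. -/
theorem centeredEntry_moments (hw : ∀ i, Measurable (w i)) (hindep : iIndepFun w P)
    (hlaw : ∀ i, HasLaw (w i) π P) (hg : IsNoisyField g π μ κ s) {a b : E} (ha : ‖a‖ ≤ 1)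
    (hb : ‖b‖ ≤ 1) {t j : ℕ} (h : t ≤ j) :
    ∫ ω, centeredEntry g w π a b t j ω ∂P = 0 ∧
    MemLp (centeredEntry g w π a b t j) 2 P ∧
    ∫ ω, centeredEntry g w π a b t j ω ^ 2 ∂P ≤ 82 * s ^ 2 * ((j : ℝ) - t) ^ 2 := by
  have hS2 := memLp_noiseSum hw hindep hlaw hg h
  obtain ⟨m1, -, m3⟩ := noiseSum_moments hw hindep hlaw hg h
  set S := noiseSum g w t j with hS
  set v := ∫ v, inner ℝ a (g 0 v) * inner ℝ b (g 0 v) ∂π with hv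
  set l := (j : ℝ) - t with hl
  have hab := integrable_inner_mul_inner hS2 hS2 a b
  have hvle : v ^ 2 ≤ s ^ 2 := by
    have h1 : |v| ≤ ∫ v, ‖g 0 v‖ ^ 2 ∂π := by
      rw [← Real.norm_eq_abs, hv]
      refine norm_integral_le_of_norm_le (hg.integrable_sq 0)
        (Filter.Eventually.of_forall fun v => ?_)
      rw [norm_mul]
      calc _ ≤ (‖a‖ * ‖g 0 v‖) * (‖b‖ * ‖g 0 v‖) := by gcongr <;> exact norm_inner_le_norm _ _
        _ ≤ (1 * ‖g 0 v‖) * (1 * ‖g 0 v‖) := by gcongr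
        _ = _ := by ring
    exact sq_le_sq' (by linarith [neg_abs_le v, h1.trans hg.second_zero])
      ((le_abs_self v).trans (h1.trans hg.second_zero))
  have hpt : ∀ ω, centeredEntry g w π a b t j ω ^ 2 ≤ 2 * ‖S ω‖ ^ 4 + 2 * (l ^ 2 * s ^ 2) := by
    intro ω
    have h1 : (inner ℝ a (S ω) * inner ℝ b (S ω)) ^ 2 ≤ ‖S ω‖ ^ 4 := by
      have ea : inner ℝ a (S ω) ^ 2 ≤ ‖S ω‖ ^ 2 := by
        refine sq_le_sq' ?_ ?_ <;>
        nlinarith [abs_le.1 (abs_real_inner_le_norm a (S ω)), norm_nonneg (S ω)]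
      have eb : inner ℝ b (S ω) ^ 2 ≤ ‖S ω‖ ^ 2 := by
        refine sq_le_sq' ?_ ?_ <;>
        nlinarith [abs_le.1 (abs_real_inner_le_norm b (S ω)), norm_nonneg (S ω)]
      calc _ = inner ℝ a (S ω) ^ 2 * inner ℝ b (S ω) ^ 2 := by ring
        _ ≤ ‖S ω‖ ^ 2 * ‖S ω‖ ^ 2 := by gcongr
        _ = _ := by ring
    have h2 := add_sq_le_two (inner ℝ a (S ω) * inner ℝ b (S ω)) (-(l * v))
    have h3 : (l * v) ^ 2 ≤ l ^ 2 * s ^ 2 := by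
      rw [mul_pow]; gcongr
    rw [neg_sq, ← sub_eq_add_neg] at h2
    exact h2.trans (by linarith)
  have hmeas : Measurable (centeredEntry g w π a b t j) :=
    (measurable_centeredEntry hg w a b t j).mono (sigmaOf_le hw _) le_rfl
  have hdom : Integrable (fun ω => 2 * ‖S ω‖ ^ 4 + 2 * (l ^ 2 * s ^ 2)) P :=
    (m1.const_mul 2).add (integrable_const _)
  have hint : Integrable (fun ω => centeredEntry g w π a b t j ω ^ 2) P := by
    refine hdom.mono' (hmeas.pow_const 2).aestronglyMeasurable
      (Filter.Eventually.of_forall fun ω => ?_)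
    rw [Real.norm_eq_abs, abs_of_nonneg (sq_nonneg _)]
    exact hpt ω
  refine ⟨?_, (memLp_two_iff_integrable_sq hmeas.aestronglyMeasurable).2 hint, ?_⟩
  · unfold centeredEntry
    rw [integral_sub hab (integrable_const _), integral_inner_noiseSum hw hindep hlaw hg a b h]
    simp
  · refine (integral_mono hint hdom hpt).trans ?_
    rw [integral_add (m1.const_mul 2) (integrable_const _), integral_const_mul]
    simp only [integral_const, probReal_univ, one_smul]
    linarith

/-- Second moment of the sum of the centered entries over a family of time intervals, two of which
are disjoint as soon as their starting points differ. -/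
theorem integral_sq_sum_centeredEntry_le (hw : ∀ i, Measurable (w i)) (hindep : iIndepFun w P)
    (hlaw : ∀ i, HasLaw (w i) π P) (hg : IsNoisyField g π μ κ s) {a b : E} (ha : ‖a‖ ≤ 1)
    (hb : ‖b‖ ≤ 1) (I : Finset ℕ) {T : ℕ → ℕ} (hT : ∀ i, T i ≤ i) {l : ℝ}
    (hl : ∀ i ∈ I, ((i + 1 : ℕ) : ℝ) - T i ≤ l)
    (hdisj : ∀ i ∈ I, ∀ j ∈ I, T i ≠ T j → i < T j ∨ j < T i) :
    ∫ ω, (∑ i ∈ I, centeredEntry g w π a b (T i) (i + 1) ω) ^ 2 ∂P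
      ≤ 82 * s ^ 2 * l ^ 2 * ∑ i ∈ I, ∑ j ∈ I, (if T i = T j then (1 : ℝ) else 0) := by
  set Y : ℕ → Ω → ℝ := fun i => centeredEntry g w π a b (T i) (i + 1) with hY
  have hmom := fun i => centeredEntry_moments hw hindep hlaw hg ha hb
    (show T i ≤ i + 1 from (hT i).trans (Nat.le_succ i))
  have hint : ∀ i j, Integrable (fun ω => Y i ω * Y j ω) P := fun i j =>
    MemLp.integrable_mul (hmom i).2.1 (hmom j).2.1
  have hsq : ∀ i ∈ I, ∫ ω, Y i ω ^ 2 ∂P ≤ 82 * s ^ 2 * l ^ 2 := fun i hi => by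
    refine (hmom i).2.2.trans ?_
    have h0 : (0 : ℝ) ≤ ((i + 1 : ℕ) : ℝ) - T i := by
      rw [sub_nonneg]; exact_mod_cast (hT i).trans (Nat.le_succ i)
    have := hl i hi
    gcongr
  have e : ∀ ω, (∑ i ∈ I, Y i ω) ^ 2 = ∑ i ∈ I, ∑ j ∈ I, Y i ω * Y j ω := fun ω => by
    rw [sq, Finset.sum_mul_sum]
  rw [integral_congr_ae (Filter.Eventually.of_forall e),
    integral_finsetSum I fun i _ => integrable_finsetSum I fun j _ => hint i j, Finset.mul_sum]
  refine Finset.sum_le_sum fun i hi => ?_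
  rw [integral_finsetSum I fun j _ => hint i j, Finset.mul_sum]
  refine Finset.sum_le_sum fun j hj => ?_
  -- Same starting point: bound the product by half the sum of squares. Different starting points:
  -- the intervals are disjoint, so the entries are independent and centred.
  split_ifs with hij
  · have h2 : ∀ k, Integrable (fun ω => Y k ω ^ 2) P := fun k => (hmom k).2.1.integrable_sq
    calc ∫ ω, Y i ω * Y j ω ∂P ≤ ∫ ω, (Y i ω ^ 2 / 2 + Y j ω ^ 2 / 2) ∂P :=
          integral_mono (hint i j) (((h2 i).div_const 2).add ((h2 j).div_const 2)) fun ω => by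
            simp only
            nlinarith [sq_nonneg (Y i ω - Y j ω)]
      _ = (∫ ω, Y i ω ^ 2 ∂P) / 2 + (∫ ω, Y j ω ^ 2 ∂P) / 2 := by
          rw [integral_add ((h2 i).div_const 2) ((h2 j).div_const 2), integral_div, integral_div]
      _ ≤ _ := by linarith [hsq i hi, hsq j hj]
  · rw [mul_zero]
    have hd : Disjoint (Set.Ioc (T i) (i + 1)) (Set.Ioc (T j) (j + 1)) := by
      rw [Set.disjoint_left]
      intro k hk hk'
      rw [Set.mem_Ioc] at hk hk'
      rcases hdisj i hi j hj hij with h | h <;> omega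
    have hind : IndepFun (Y i) (Y j) P :=
      indepFun_of_sigmaOf hw hindep hd (measurable_centeredEntry hg w a b _ _)
        (measurable_centeredEntry hg w a b _ _)
    have := hind.integral_fun_mul_eq_mul_integral (hmom i).2.1.1 (hmom j).2.1.1
    rw [this, (hmom i).1, zero_mul]

end NoiseSums

/-! ### Operators -/

section Operators

variable {E : Type*} [NormedAddCommGroup E] [InnerProductSpace ℝ E]

/-- Reduces the operator norm to scalar entries, for which variances can be computed. -/
theorem opNorm_le_sum_entries {ι : Type*} [Fintype ι] (b : OrthonormalBasis ι ℝ E) (T : E →L[ℝ] E) :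
    ‖T‖ ≤ ∑ p, ∑ q, |inner ℝ (b p) (T (b q))| := by
  refine ContinuousLinearMap.opNorm_le_bound _
    (Finset.sum_nonneg fun _ _ => Finset.sum_nonneg fun _ _ => abs_nonneg _) fun x => ?_
  have h1 : ∀ q, ‖T (b q)‖ ≤ ∑ p, |inner ℝ (b p) (T (b q))| := fun q => by
    conv_lhs => rw [← b.sum_repr' (T (b q))]
    refine (norm_sum_le _ _).trans (le_of_eq ?_)
    exact Finset.sum_congr rfl fun p _ => by
      rw [norm_smul, b.norm_eq_one, mul_one, Real.norm_eq_abs]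
  conv_lhs => rw [← b.sum_repr' x, map_sum]
  rw [Finset.sum_comm, Finset.sum_mul]
  refine (norm_sum_le _ _).trans (Finset.sum_le_sum fun q _ => ?_)
  rw [map_smul, norm_smul, mul_comm]
  gcongr
  · exact h1 q
  · refine (norm_inner_le_norm _ _).trans ?_
    rw [b.norm_eq_one, one_mul]

/-- Coercivity bounds `A` from below, so it is injective, hence bijective in finite dimension;
`A.inverse` is then the true inverse and not the default value `0`. -/
theorem exists_inverse_of_coercive [FiniteDimensional ℝ E] {A : E →L[ℝ] E} {μ : ℝ} (hμ : 0 < μ)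
    (hA : ∀ v, μ * ‖v‖ ^ 2 ≤ inner ℝ (A v) v) :
    (∀ v, A (A.inverse v) = v) ∧ (∀ v, A.inverse (A v) = v) ∧ ∀ v, ‖A.inverse v‖ ≤ μ⁻¹ * ‖v‖ := by
  have hlow : ∀ v, μ * ‖v‖ ≤ ‖A v‖ := fun v => by
    rcases eq_or_ne v 0 with rfl | hv
    · simp
    · have h1 := (hA v).trans (real_inner_le_norm _ _)
      have h2 := norm_pos_iff.2 hv
      rw [sq, ← mul_assoc] at h1
      exact le_of_mul_le_mul_right h1 h2
  have hinj : Function.Injective A := by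
    rw [injective_iff_map_eq_zero]
    intro v hv
    have := hlow v
    rw [hv, norm_zero] at this
    have h3 : ‖v‖ ≤ 0 := by
      by_contra h
      push Not at h
      nlinarith
    exact norm_le_zero_iff.1 h3
  let e : E ≃L[ℝ] E :=
    (LinearEquiv.ofInjectiveEndo (A : E →ₗ[ℝ] E) hinj).toContinuousLinearEquiv
  have he : A = (e : E →L[ℝ] E) := by
    ext v
    rfl
  have hinv : A.inverse = (e.symm : E →L[ℝ] E) := by
    rw [he, ContinuousLinearMap.inverse_equiv]
  have h1 : ∀ v, A (A.inverse v) = v := fun v => by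
    rw [hinv, he]; simp
  refine ⟨h1, fun v => by rw [hinv, he]; simp, fun v => ?_⟩
  have := hlow (A.inverse v)
  rw [h1] at this
  rw [inv_mul_eq_div, le_div_iff₀ hμ]
  linarith

end Operators

/-! ### Outer products and the covariance estimator -/

section Outer

variable {d : ℕ}

theorem outer_apply (v x : EuclideanSpace ℝ (Fin d)) : outer v x = inner ℝ v x • v := rfl

theorem norm_outer_le (v : EuclideanSpace ℝ (Fin d)) : ‖outer v‖ ≤ ‖v‖ ^ 2 := by
  refine ContinuousLinearMap.opNorm_le_bound _ (sq_nonneg _) fun x => ?_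
  rw [outer_apply, norm_smul]
  calc _ ≤ (‖v‖ * ‖x‖) * ‖v‖ := by gcongr; exact norm_inner_le_norm v x
    _ = _ := by ring

theorem continuous_outer : Continuous (outer : EuclideanSpace ℝ (Fin d) → _) := by
  exact ((InnerProductSpace.rankOne ℝ : EuclideanSpace ℝ (Fin d) →L[ℝ] _).continuous).clm_apply
    continuous_id

/-- The terms quadratic in `u` cancel, and Young's inequality with a free parameter `δ` splits the
cross terms. -/
theorem norm_outer_sub_le {δ : ℝ} (hδ : 0 < δ) (r u : EuclideanSpace ℝ (Fin d)) :
    ‖outer (r - u) - outer u‖ ≤ (1 + δ⁻¹) * ‖r‖ ^ 2 + δ * ‖u‖ ^ 2 := by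
  have h1 : ‖outer (r - u) - outer u‖ ≤ ‖r‖ ^ 2 + 2 * (‖r‖ * ‖u‖) := by
    refine ContinuousLinearMap.opNorm_le_bound _ (by positivity) fun x => ?_
    have e : (outer (r - u) - outer u) x
        = inner ℝ r x • r - (inner ℝ r x • u + inner ℝ u x • r) := by
      rw [sub_apply, outer_apply, outer_apply, inner_sub_left]
      module
    rw [e]
    have a1 := norm_inner_le_norm (𝕜 := ℝ) r x
    have a2 := norm_inner_le_norm (𝕜 := ℝ) u x
    calc _ ≤ ‖inner ℝ r x • r‖ + (‖inner ℝ r x • u‖ + ‖inner ℝ u x • r‖) :=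
          (norm_sub_le _ _).trans (by gcongr; exact norm_add_le _ _)
      _ ≤ (‖r‖ * ‖x‖) * ‖r‖ + ((‖r‖ * ‖x‖) * ‖u‖ + (‖u‖ * ‖x‖) * ‖r‖) := by
          simp only [norm_smul]
          gcongr
      _ = _ := by ring
  have h2 : 2 * (‖r‖ * ‖u‖) ≤ δ⁻¹ * ‖r‖ ^ 2 + δ * ‖u‖ ^ 2 := by
    have h3 : 0 ≤ δ⁻¹ * (‖r‖ - δ * ‖u‖) ^ 2 := by positivity
    have h4 : δ⁻¹ * (‖r‖ - δ * ‖u‖) ^ 2 = δ⁻¹ * ‖r‖ ^ 2 + δ * ‖u‖ ^ 2 - 2 * (‖r‖ * ‖u‖) := by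
      field_simp
      ring
    linarith
  linarith

theorem outer_map {B : EuclideanSpace ℝ (Fin d) →L[ℝ] EuclideanSpace ℝ (Fin d)}
    (hB : ∀ v x, inner ℝ (B v) x = inner ℝ v (B x)) (v : EuclideanSpace ℝ (Fin d)) :
    outer (B v) = B ∘L outer v ∘L B := by
  ext1 x
  rw [outer_apply, hB]
  simp [outer_apply]

/-- Separates the sampling error of the noise blocks `v i`, conjugated by `B`, from the effect of
the remainders `r i`. The parameter `δ` is left free to be matched with the convergence rate. -/
theorem norm_average_outer_sub_le {B S : EuclideanSpace ℝ (Fin d) →L[ℝ] EuclideanSpace ℝ (Fin d)}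
    (hB : ∀ v x, inner ℝ (B v) x = inner ℝ v (B x)) {β : ℝ} (hβ : 0 ≤ β)
    (hBn : ∀ v, ‖B v‖ ≤ β * ‖v‖) {δ Λ : ℝ} (hδ : 0 < δ) (hΛ : 0 ≤ Λ) (I : Finset ℕ)
    (r v : ℕ → EuclideanSpace ℝ (Fin d)) :
    ‖Λ⁻¹ • ∑ i ∈ I, outer (r i - B (v i)) - B ∘L S ∘L B‖
      ≤ β ^ 2 * ‖Λ⁻¹ • ∑ i ∈ I, outer (v i) - S‖
        + (δ * β ^ 2 * (Λ⁻¹ * ∑ i ∈ I, ‖v i‖ ^ 2) + (1 + δ⁻¹) * (Λ⁻¹ * ∑ i ∈ I, ‖r i‖ ^ 2)) := by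
  have e : Λ⁻¹ • ∑ i ∈ I, outer (r i - B (v i)) - B ∘L S ∘L B
      = B ∘L (Λ⁻¹ • ∑ i ∈ I, outer (v i) - S) ∘L B
        + Λ⁻¹ • ∑ i ∈ I, (outer (r i - B (v i)) - outer (B (v i))) := by
    simp_rw [outer_map hB]
    ext1 x
    simp [map_sum, smul_sub, Finset.sum_sub_distrib]
  rw [e]
  refine (norm_add_le _ _).trans (add_le_add ?_ ?_)
  · have hB1 : ‖B‖ ≤ β := B.opNorm_le_bound hβ hBn
    calc _ ≤ ‖B‖ * (‖Λ⁻¹ • ∑ i ∈ I, outer (v i) - S‖ * ‖B‖) :=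
          (ContinuousLinearMap.opNorm_comp_le _ _).trans
            (by gcongr; exact ContinuousLinearMap.opNorm_comp_le _ _)
      _ ≤ β * (‖Λ⁻¹ • ∑ i ∈ I, outer (v i) - S‖ * β) := by gcongr
      _ = _ := by ring
  · have hΛ' : 0 ≤ Λ⁻¹ := inv_nonneg.2 hΛ
    rw [norm_smul, Real.norm_eq_abs, abs_of_nonneg hΛ']
    calc _ ≤ Λ⁻¹ * ∑ i ∈ I, ((1 + δ⁻¹) * ‖r i‖ ^ 2 + δ * (β * ‖v i‖) ^ 2) := by
          gcongr
          refine (norm_sum_le _ _).trans (Finset.sum_le_sum fun i _ => ?_)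
          refine (norm_outer_sub_le hδ _ _).trans ?_
          gcongr
          exact hBn _
      _ = _ := by
          rw [Finset.sum_add_distrib, ← Finset.mul_sum, ← Finset.mul_sum]
          simp_rw [mul_pow]
          rw [← Finset.mul_sum]
          ring

/-- A block sum moves by `l_i x₀`, and so does `l_i` times the average. For `n = 0` the average is
`0` and does not move, hence `1 ≤ n`. -/
theorem covEst_const_add (a : ℕ → ℕ) (x₀ : EuclideanSpace ℝ (Fin d))
    (x : ℕ → EuclideanSpace ℝ (Fin d)) {n : ℕ} (hn : 1 ≤ n) :
    covEst a (fun k => x₀ + x k) n = covEst a x n := by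
  have hn0 : (n : ℝ) ≠ 0 := by positivity
  unfold covEst
  congr 1
  refine Finset.sum_congr rfl fun i _ => ?_
  congr 1
  have h1 : average (fun k => x₀ + x k) n = x₀ + average x n := by
    unfold average
    rw [Finset.sum_add_distrib, Finset.sum_const, Finset.card_range, smul_add,
      ← Nat.cast_smul_eq_nsmul ℝ, smul_smul, inv_mul_cancel₀ hn0, one_smul]
  rw [h1, Finset.sum_add_distrib, Finset.sum_const, card_Icc_batch,
    ← Nat.cast_smul_eq_nsmul ℝ, smul_add]
  abel

end Outer

/-! ### Error bounds -/

section ErrorBounds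

set_option linter.unusedSectionVars false

variable {d : ℕ} {W Ω : Type*} [MeasurableSpace W] [mΩ : MeasurableSpace Ω] {P : Measure Ω}
  [IsProbabilityMeasure P] {π : Measure W} [IsProbabilityMeasure π] {w : ℕ → Ω → W} {κ : ℝ}

theorem batchStart_disjoint {C α : ℝ} (hbatch : StrictMonoOn (batchSeq C α) (Set.Ici 1)) {i j : ℕ}
    (hi : 1 ≤ i) (hj : 1 ≤ j) (h : batchStart (batchSeq C α) i ≠ batchStart (batchSeq C α) j) :
    i < batchStart (batchSeq C α) j ∨ j < batchStart (batchSeq C α) i := by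
  obtain ⟨m, hm, h1, h2⟩ := exists_batch hbatch (batchSeq_one C α) hi
  obtain ⟨m', hm', h1', h2'⟩ := exists_batch hbatch (batchSeq_one C α) hj
  rw [batchStart_eq hbatch hm h1 h2, batchStart_eq hbatch hm' h1' h2'] at *
  have hmm : m ≠ m' := fun e => h (by rw [e])
  rcases lt_or_gt_of_ne hmm with hlt | hlt
  · have := hbatch.monotoneOn (Set.mem_Ici.2 (by omega : 1 ≤ m + 1)) (Set.mem_Ici.2 hm')
      (by omega : m + 1 ≤ m')
    left; omega
  · have := hbatch.monotoneOn (Set.mem_Ici.2 (by omega : 1 ≤ m' + 1)) (Set.mem_Ici.2 hm)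
      (by omega : m' + 1 ≤ m)
    right; omega

theorem batchLen_cast (a : ℕ → ℕ) (i : ℕ) :
    (batchLen a i : ℝ) = ((i + 1 : ℕ) : ℝ) - batchStart a i := by
  have := batchStart_le a i
  unfold batchLen
  push_cast [Nat.cast_sub this]
  ring

/-- The empirical covariance of the block sums of the noise converges to the noise covariance. -/
theorem exists_empirical_covariance_bound (hw : ∀ i, Measurable (w i)) (hindep : iIndepFun w P)
    (hlaw : ∀ i, HasLaw (w i) π P) {α C μ : ℝ} (hα : 0 < α) (hα' : α < 1) (hC : 0 < C)
    (hbatch : StrictMonoOn (batchSeq C α) (Set.Ici 1)) :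
    ∃ K : ℝ, 0 < K ∧ ∀ (g : EuclideanSpace ℝ (Fin d) → W → EuclideanSpace ℝ (Fin d)) (s : ℝ),
      IsNoisyField g π μ κ s → ∀ n : ℕ, 1 ≤ n →
      Integrable (fun ω => ‖(∑ i ∈ Finset.Icc 1 n, (batchLen (batchSeq C α) i : ℝ))⁻¹ •
        ∑ i ∈ Finset.Icc 1 n, outer (noiseSum g w (batchStart (batchSeq C α) i) (i + 1) ω)
        - ∫ v, outer (g 0 v) ∂π‖) P ∧
      ∫ ω, ‖(∑ i ∈ Finset.Icc 1 n, (batchLen (batchSeq C α) i : ℝ))⁻¹ •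
        ∑ i ∈ Finset.Icc 1 n, outer (noiseSum g w (batchStart (batchSeq C α) i) (i + 1) ω)
        - ∫ v, outer (g 0 v) ∂π‖ ∂P ≤ K * s * (n : ℝ) ^ (-((1 - α) / 4)) := by
  obtain ⟨c₁, hc₁, H₁⟩ := exists_batchLen_le hC hα hα' hbatch
  obtain ⟨c₂, hc₂, H₂⟩ := exists_sum_batchLen_ge hC hα' hbatch
  set K₀ := 1 / 2 + 82 * c₁ ^ 2 * c₂⁻¹ with hK₀
  have hK₀' : 0 < K₀ := by positivity
  refine ⟨(d : ℝ) ^ 2 * K₀ + 1, by positivity, fun g s hg n hn => ?_⟩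
  have hs := hg.s_pos
  have hn0 : (0 : ℝ) < n := by exact_mod_cast hn
  set T := batchStart (batchSeq C α) with hT
  set l := batchLen (batchSeq C α) with hl
  set I := Finset.Icc 1 n with hI
  set Λ := ∑ i ∈ I, (l i : ℝ) with hΛ
  set δ := (n : ℝ) ^ (-((1 - α) / 4)) with hδ
  have hδ0 : 0 < δ := Real.rpow_pos_of_pos hn0 _
  have hΛn : c₂ * (n : ℝ) ^ (1 + (1 + α) / 2) ≤ Λ := H₂ n hn
  have hΛ0 : 0 < Λ := lt_of_lt_of_le (by positivity) hΛn
  have hTi : ∀ i, T i ≤ i := batchStart_le _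
  have hli : ∀ i ∈ I, ((i + 1 : ℕ) : ℝ) - T i ≤ c₁ * (n : ℝ) ^ ((1 + α) / 2) := fun i hi => by
    rw [hI, Finset.mem_Icc] at hi
    rw [hT, ← batchLen_cast]
    refine (H₁ i hi.1).trans ?_
    gcongr
    exact hi.2
  have hdisj : ∀ i ∈ I, ∀ j ∈ I, T i ≠ T j → i < T j ∨ j < T i := fun i hi j hj h =>
    batchStart_disjoint hbatch (Finset.mem_Icc.1 hi).1 (Finset.mem_Icc.1 hj).1 h
  set b := EuclideanSpace.basisFun (Fin d) ℝ with hb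
  have hb1 : ∀ p, ‖b p‖ ≤ 1 := fun p => (b.norm_eq_one p).le
  set X : Fin d → Fin d → Ω → ℝ := fun p q ω =>
    Λ⁻¹ * ∑ i ∈ I, centeredEntry g w π (b p) (b q) (T i) (i + 1) ω with hX
  set D : Ω → EuclideanSpace ℝ (Fin d) →L[ℝ] EuclideanSpace ℝ (Fin d) := fun ω =>
    Λ⁻¹ • ∑ i ∈ I, outer (noiseSum g w (T i) (i + 1) ω) - ∫ v, outer (g 0 v) ∂π with hD
  have hout : Integrable (fun v => outer (g 0 v)) π := by
    refine (hg.integrable_sq 0).mono'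
      (continuous_outer.comp_aestronglyMeasurable (hg.measurable_apply 0).aestronglyMeasurable)
      (Filter.Eventually.of_forall fun v => norm_outer_le _)
  -- Since the lengths add up to `Λ`, subtracting the noise covariance amounts to centring every
  -- summand.
  have hentry : ∀ p q ω, inner ℝ (b p) (D ω (b q)) = X p q ω := by
    intro p q ω
    have e1 : inner ℝ (b p) ((∫ v, outer (g 0 v) ∂π) (b q))
        = ∫ v, inner ℝ (b p) (g 0 v) * inner ℝ (b q) (g 0 v) ∂π := by
      rw [ContinuousLinearMap.integral_apply hout, ← integral_inner (𝕜 := ℝ)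
        (hout.apply_continuousLinearMap (b q))]
      refine integral_congr_ae (Filter.Eventually.of_forall fun v => ?_)
      simp only [outer_apply, inner_smul_right]
      rw [real_inner_comm, mul_comm]
    have e2 : inner ℝ (b p) ((Λ⁻¹ • ∑ i ∈ I, outer (noiseSum g w (T i) (i + 1) ω)) (b q))
        = Λ⁻¹ * ∑ i ∈ I, inner ℝ (b p) (noiseSum g w (T i) (i + 1) ω)
          * inner ℝ (b q) (noiseSum g w (T i) (i + 1) ω) := by
      rw [smul_apply, inner_smul_right, sum_apply, inner_sum]
      congr 1
      refine Finset.sum_congr rfl fun i _ => ?_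
      rw [outer_apply, inner_smul_right, real_inner_comm, mul_comm]
    rw [hD]
    simp only
    rw [sub_apply, inner_sub_right, e1, e2, hX]
    simp only [centeredEntry]
    rw [Finset.sum_sub_distrib, ← Finset.sum_mul]
    have e3 : ∑ i ∈ I, (((i + 1 : ℕ) : ℝ) - T i) = Λ :=
      Finset.sum_congr rfl fun i _ => (batchLen_cast _ i).symm
    rw [e3]
    field_simp
  have hmom := fun p q i => centeredEntry_moments hw hindep hlaw hg (hb1 p) (hb1 q)
    (show T i ≤ i + 1 from (hTi i).trans (Nat.le_succ i))
  have hXL : ∀ p q, MemLp (X p q) 2 P := fun p q =>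
    (memLp_finsetSum I fun i _ => (hmom p q i).2.1).const_mul _
  have hε : δ ^ 2 * (n : ℝ) ^ (1 + (1 + α) / 2) = ((n : ℝ) ^ ((1 + α) / 2)) ^ 2 := by
    rw [hδ, ← Real.rpow_natCast, ← Real.rpow_natCast, ← Real.rpow_mul hn0.le,
      ← Real.rpow_mul hn0.le, ← Real.rpow_add hn0]
    congr 1; push_cast; ring
  -- Only the at most `2Λ` pairs in a common batch contribute, each `82 s²` times the squared
  -- maximal length, which explains `164`.
  have hXsq : ∀ p q, ∫ ω, X p q ω ^ 2 ∂P ≤ 164 * s ^ 2 * c₁ ^ 2 * c₂⁻¹ * δ ^ 2 := by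
    intro p q
    have h1 := integral_sq_sum_centeredEntry_le hw hindep hlaw hg (hb1 p) (hb1 q) I hTi hli hdisj
    have h2 := card_pairs_le (batchSeq C α) n
    have e1 : ∫ ω, X p q ω ^ 2 ∂P = Λ⁻¹ ^ 2
        * ∫ ω, (∑ i ∈ I, centeredEntry g w π (b p) (b q) (T i) (i + 1) ω) ^ 2 ∂P := by
      rw [← integral_const_mul]
      refine integral_congr_ae (Filter.Eventually.of_forall fun ω => ?_)
      simp only [hX]
      ring
    rw [e1]
    calc _ ≤ Λ⁻¹ ^ 2 * (82 * s ^ 2 * (c₁ * (n : ℝ) ^ ((1 + α) / 2)) ^ 2 * (2 * Λ)) := by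
          refine mul_le_mul_of_nonneg_left (h1.trans ?_) (sq_nonneg _)
          gcongr
      _ = 164 * s ^ 2 * c₁ ^ 2 * (δ ^ 2 * (n : ℝ) ^ (1 + (1 + α) / 2)) * Λ⁻¹ := by
          rw [hε]; field_simp; ring
      _ ≤ 164 * s ^ 2 * c₁ ^ 2 * (δ ^ 2 * (n : ℝ) ^ (1 + (1 + α) / 2))
          * (c₂ * (n : ℝ) ^ (1 + (1 + α) / 2))⁻¹ := by
          gcongr
      _ = _ := by
          have : (n : ℝ) ^ (1 + (1 + α) / 2) ≠ 0 := by positivity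
          field_simp
  -- Young's inequality at the scale `δ s` passes from the second moment, of order `s² δ²`, to the
  -- first.
  have hXabs : ∀ p q, ∫ ω, |X p q ω| ∂P ≤ K₀ * s * δ := by
    intro p q
    have hXi : Integrable (fun ω => |X p q ω|) P := ((hXL p q).integrable (by norm_num)).abs
    have hX2 : Integrable (fun ω => X p q ω ^ 2) P := (hXL p q).integrable_sq
    calc _ ≤ ∫ ω, (δ * s / 2 + (2 * (δ * s))⁻¹ * X p q ω ^ 2) ∂P := by
          refine integral_mono hXi ((integrable_const _).add (hX2.const_mul _)) fun ω => ?_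
          have hp : 0 < δ * s := by positivity
          have h3 : 0 ≤ (2 * (δ * s))⁻¹ * (|X p q ω| - δ * s) ^ 2 := by positivity
          have h4 : (2 * (δ * s))⁻¹ * (|X p q ω| - δ * s) ^ 2
              = δ * s / 2 + (2 * (δ * s))⁻¹ * X p q ω ^ 2 - |X p q ω| := by
            rw [sub_sq, sq_abs]
            field_simp
            ring
          simp only
          linarith
      _ = δ * s / 2 + (2 * (δ * s))⁻¹ * ∫ ω, X p q ω ^ 2 ∂P := by
          rw [integral_add (integrable_const _) (hX2.const_mul _), integral_const_mul]
          simp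
      _ ≤ δ * s / 2 + (2 * (δ * s))⁻¹ * (164 * s ^ 2 * c₁ ^ 2 * c₂⁻¹ * δ ^ 2) := by
          gcongr
          exact hXsq p q
      _ = _ := by
          rw [hK₀]
          field_simp
          ring
  have hDle : ∀ ω, ‖D ω‖ ≤ ∑ p, ∑ q, |X p q ω| := fun ω => by
    refine (opNorm_le_sum_entries b (D ω)).trans (le_of_eq ?_)
    simp_rw [hentry]
  have hXi : ∀ p q, Integrable (fun ω => |X p q ω|) P := fun p q =>
    ((hXL p q).integrable (by norm_num)).abs
  have hsumi : Integrable (fun ω => ∑ p, ∑ q, |X p q ω|) P :=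
    integrable_finsetSum _ fun p _ => integrable_finsetSum _ fun q _ => hXi p q
  have hDm : AEStronglyMeasurable D P := by
    have h : AEStronglyMeasurable
        (fun ω => ∑ i ∈ I, outer (noiseSum g w (T i) (i + 1) ω)) P := by
      refine Finset.aestronglyMeasurable_fun_sum _ fun i _ => ?_
      exact continuous_outer.comp_aestronglyMeasurable
        ((measurable_noiseSum (hg.measurable_apply 0) w _ _).mono
          (sigmaOf_le hw _) le_rfl).aestronglyMeasurable
    exact (h.const_smul Λ⁻¹).sub aestronglyMeasurable_const
  have hDi : Integrable (fun ω => ‖D ω‖) P := by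
    refine hsumi.mono' hDm.norm (Filter.Eventually.of_forall fun ω => ?_)
    rw [norm_norm]
    exact hDle ω
  refine ⟨hDi, (integral_mono hDi hsumi hDle).trans ?_⟩
  rw [integral_finsetSum _ fun p _ => integrable_finsetSum _ fun q _ => hXi p q]
  calc _ ≤ ∑ p : Fin d, ∑ q : Fin d, K₀ * s * δ := by
        refine Finset.sum_le_sum fun p _ => ?_
        rw [integral_finsetSum _ fun q _ => hXi p q]
        exact Finset.sum_le_sum fun q _ => hXabs p q
    _ = (d : ℝ) ^ 2 * K₀ * (s * δ) := by
        simp only [Finset.sum_const, Finset.card_univ, Fintype.card_fin, nsmul_eq_mul]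
        ring
    _ ≤ _ := by
        have : 0 ≤ s * δ := by positivity
        nlinarith

end ErrorBounds

/-! ### Replacing block sums of iterates by block sums of noise -/

section Remainder

set_option linter.unusedSectionVars false

variable {d : ℕ} {W Ω : Type*} [MeasurableSpace W] [mΩ : MeasurableSpace Ω] {P : Measure Ω}
  [IsProbabilityMeasure P] {π : Measure W} [IsProbabilityMeasure π] {w : ℕ → Ω → W} {κ : ℝ}

/-- All steps in the batch are comparable to `i^{-α}`, and there are `O(i^{(1+α)/2})` of them. -/
theorem exists_sum_block_stepPow_le {α C : ℝ} (hC : 0 < C) (hα : 0 < α) (hα' : α < 1)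
    (hbatch : StrictMonoOn (batchSeq C α) (Set.Ici 1)) :
    ∃ c : ℝ, 0 < c ∧ ∀ i : ℕ, 1 ≤ i →
      ∑ k ∈ Finset.Icc (batchStart (batchSeq C α) i) i, stepPow α k
        ≤ c * (i : ℝ) ^ ((1 - α) / 2) := by
  obtain ⟨c₁, hc₁, H₁⟩ := exists_batchLen_le hC hα hα' hbatch
  obtain ⟨c₃, hc₃, H₃⟩ := exists_batchStart_ge hC hα' hbatch
  refine ⟨c₁ * c₃ ^ α, by positivity, fun i hi => ?_⟩
  have hi0 : (0 : ℝ) < i := by exact_mod_cast hi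
  set t := batchStart (batchSeq C α) i with ht
  have ht3 : (i : ℝ) / c₃ ≤ t := by
    rw [div_le_iff₀' hc₃]
    exact H₃ i hi
  have hs : ∀ k ∈ Finset.Icc t i, stepPow α k ≤ c₃ ^ α * (i : ℝ) ^ (-α) := fun k hk => by
    calc stepPow α k ≤ ((i : ℝ) / c₃) ^ (-α) := by
          refine Real.rpow_le_rpow_of_nonpos (by positivity) ?_ (by linarith)
          have : (t : ℝ) ≤ k := by exact_mod_cast (Finset.mem_Icc.1 hk).1
          linarith
      _ = _ := by
          rw [Real.div_rpow hi0.le hc₃.le, Real.rpow_neg hc₃.le, div_inv_eq_mul, mul_comm]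
  calc _ ≤ (batchLen (batchSeq C α) i : ℝ) * (c₃ ^ α * (i : ℝ) ^ (-α)) := by
        have := Finset.sum_le_card_nsmul _ _ _ hs
        rwa [card_Icc_batch, nsmul_eq_mul] at this
    _ ≤ c₁ * (i : ℝ) ^ ((1 + α) / 2) * (c₃ ^ α * (i : ℝ) ^ (-α)) := by
        gcongr
        exact H₁ i hi
    _ = c₁ * c₃ ^ α * ((i : ℝ) ^ ((1 + α) / 2) * (i : ℝ) ^ (-α)) := by ring
    _ = _ := by
        rw [← Real.rpow_add hi0]
        congr 2
        ring

theorem inv_stepPow_le {α : ℝ} (hα : 0 ≤ α) (hα' : α ≤ 1) {i n : ℕ} (hn : 1 ≤ n) (hi : i ≤ n) :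
    (stepPow α i)⁻¹ ≤ 2 * (n : ℝ) ^ α := by
  have hn1 : (1 : ℝ) ≤ n := by exact_mod_cast hn
  have hi1 : (i : ℝ) ≤ n := by exact_mod_cast hi
  rw [inv_stepPow]
  calc ((i : ℝ) + 1) ^ α ≤ (2 * (n : ℝ)) ^ α := by
        gcongr
        linarith
    _ = 2 ^ α * (n : ℝ) ^ α := Real.mul_rpow (by norm_num) (by positivity)
    _ ≤ _ := by
        gcongr
        exact (Real.rpow_le_rpow_of_exponent_le (by norm_num) hα').trans (by norm_num)

theorem integral_sq_smul {E : Type*} [NormedAddCommGroup E] [NormedSpace ℝ E] (c : ℝ) (X : Ω → E) :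
    ∫ ω, ‖c • X ω‖ ^ 2 ∂P = c ^ 2 * ∫ ω, ‖X ω‖ ^ 2 ∂P := by
  rw [← integral_const_mul]
  refine integral_congr_ae (Filter.Eventually.of_forall fun ω => ?_)
  simp only [norm_smul, mul_pow, Real.norm_eq_abs, sq_abs]

theorem average_eq_sum_Icc {x : ℕ → EuclideanSpace ℝ (Fin d)} {n : ℕ} (hn : 1 ≤ n) :
    average x n = (n : ℝ)⁻¹ • ∑ k ∈ Finset.Icc 0 (n - 1), x k := by
  unfold average
  congr 2
  ext k
  simp only [Finset.mem_range, Finset.mem_Icc]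
  omega

/-- The centred block sums of the iterates are close to the images of the block sums of the noise
under the inverse of the linearization. -/
theorem exists_remainder_bound (hw : ∀ i, Measurable (w i)) (hindep : iIndepFun w P)
    (hlaw : ∀ i, HasLaw (w i) π P) {η α C C₀ μ : ℝ} (hμ : 0 < μ) (hη : 0 < η) (hα : 1 / 2 < α)
    (hα' : α < 1) (hC : 0 < C) (hbatch : StrictMonoOn (batchSeq C α) (Set.Ici 1))
    (hC₀ : 0 ≤ C₀) :
    ∃ K : ℝ, 0 < K ∧ ∀ (g : EuclideanSpace ℝ (Fin d) → W → EuclideanSpace ℝ (Fin d)) (s : ℝ),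
      IsNoisyField g π μ κ s → ∀ y₀, ‖y₀‖ ^ 2 ≤ C₀ * s →
      ∀ (A B : EuclideanSpace ℝ (Fin d) →L[ℝ] EuclideanSpace ℝ (Fin d)) (c : ℝ), 0 < c →
      (∀ y, ‖∫ v, g y v ∂π - A y‖ ≤ c * ‖y‖ ^ 2) → (∀ v, B (A v) = v) →
      (∀ v, ‖B v‖ ≤ μ⁻¹ * ‖v‖) →
      ∃ N : ℕ, 1 ≤ N ∧ ∀ n, N ≤ n → ∀ R : ℕ → Ω → EuclideanSpace ℝ (Fin d),
        (∀ i ω, R i ω = (∑ k ∈ Finset.Icc (batchStart (batchSeq C α) i) i,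
            descent g (fun k => η * stepPow α k) y₀ w k ω)
          - (batchLen (batchSeq C α) i : ℝ)
            • average (fun k => descent g (fun k => η * stepPow α k) y₀ w k ω) n
          + B (noiseSum g w (batchStart (batchSeq C α) i) (i + 1) ω)) →
        (∀ i, MemLp (R i) 2 P) ∧
        (∑ i ∈ Finset.Icc 1 n, (batchLen (batchSeq C α) i : ℝ))⁻¹
          * ∑ i ∈ Finset.Icc 1 n, ∫ ω, ‖R i ω‖ ^ 2 ∂P ≤ K * s * (n : ℝ) ^ (-((1 - α) / 2)) := by
  have hα0 : 0 < α := by linarith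
  have h1α : 0 < 1 - α := by linarith
  obtain ⟨K₀, -, H₀⟩ := exists_descent_moment_bound (E := EuclideanSpace ℝ (Fin d)) (κ := κ)
    hw hindep hlaw hμ hη hα0 hα' hC₀
  obtain ⟨K₁, hK₁, HB⟩ := exists_block_bound (E := EuclideanSpace ℝ (Fin d)) (κ := κ)
    hw hindep hlaw hμ hη hα hα' hC₀
  obtain ⟨c₁, hc₁, H₁⟩ := exists_batchLen_le hC hα0 hα' hbatch
  obtain ⟨c₂, hc₂, H₂⟩ := exists_sum_batchLen_ge hC hα' hbatch
  obtain ⟨c₄, hc₄, H₄⟩ := exists_sum_block_stepPow_le hC hα0 hα' hbatch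
  set p₁ := c₂⁻¹ * (4 * (μ⁻¹ ^ 2 * K₁)) + 2 * (c₁ * (μ⁻¹ ^ 2 * (2 * K₁ + 4))) with hp₁
  set p₂ := c₂⁻¹ * (2 * (μ⁻¹ ^ 2 * K₁) * c₄ ^ 2)
    + 4 * (c₁ * (μ⁻¹ ^ 2 * K₁) * (1 - α)⁻¹ ^ 2) with hp₂
  have hp₁0 : 0 < p₁ := by positivity
  have hp₂0 : 0 < p₂ := by positivity
  refine ⟨p₁ + 1, by positivity, fun g s hg y₀ hy₀ A B c hc hr hBA hB => ?_⟩
  have hs := hg.s_pos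
  -- The linearization constant `c` enters the final estimate only through this quantity, which
  -- tends to `0` because `2α > 1`. Hence `N` depends on `c` and `s`, while `K` does not.
  have hlim : Filter.Tendsto (fun n : ℕ => p₂ * c ^ 2 * s * (n : ℝ) ^ (-(2 * α - 1)))
      Filter.atTop (nhds 0) := by
    have := ((tendsto_rpow_neg_atTop (by linarith : 0 < 2 * α - 1)).comp
      tendsto_natCast_atTop_atTop).const_mul (p₂ * c ^ 2 * s)
    simpa using this
  obtain ⟨N, hN⟩ := Filter.eventually_atTop.1 (hlim.eventually_le_const one_pos)
  refine ⟨max N 1, le_max_right _ _, fun n hn R hR => ?_⟩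
  have hn1 : 1 ≤ n := (le_max_right _ _).trans hn
  have hnN := hN n ((le_max_left _ _).trans hn)
  have hn0 : (0 : ℝ) < n := by exact_mod_cast hn1
  set Δ := descent g (fun k => η * stepPow α k) y₀ w with hΔ
  set T := batchStart (batchSeq C α) with hT
  set l := batchLen (batchSeq C α) with hl
  have hTi : ∀ i, T i ≤ i := batchStart_le _
  have hΔ2 : ∀ k, MemLp (Δ k) 2 P := fun k =>
    memLp_two_of_fourth ((measurable_descent hg.measurable _ y₀ w k).mono
      (sigmaOf_le hw _) le_rfl).aestronglyMeasurable (H₀ g s hg y₀ hy₀ k).1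
  have hW2 : ∀ t j, t ≤ j → MemLp (noiseSum g w t j) 2 P := fun t j h =>
    memLp_noiseSum hw hindep hlaw hg h
  have hS2 : ∀ t i, MemLp (fun ω => ∑ k ∈ Finset.Icc t i, Δ k ω) 2 P := fun t i =>
    memLp_finsetSum _ fun k _ => hΔ2 k
  have hA2 : MemLp (fun ω => average (fun k => Δ k ω) n) 2 P :=
    (memLp_finsetSum (Finset.range n) fun k _ => hΔ2 k).const_smul (n : ℝ)⁻¹
  have hBL : ∀ {X : Ω → EuclideanSpace ℝ (Fin d)}, MemLp X 2 P → MemLp (fun ω => B (X ω)) 2 P :=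
    fun h => B.comp_memLp' h
  -- a block sum plus the image of the noise
  have hblock2 : ∀ t i, t ≤ i → MemLp (fun ω => (∑ k ∈ Finset.Icc t i, Δ k ω)
      + B (noiseSum g w t (i + 1) ω)) 2 P := fun t i h =>
    (hS2 t i).add (hBL (hW2 t (i + 1) (by omega)))
  -- As `B A = 1`, the sum is `B` applied to `A ∑ Δ_k` plus the noise sum, the quantity in
  -- `exists_block_bound`.
  have hblock : ∀ t i, t ≤ i → ∫ ω, ‖(∑ k ∈ Finset.Icc t i, Δ k ω)
      + B (noiseSum g w t (i + 1) ω)‖ ^ 2 ∂P ≤ μ⁻¹ ^ 2 * (K₁ * (s * (stepPow α i)⁻¹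
        + c ^ 2 * s ^ 2 * (∑ k ∈ Finset.Icc t i, stepPow α k) ^ 2)) := fun t i h => by
    have hAm : MemLp (fun ω => A (∑ k ∈ Finset.Icc t i, Δ k ω) + noiseSum g w t (i + 1) ω) 2 P :=
      (A.comp_memLp' (hS2 t i)).add (hW2 t (i + 1) (by omega))
    calc _ ≤ ∫ ω, μ⁻¹ ^ 2
        * ‖A (∑ k ∈ Finset.Icc t i, Δ k ω) + noiseSum g w t (i + 1) ω‖ ^ 2 ∂P := by
          refine integral_mono (integrable_sq_of_memLp_two (hblock2 t i h))
            ((integrable_sq_of_memLp_two hAm).const_mul _) fun ω => ?_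
          simp only
          rw [← mul_pow, ← hBA (∑ k ∈ Finset.Icc t i, Δ k ω), ← map_add, hBA]
          gcongr
          exact hB _
      _ ≤ _ := by
          rw [integral_const_mul]
          gcongr
          exact HB g s hg y₀ hy₀ A c hc hr t i h
  have hE1 : ∀ i ∈ Finset.Icc 1 n, ∫ ω, ‖(∑ k ∈ Finset.Icc (T i) i, Δ k ω)
      + B (noiseSum g w (T i) (i + 1) ω)‖ ^ 2 ∂P ≤ μ⁻¹ ^ 2 * (K₁ * (s * (2 * (n : ℝ) ^ α)
        + c ^ 2 * s ^ 2 * (c₄ ^ 2 * (n : ℝ) ^ (1 - α)))) := fun i hi => by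
    have hi' := Finset.mem_Icc.1 hi
    refine (hblock (T i) i (hTi i)).trans ?_
    have h0 : 0 ≤ ∑ k ∈ Finset.Icc (T i) i, stepPow α k :=
      Finset.sum_nonneg fun k _ => (stepPow_pos α k).le
    have h1 : (∑ k ∈ Finset.Icc (T i) i, stepPow α k) ^ 2 ≤ c₄ ^ 2 * (n : ℝ) ^ (1 - α) := by
      calc _ ≤ (c₄ * (n : ℝ) ^ ((1 - α) / 2)) ^ 2 := by
            gcongr
            refine (H₄ i hi'.1).trans ?_
            gcongr
            exact hi'.2
        _ = _ := by
            rw [mul_pow, ← Real.rpow_natCast ((n : ℝ) ^ _), ← Real.rpow_mul hn0.le]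
            congr 2
            push_cast
            ring
    gcongr
    exact inv_stepPow_le hα0.le hα'.le hn1 hi'.2
  -- the average
  set Y := μ⁻¹ ^ 2 * ((2 * K₁ + 4) * s * (n : ℝ)⁻¹
    + 2 * K₁ * (c ^ 2 * s ^ 2) * (1 - α)⁻¹ ^ 2 * (n : ℝ) ^ (-(2 * α))) with hY
  -- The average is the block `[0, n-1]` divided by `n`: the noise sum and the `h⁻¹` term, at most
  -- `n`, contribute `O(s/n)`, and the linearization error contributes the `n^{-2α}` term.
  have hE2 : ∫ ω, ‖average (fun k => Δ k ω) n‖ ^ 2 ∂P ≤ Y := by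
    have e0 : n - 1 + 1 = n := by omega
    have b1 := hblock 0 (n - 1) (Nat.zero_le _)
    have m1 := hblock2 0 (n - 1) (Nat.zero_le _)
    rw [e0] at b1 m1
    have b2 := (noiseSum_moments hw hindep hlaw hg (Nat.zero_le n)).2.1
    have m2 := hBL (hW2 0 n (Nat.zero_le n))
    have b3 : ∫ ω, ‖B (noiseSum g w 0 n ω)‖ ^ 2 ∂P ≤ μ⁻¹ ^ 2 * (2 * s * n) := by
      calc _ ≤ ∫ ω, μ⁻¹ ^ 2 * ‖noiseSum g w 0 n ω‖ ^ 2 ∂P := by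
            refine integral_mono (integrable_sq_of_memLp_two m2)
              ((integrable_sq_of_memLp_two (hW2 0 n (Nat.zero_le n))).const_mul _) fun ω => ?_
            simp only
            rw [← mul_pow]
            gcongr
            exact hB _
        _ ≤ _ := by
            rw [integral_const_mul]
            gcongr
            simpa using b2
    have b4 := integral_norm_sub_sq_le m1 m2
    simp only [add_sub_cancel_right] at b4
    have b5 : (stepPow α (n - 1))⁻¹ ≤ n := by
      rw [inv_stepPow, Nat.cast_sub hn1]
      push_cast
      rw [sub_add_cancel]
      exact Real.rpow_le_self_of_one_le (by exact_mod_cast hn1) hα'.le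
    have b6 : ∑ k ∈ Finset.Icc 0 (n - 1), stepPow α k ≤ (1 - α)⁻¹ * (n : ℝ) ^ (1 - α) := by
      have h := sum_stepPow_le hα0 hα' n
      rw [div_eq_inv_mul] at h
      convert h using 2
      ext k
      simp only [Finset.mem_range, Finset.mem_Icc]
      omega
    have b60 : 0 ≤ ∑ k ∈ Finset.Icc 0 (n - 1), stepPow α k :=
      Finset.sum_nonneg fun k _ => (stepPow_pos α k).le
    have b7 : ∫ ω, ‖∑ k ∈ Finset.Icc 0 (n - 1), Δ k ω‖ ^ 2 ∂P
        ≤ 2 * (μ⁻¹ ^ 2 * (K₁ * (s * n + c ^ 2 * s ^ 2 * ((1 - α)⁻¹ * (n : ℝ) ^ (1 - α)) ^ 2)))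
          + 2 * (μ⁻¹ ^ 2 * (2 * s * n)) := by
      refine b4.trans (add_le_add (mul_le_mul_of_nonneg_left (b1.trans ?_) zero_le_two)
        (mul_le_mul_of_nonneg_left b3 zero_le_two))
      gcongr
    have b8 : (n : ℝ)⁻¹ ^ 2 * ((n : ℝ) ^ (1 - α)) ^ 2 = (n : ℝ) ^ (-(2 * α)) := by
      rw [← Real.rpow_neg_one, ← mul_pow, ← Real.rpow_add hn0, ← Real.rpow_natCast,
        ← Real.rpow_mul hn0.le]
      congr 1
      push_cast
      ring
    simp_rw [average_eq_sum_Icc hn1]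
    rw [integral_sq_smul]
    calc _ ≤ (n : ℝ)⁻¹ ^ 2 * (2 * (μ⁻¹ ^ 2 * (K₁ * (s * n + c ^ 2 * s ^ 2
          * ((1 - α)⁻¹ * (n : ℝ) ^ (1 - α)) ^ 2))) + 2 * (μ⁻¹ ^ 2 * (2 * s * n))) := by gcongr
      _ = μ⁻¹ ^ 2 * ((2 * K₁ + 4) * s * ((n : ℝ)⁻¹ ^ 2 * n) + 2 * K₁ * (c ^ 2 * s ^ 2)
          * (1 - α)⁻¹ ^ 2 * ((n : ℝ)⁻¹ ^ 2 * ((n : ℝ) ^ (1 - α)) ^ 2)) := by ring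
      _ = Y := by
          rw [b8, hY]
          have : (n : ℝ)⁻¹ ^ 2 * n = (n : ℝ)⁻¹ := by field_simp
          rw [this]
  have hRe : ∀ i ω, R i ω = ((∑ k ∈ Finset.Icc (T i) i, Δ k ω) + B (noiseSum g w (T i) (i + 1) ω))
      - (l i : ℝ) • average (fun k => Δ k ω) n := fun i ω => by
    rw [hR]
    abel
  have hlA : ∀ i, MemLp (fun ω => (l i : ℝ) • average (fun k => Δ k ω) n) 2 P := fun i =>
    hA2.const_smul (l i : ℝ)
  refine ⟨fun i => ?_, ?_⟩
  · rw [show R i = _ from funext (hRe i)]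
    exact (hblock2 (T i) i (hTi i)).sub (hlA i)
  set Λ := ∑ i ∈ Finset.Icc 1 n, (l i : ℝ) with hΛ
  have hΛn : c₂ * (n : ℝ) ^ (1 + (1 + α) / 2) ≤ Λ := H₂ n hn1
  have hΛ0 : 0 < Λ := lt_of_lt_of_le (by positivity) hΛn
  set X := μ⁻¹ ^ 2 * (K₁ * (s * (2 * (n : ℝ) ^ α) + c ^ 2 * s ^ 2 * (c₄ ^ 2 * (n : ℝ) ^ (1 - α))))
    with hX
  have hX0 : 0 ≤ X := by positivity
  have hY0 : 0 ≤ Y := by positivity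
  have hRi : ∀ i ∈ Finset.Icc 1 n, ∫ ω, ‖R i ω‖ ^ 2 ∂P
      ≤ 2 * X + 2 * Y * (c₁ * (n : ℝ) ^ ((1 + α) / 2)) * l i := fun i hi => by
    simp_rw [hRe]
    have h := integral_norm_sub_sq_le (hblock2 (T i) i (hTi i)) (hlA i)
    rw [integral_sq_smul] at h
    have hli : (l i : ℝ) ≤ c₁ * (n : ℝ) ^ ((1 + α) / 2) := by
      refine (H₁ i (Finset.mem_Icc.1 hi).1).trans ?_
      gcongr
      exact (Finset.mem_Icc.1 hi).2
    have h2 : (l i : ℝ) ^ 2 * ∫ ω, ‖average (fun k => Δ k ω) n‖ ^ 2 ∂P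
        ≤ (c₁ * (n : ℝ) ^ ((1 + α) / 2)) * l i * Y := by
      rw [sq]
      gcongr
    have h3 := hE1 i hi
    linarith
  have e1 : Λ⁻¹ * n ≤ c₂⁻¹ * (n : ℝ) ^ (-((1 + α) / 2)) := by
    calc _ ≤ (c₂ * (n : ℝ) ^ (1 + (1 + α) / 2))⁻¹ * n := by gcongr
      _ = c₂⁻¹ * ((n : ℝ) ^ (-(1 + (1 + α) / 2)) * (n : ℝ) ^ (1 : ℝ)) := by
          rw [mul_inv, Real.rpow_neg hn0.le, Real.rpow_one]; ring
      _ = _ := by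
          rw [← Real.rpow_add hn0]
          congr 2
          ring
  set ε := (n : ℝ) ^ (-((1 - α) / 2)) with hε
  set τ := (n : ℝ) ^ (-(2 * α - 1)) with hτ
  have q1 : (n : ℝ) ^ (-((1 + α) / 2)) * (n : ℝ) ^ α = ε := by
    rw [← Real.rpow_add hn0]; congr 1; ring
  have q2 : (n : ℝ) ^ (-((1 + α) / 2)) * (n : ℝ) ^ (1 - α) = ε * τ := by
    rw [← Real.rpow_add hn0, hε, hτ, ← Real.rpow_add hn0]; congr 1; ring
  have q3 : (n : ℝ) ^ ((1 + α) / 2) * (n : ℝ)⁻¹ = ε := by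
    rw [← Real.rpow_neg_one, ← Real.rpow_add hn0]; congr 1; ring
  have q4 : (n : ℝ) ^ ((1 + α) / 2) * (n : ℝ) ^ (-(2 * α)) = ε * τ := by
    rw [← Real.rpow_add hn0, hε, hτ, ← Real.rpow_add hn0]; congr 1; ring
  have hε0 : 0 < ε := Real.rpow_pos_of_pos hn0 _
  calc _ ≤ Λ⁻¹ * ∑ i ∈ Finset.Icc 1 n,
        (2 * X + 2 * Y * (c₁ * (n : ℝ) ^ ((1 + α) / 2)) * l i) := by
        gcongr with i hi
        exact hRi i hi
    _ = (Λ⁻¹ * n) * (2 * X) + 2 * Y * (c₁ * (n : ℝ) ^ ((1 + α) / 2)) := by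
        have h : ∑ i ∈ Finset.Icc 1 n, (2 * X + 2 * Y * (c₁ * (n : ℝ) ^ ((1 + α) / 2)) * l i)
            = n * (2 * X) + 2 * Y * (c₁ * (n : ℝ) ^ ((1 + α) / 2)) * Λ := by
          rw [Finset.sum_add_distrib, hΛ, Finset.mul_sum]
          simp
        rw [h]
        field_simp
    _ ≤ (c₂⁻¹ * (n : ℝ) ^ (-((1 + α) / 2))) * (2 * X)
        + 2 * Y * (c₁ * (n : ℝ) ^ ((1 + α) / 2)) := by gcongr
    -- Both the blocks and the average give the rate `ε` for the terms without `c`, and `ε τ` for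
    -- those with `c`.
    _ = p₁ * s * ε + p₂ * (c ^ 2 * s ^ 2) * (ε * τ) := by
        rw [hX, hY]
        calc _ = c₂⁻¹ * (4 * (μ⁻¹ ^ 2 * K₁)) * s * ((n : ℝ) ^ (-((1 + α) / 2)) * (n : ℝ) ^ α)
            + c₂⁻¹ * (2 * (μ⁻¹ ^ 2 * K₁) * c₄ ^ 2) * (c ^ 2 * s ^ 2)
              * ((n : ℝ) ^ (-((1 + α) / 2)) * (n : ℝ) ^ (1 - α))
            + 2 * (c₁ * (μ⁻¹ ^ 2 * (2 * K₁ + 4))) * s * ((n : ℝ) ^ ((1 + α) / 2) * (n : ℝ)⁻¹)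
            + 4 * (c₁ * (μ⁻¹ ^ 2 * K₁) * (1 - α)⁻¹ ^ 2) * (c ^ 2 * s ^ 2)
              * ((n : ℝ) ^ ((1 + α) / 2) * (n : ℝ) ^ (-(2 * α))) := by ring
          _ = _ := by
              rw [q1, q2, q3, q4, hp₁, hp₂]
              ring
    _ = p₁ * s * ε + (p₂ * c ^ 2 * s * τ) * (s * ε) := by ring
    _ ≤ p₁ * s * ε + 1 * (s * ε) := by gcongr
    _ = _ := by ring

end Remainder

/-! ### Error of the covariance estimator for a general noisy field -/

section CovarianceBound

set_option linter.unusedSectionVars false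

variable {d : ℕ} {W Ω : Type*} [MeasurableSpace W] [mΩ : MeasurableSpace Ω] {P : Measure Ω}
  [IsProbabilityMeasure P] {π : Measure W} [IsProbabilityMeasure π] {w : ℕ → Ω → W} {κ : ℝ}

/-- The covariance estimator along a stochastic approximation scheme. -/
theorem exists_covEst_bound (hw : ∀ i, Measurable (w i)) (hindep : iIndepFun w P)
    (hlaw : ∀ i, HasLaw (w i) π P) {η α C C₀ μ : ℝ} (hμ : 0 < μ) (hη : 0 < η) (hα : 1 / 2 < α)
    (hα' : α < 1) (hC : 0 < C) (hbatch : StrictMonoOn (batchSeq C α) (Set.Ici 1))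
    (hC₀ : 0 ≤ C₀) :
    ∃ K : ℝ, 0 < K ∧ ∀ (g : EuclideanSpace ℝ (Fin d) → W → EuclideanSpace ℝ (Fin d)) (s : ℝ),
      IsNoisyField g π μ κ s → ∀ y₀, ‖y₀‖ ^ 2 ≤ C₀ * s →
      ∀ A : EuclideanSpace ℝ (Fin d) →L[ℝ] EuclideanSpace ℝ (Fin d),
      (∀ v, μ * ‖v‖ ^ 2 ≤ inner ℝ (A v) v) → (∀ v x, inner ℝ (A v) x = inner ℝ v (A x)) →
      ∀ c : ℝ, 0 < c → (∀ y, ‖∫ v, g y v ∂π - A y‖ ≤ c * ‖y‖ ^ 2) →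
      ∃ N : ℕ, 1 ≤ N ∧ ∀ n, N ≤ n →
        Integrable (fun ω => ‖covEst (batchSeq C α)
            (fun k => descent g (fun k => η * stepPow α k) y₀ w k ω) n
          - A.inverse ∘L (∫ v, outer (g 0 v) ∂π) ∘L A.inverse‖) P ∧
        ∫ ω, ‖covEst (batchSeq C α) (fun k => descent g (fun k => η * stepPow α k) y₀ w k ω) n
          - A.inverse ∘L (∫ v, outer (g 0 v) ∂π) ∘L A.inverse‖ ∂P
            ≤ K * s * (n : ℝ) ^ (-((1 - α) / 4)) := by
  have hα0 : 0 < α := by linarith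
  obtain ⟨K₁, hK₁, H₁⟩ := exists_empirical_covariance_bound (d := d) (κ := κ) (μ := μ)
    hw hindep hlaw hα0 hα' hC hbatch
  obtain ⟨K₂, hK₂, H₂⟩ := exists_remainder_bound (d := d) (κ := κ)
    hw hindep hlaw hμ hη hα hα' hC hbatch hC₀
  obtain ⟨c₂, hc₂, HΛ⟩ := exists_sum_batchLen_ge hC hα' hbatch
  refine ⟨μ⁻¹ ^ 2 * K₁ + 2 * μ⁻¹ ^ 2 + 2 * K₂, by positivity,
    fun g s hg y₀ hy₀ A hA hsymm c hc hr => ?_⟩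
  have hs := hg.s_pos
  obtain ⟨hB1, hB2, hB3⟩ := exists_inverse_of_coercive hμ hA
  obtain ⟨N, hN1, HN⟩ := H₂ g s hg y₀ hy₀ A A.inverse c hc hr hB2 hB3
  refine ⟨N, hN1, fun n hn => ?_⟩
  set B := A.inverse with hB
  -- The inverse of a symmetric operator is symmetric, so `outer (B v)` is the conjugation of `outer
  -- v` by `B`.
  have hBs : ∀ v x, inner ℝ (B v) x = inner ℝ v (B x) := fun v x => by
    conv_lhs => rw [← hB1 x]
    rw [← hsymm, hB1]
  have hn1 : 1 ≤ n := hN1.trans hn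
  have hn0 : (0 : ℝ) < n := by exact_mod_cast hn1
  set Δ := descent g (fun k => η * stepPow α k) y₀ w with hΔ
  set T := batchStart (batchSeq C α) with hT
  set l := batchLen (batchSeq C α) with hl
  have hTi : ∀ i, T i ≤ i := batchStart_le _
  set I := Finset.Icc 1 n with hI
  set Λ := ∑ i ∈ I, (l i : ℝ) with hΛ
  have hΛ0 : 0 < Λ := lt_of_lt_of_le (by positivity) (HΛ n hn1)
  set V : ℕ → Ω → EuclideanSpace ℝ (Fin d) := fun i => noiseSum g w (T i) (i + 1) with hV
  set X : ℕ → Ω → EuclideanSpace ℝ (Fin d) := fun i ω => (∑ k ∈ Finset.Icc (T i) i, Δ k ω)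
    - (l i : ℝ) • average (fun k => Δ k ω) n with hX
  -- Thus `X i = R i - B (V i)`; the sign comes from the descent step and disappears in the outer
  -- product.
  set R : ℕ → Ω → EuclideanSpace ℝ (Fin d) := fun i ω => X i ω + B (V i ω) with hR
  obtain ⟨hR2, hRn⟩ := HN n hn R fun i ω => rfl
  obtain ⟨hDi, hDn⟩ := H₁ g s hg n hn1
  set S := ∫ v, outer (g 0 v) ∂π with hS
  set D : Ω → ℝ := fun ω => ‖Λ⁻¹ • ∑ i ∈ I, outer (V i ω) - S‖ with hD
  -- The target rate doubles as Young parameter: the normalized sums of `‖V i‖²` and `‖R i‖²` are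
  -- `O(s)` and `O(s δ²)`, so the weights `δ` and `1 + δ⁻¹` both produce `O(s δ)`.
  set δ := (n : ℝ) ^ (-((1 - α) / 4)) with hδ
  have hδ0 : 0 < δ := Real.rpow_pos_of_pos hn0 _
  have hδ1 : δ ≤ 1 := Real.rpow_le_one_of_one_le_of_nonpos (by exact_mod_cast hn1) (by linarith)
  have hδ2 : (n : ℝ) ^ (-((1 - α) / 2)) = δ ^ 2 := by
    rw [hδ, ← Real.rpow_natCast, ← Real.rpow_mul hn0.le]
    congr 1
    push_cast
    ring
  set bound : Ω → ℝ := fun ω => μ⁻¹ ^ 2 * D ω + (δ * μ⁻¹ ^ 2 * (Λ⁻¹ * ∑ i ∈ I, ‖V i ω‖ ^ 2)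
    + (1 + δ⁻¹) * (Λ⁻¹ * ∑ i ∈ I, ‖R i ω‖ ^ 2)) with hbound
  have hle : ∀ ω, ‖covEst (batchSeq C α) (fun k => Δ k ω) n - B ∘L S ∘L B‖ ≤ bound ω := fun ω => by
    have h := norm_average_outer_sub_le (S := S) hBs (inv_nonneg.2 hμ.le) hB3 hδ0 hΛ0.le I
      (fun i => R i ω) (fun i => V i ω)
    have e : covEst (batchSeq C α) (fun k => Δ k ω) n
        = Λ⁻¹ • ∑ i ∈ I, outer (R i ω - B (V i ω)) := by
      unfold covEst
      simp only [hR, hX, add_sub_cancel_right]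
      rfl
    rw [e]
    exact h
  have hΔm : ∀ k, Measurable (Δ k) := fun k =>
    (measurable_descent hg.measurable _ y₀ w k).mono (sigmaOf_le hw _) le_rfl
  have hXm : ∀ i, Measurable (X i) := fun i => by
    have h1 : Measurable fun ω => ∑ k ∈ Finset.Icc (T i) i, Δ k ω :=
      Finset.measurable_fun_sum _ fun k _ => hΔm k
    have h2 : Measurable fun ω => average (fun k => Δ k ω) n :=
      (Finset.measurable_fun_sum (Finset.range n) fun k _ => hΔm k).const_smul (n : ℝ)⁻¹
    exact h1.sub (h2.const_smul (l i : ℝ))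
  have hm : AEStronglyMeasurable
      (fun ω => covEst (batchSeq C α) (fun k => Δ k ω) n - B ∘L S ∘L B) P := by
    have h : AEStronglyMeasurable (fun ω => ∑ i ∈ I, outer (X i ω)) P :=
      Finset.aestronglyMeasurable_fun_sum _ fun i _ =>
        continuous_outer.comp_aestronglyMeasurable (hXm i).aestronglyMeasurable
    exact (h.const_smul Λ⁻¹).sub aestronglyMeasurable_const
  have hVm := fun i => noiseSum_moments hw hindep hlaw hg
    (show T i ≤ i + 1 from (hTi i).trans (Nat.le_succ i))
  have hVi : ∀ i, Integrable (fun ω => ‖V i ω‖ ^ 2) P := fun i =>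
    integrable_sq_of_memLp_two (memLp_noiseSum hw hindep hlaw hg
      (show T i ≤ i + 1 from (hTi i).trans (Nat.le_succ i)))
  have hRi : ∀ i, Integrable (fun ω => ‖R i ω‖ ^ 2) P := fun i => integrable_sq_of_memLp_two (hR2 i)
  have iD : Integrable D P := hDi
  have iV : Integrable (fun ω => ∑ i ∈ I, ‖V i ω‖ ^ 2) P := integrable_finsetSum _ fun i _ => hVi i
  have iR : Integrable (fun ω => ∑ i ∈ I, ‖R i ω‖ ^ 2) P := integrable_finsetSum _ fun i _ => hRi i
  have i1 : Integrable (fun ω => μ⁻¹ ^ 2 * D ω) P := iD.const_mul _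
  have i2 : Integrable (fun ω => δ * μ⁻¹ ^ 2 * (Λ⁻¹ * ∑ i ∈ I, ‖V i ω‖ ^ 2)) P :=
    (iV.const_mul _).const_mul _
  have i3 : Integrable (fun ω => (1 + δ⁻¹) * (Λ⁻¹ * ∑ i ∈ I, ‖R i ω‖ ^ 2)) P :=
    (iR.const_mul _).const_mul _
  have hbi : Integrable bound P := i1.add (i2.add i3)
  have hi : Integrable (fun ω => ‖covEst (batchSeq C α) (fun k => Δ k ω) n - B ∘L S ∘L B‖) P := by
    refine hbi.mono' hm.norm (Filter.Eventually.of_forall fun ω => ?_)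
    rw [norm_norm]
    exact hle ω
  refine ⟨hi, (integral_mono hi hbi hle).trans ?_⟩
  have hVn : Λ⁻¹ * ∑ i ∈ I, ∫ ω, ‖V i ω‖ ^ 2 ∂P ≤ 2 * s := by
    calc _ ≤ Λ⁻¹ * ∑ i ∈ I, 2 * s * (l i : ℝ) := by
          gcongr with i hi
          rw [hl, batchLen_cast]
          exact (hVm i).2.1
      _ = _ := by
          rw [← Finset.mul_sum, ← hΛ]
          field_simp
  have i23 : Integrable (fun ω => δ * μ⁻¹ ^ 2 * (Λ⁻¹ * ∑ i ∈ I, ‖V i ω‖ ^ 2)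
      + (1 + δ⁻¹) * (Λ⁻¹ * ∑ i ∈ I, ‖R i ω‖ ^ 2)) P := i2.add i3
  calc _ = μ⁻¹ ^ 2 * ∫ ω, D ω ∂P + (δ * μ⁻¹ ^ 2 * (Λ⁻¹ * ∑ i ∈ I, ∫ ω, ‖V i ω‖ ^ 2 ∂P)
        + (1 + δ⁻¹) * (Λ⁻¹ * ∑ i ∈ I, ∫ ω, ‖R i ω‖ ^ 2 ∂P)) := by
        rw [hbound, integral_add i1 i23, integral_add i2 i3]
        simp only [integral_const_mul]
        rw [integral_finsetSum _ fun i _ => hVi i, integral_finsetSum _ fun i _ => hRi i]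
    _ ≤ μ⁻¹ ^ 2 * (K₁ * s * δ) + (δ * μ⁻¹ ^ 2 * (2 * s) + (1 + δ⁻¹) * (K₂ * s * δ ^ 2)) := by
        rw [← hδ2]
        gcongr
    _ = (μ⁻¹ ^ 2 * K₁ + 2 * μ⁻¹ ^ 2 + K₂ * (1 + δ)) * s * δ := by
        field_simp
        ring
    _ ≤ _ := by
        rw [mul_comm 2 K₂]
        gcongr
        linarith

end CovarianceBound

/-! ### Functions with continuous Hessian -/

section Hessian

variable {d : ℕ} {f : EuclideanSpace ℝ (Fin d) → ℝ}

theorem hasGradientAt_of_contDiff {n : WithTop ℕ∞} (hn : n ≠ 0) (hf : ContDiff ℝ n f)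
    (x : EuclideanSpace ℝ (Fin d)) : HasGradientAt f (gradient f x) x :=
  ((hf.differentiable hn) x).hasGradientAt

theorem contDiff_gradient (hf : ContDiff ℝ 2 f) : ContDiff ℝ 1 (gradient f) :=
  (InnerProductSpace.toDual ℝ (EuclideanSpace ℝ (Fin d))).symm.contDiff.comp
    (hf.fderiv_right (m := 1) (by norm_num))

theorem hasFDerivAt_gradient (hf : ContDiff ℝ 2 f) (x : EuclideanSpace ℝ (Fin d)) :
    HasFDerivAt (gradient f) (hessian f x) x :=
  ((contDiff_gradient hf).differentiable one_ne_zero x).hasFDerivAt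

theorem continuous_hessian (hf : ContDiff ℝ 2 f) : Continuous (hessian f) :=
  (contDiff_gradient hf).continuous_fderiv one_ne_zero

/-- Symmetry of second derivatives, transported through the Riesz isometry that defines the
gradient. -/
theorem inner_hessian_symm (hf : ContDiff ℝ 2 f) (x v w : EuclideanSpace ℝ (Fin d)) :
    inner ℝ (hessian f x v) w = inner ℝ v (hessian f x w) := by
  have hd : HasFDerivAt (fderiv ℝ f) (fderiv ℝ (fderiv ℝ f) x) x :=
    ((hf.fderiv_right (m := 1) (by norm_num)).differentiable one_ne_zero x).hasFDerivAt
  have h : ∀ v w, inner ℝ (hessian f x v) w = fderiv ℝ (fderiv ℝ f) x v w := by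
    intro v w
    have h1 := (InnerProductSpace.toDual ℝ
      (EuclideanSpace ℝ (Fin d))).symm.toContinuousLinearEquiv.hasFDerivAt.comp x hd
    have h2 : hessian f x = _ := h1.fderiv
    rw [h2]
    exact InnerProductSpace.toDual_symm_apply
  rw [h, real_inner_comm, h]
  exact second_derivative_symmetric (fun y => (hf.differentiable two_ne_zero y).hasFDerivAt) hd v w

theorem norm_hessian_le {M : ℝ} (hM : 0 ≤ M)
    (h : ∀ x y, ‖gradient f x - gradient f y‖ ≤ M * ‖x - y‖)
    (x : EuclideanSpace ℝ (Fin d)) : ‖hessian f x‖ ≤ M :=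
  norm_fderiv_le_of_lipschitz ℝ (C := ⟨M, hM⟩) (LipschitzWith.of_dist_le_mul fun x y => by
    rw [dist_eq_norm, dist_eq_norm]
    exact h x y)

end Hessian

/-! ### The two-point estimator along one realization -/

section Pathwise

variable {d : ℕ} {Z : Type*} [MeasurableSpace Z] {Q : Measure Z}
  {F : EuclideanSpace ℝ (Fin d) → Z → ℝ} {H : Z → ℝ} {xs : EuclideanSpace ℝ (Fin d)}

theorem HasHessianBound.nonneg (hhess : HasHessianBound F Q H) (z : Z) : 0 ≤ H z :=
  (norm_nonneg _).trans (hhess.hessian_le 0 z)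

theorem norm_gradF_sub_le (hhess : HasHessianBound F Q H) (x y : EuclideanSpace ℝ (Fin d)) (z : Z) :
    ‖gradF F x z - gradF F y z‖ ≤ H z * ‖x - y‖ :=
  norm_sub_le_of_hasFDerivAt (g := fun x => gradF F x z) (h := hessian fun y => F y z)
    (fun x => (hhess.differentiable z x).hasFDerivAt) (fun x => hhess.hessian_le x z) x y

theorem hasGradientAt_gradF (hnoise : IsRegularNoise F Q xs) (x : EuclideanSpace ℝ (Fin d))
    (z : Z) : HasGradientAt (fun x => F x z) (gradF F x z) x :=
  hasGradientAt_of_contDiff one_ne_zero (hnoise.contDiff z) x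

/-- The increment `x ↦ F(x + ν u) - F(x)` has a gradient bounded by `H ν ‖u‖`; this `ν` cancels the
division, so the Lipschitz constant of the estimator is free of `ν`. -/
theorem norm_gradEst_sub_le (hnoise : IsRegularNoise F Q xs) (hhess : HasHessianBound F Q H)
    {ν : ℝ} (hν : 0 < ν) (x y : EuclideanSpace ℝ (Fin d)) (z : Z) (u : EuclideanSpace ℝ (Fin d)) :
    ‖gradEst F ν x z u - gradEst F ν y z u‖ ≤ H z * ‖u‖ ^ 2 * ‖x - y‖ := by
  have hd : ∀ x, HasFDerivAt (fun x => F (x + ν • u) z - F x z)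
      (InnerProductSpace.toDual ℝ _ (gradF F (x + ν • u) z - gradF F x z)) x := fun x => by
    have h1 : HasFDerivAt (fun x => F (x + ν • u) z)
        (InnerProductSpace.toDual ℝ _ (gradF F (x + ν • u) z)) x :=
      (hasFDerivAt_comp_add_right (ν • u)).2 (hasGradientAt_gradF hnoise (x + ν • u) z)
    rw [map_sub]
    exact h1.sub (hasGradientAt_gradF hnoise x z)
  have h : ‖(F (x + ν • u) z - F x z) - (F (y + ν • u) z - F y z)‖
      ≤ (H z * (ν * ‖u‖)) * ‖x - y‖ := by
    refine (convex_univ (𝕜 := ℝ)).norm_image_sub_le_of_norm_hasFDerivWithin_le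
      (fun x _ => (hd x).hasFDerivWithinAt) (fun x _ => ?_) (Set.mem_univ y) (Set.mem_univ x)
    rw [LinearIsometryEquiv.norm_map]
    refine (norm_gradF_sub_le hhess _ _ z).trans ?_
    rw [add_sub_cancel_left, norm_smul, Real.norm_eq_abs, abs_of_pos hν]
  unfold gradEst
  rw [← sub_smul, ← sub_div, norm_smul, norm_div, Real.norm_eq_abs ν, abs_of_pos hν]
  calc _ ≤ (H z * (ν * ‖u‖)) * ‖x - y‖ / ν * ‖u‖ := by gcongr
    _ = _ := by field_simp

theorem norm_gradF_le (hhess : HasHessianBound F Q H) (xs x : EuclideanSpace ℝ (Fin d)) (z : Z) :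
    ‖gradF F x z‖ ≤ ‖gradF F xs z‖ + H z * ‖x - xs‖ := by
  have h1 := norm_gradF_sub_le hhess x xs z
  have h2 := norm_add_le (gradF F xs z) (gradF F x z - gradF F xs z)
  rw [add_sub_cancel] at h2
  linarith

/-- Mean value inequality on the ball of radius `ν ‖u‖`. The leading `ν` cancels the division in the
estimator, and the remaining bound is a product of a function of `z` and a function of `u`, so that
its moments factor. -/
theorem abs_increment_le (hnoise : IsRegularNoise F Q xs) (hhess : HasHessianBound F Q H)
    {ν : ℝ} (hν : 0 < ν) (x : EuclideanSpace ℝ (Fin d)) (z : Z) (u : EuclideanSpace ℝ (Fin d)) :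
    ‖F (x + ν • u) z - F x z‖
      ≤ ν * ((1 + ‖x - xs‖ + ν) * (‖gradF F xs z‖ + H z) * (1 + ‖u‖) ^ 2) := by
  have hH := hhess.nonneg z
  have h := (convex_closedBall x (ν * ‖u‖)).norm_image_sub_le_of_norm_hasFDerivWithin_le
    (f := fun x => F x z) (C := (1 + ‖x - xs‖ + ν) * (‖gradF F xs z‖ + H z) * (1 + ‖u‖))
    (fun y _ => (hasGradientAt_gradF hnoise y z).hasFDerivAt.hasFDerivWithinAt) (fun y hy => by
      rw [LinearIsometryEquiv.norm_map]
      rw [mem_closedBall_iff_norm] at hy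
      have h1 := norm_gradF_le hhess xs y z
      have h2 : ‖y - xs‖ ≤ ν * ‖u‖ + ‖x - xs‖ := by
        calc _ = ‖(y - x) + (x - xs)‖ := by congr 1; abel
          _ ≤ _ := (norm_add_le _ _).trans (by gcongr)
      have h3 := mul_le_mul_of_nonneg_left h2 hH
      have a1 := norm_nonneg (gradF F xs z)
      have a2 := norm_nonneg (x - xs)
      have a3 := norm_nonneg u
      calc _ ≤ ‖gradF F xs z‖ + H z * (ν * ‖u‖ + ‖x - xs‖) := by linarith
        _ ≤ (‖gradF F xs z‖ + H z) * ((1 + ‖x - xs‖ + ν) * (1 + ‖u‖)) := by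
          have b1 : 1 ≤ (1 + ‖x - xs‖ + ν) * (1 + ‖u‖) := by nlinarith [mul_nonneg a2 a3]
          have b2 : ν * ‖u‖ + ‖x - xs‖ ≤ (1 + ‖x - xs‖ + ν) * (1 + ‖u‖) := by
            nlinarith [mul_nonneg a2 a3]
          nlinarith [mul_le_mul_of_nonneg_left b1 a1, mul_le_mul_of_nonneg_left b2 hH]
        _ = _ := by ring)
    (Metric.mem_closedBall_self (by positivity))
    (show x + ν • u ∈ Metric.closedBall x (ν * ‖u‖) by
      rw [mem_closedBall_iff_norm, add_sub_cancel_left, norm_smul, Real.norm_eq_abs, abs_of_pos hν])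
  rw [add_sub_cancel_left, norm_smul, Real.norm_eq_abs ν, abs_of_pos hν] at h
  refine h.trans ?_
  have a1 := norm_nonneg (gradF F xs z)
  calc _ ≤ (1 + ‖x - xs‖ + ν) * (‖gradF F xs z‖ + H z) * (1 + ‖u‖) * (ν * (1 + ‖u‖)) := by
        gcongr
        linarith
    _ = _ := by ring

theorem norm_gradEst_le (hnoise : IsRegularNoise F Q xs) (hhess : HasHessianBound F Q H)
    {ν : ℝ} (hν : 0 < ν) (x : EuclideanSpace ℝ (Fin d)) (z : Z) (u : EuclideanSpace ℝ (Fin d)) :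
    ‖gradEst F ν x z u‖ ≤ (1 + ‖x - xs‖ + ν) * (‖gradF F xs z‖ + H z) * (1 + ‖u‖) ^ 3 := by
  have hH := hhess.nonneg z
  unfold gradEst
  rw [norm_smul, norm_div, Real.norm_eq_abs ν, abs_of_pos hν]
  calc _ ≤ ν * ((1 + ‖x - xs‖ + ν) * (‖gradF F xs z‖ + H z) * (1 + ‖u‖) ^ 2) / ν * (1 + ‖u‖) := by
        gcongr
        · exact abs_increment_le hnoise hhess hν x z u
        · linarith
    _ = _ := by field_simp

theorem measurable_gradEst (hm : ∀ x, Measurable (F x)) (hnoise : IsRegularNoise F Q xs) (ν : ℝ) :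
    Measurable fun q : EuclideanSpace ℝ (Fin d) × Z × EuclideanSpace ℝ (Fin d) =>
      gradEst F ν q.1 q.2.1 q.2.2 := by
  have hF : Measurable (Function.uncurry F) :=
    measurable_uncurry_of_continuous_of_measurable (fun z => (hnoise.contDiff z).continuous) hm
  have h1 : Measurable fun q : EuclideanSpace ℝ (Fin d) × Z × EuclideanSpace ℝ (Fin d) =>
      F (q.1 + ν • q.2.2) q.2.1 :=
    hF.comp ((measurable_fst.add ((measurable_snd.comp measurable_snd).const_smul ν)).prodMk
      (measurable_fst.comp measurable_snd))
  have h2 : Measurable fun q : EuclideanSpace ℝ (Fin d) × Z × EuclideanSpace ℝ (Fin d) =>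
      F q.1 q.2.1 :=
    hF.comp (measurable_fst.prodMk (measurable_fst.comp measurable_snd))
  exact ((h1.sub h2).div_const ν).smul (measurable_snd.comp measurable_snd)

end Pathwise

/-! ### The oracle -/

section Oracle

set_option linter.unusedSectionVars false

variable {d : ℕ} {Z : Type*} [MeasurableSpace Z] {Q : Measure Z} [IsProbabilityMeasure Q]
  {F : EuclideanSpace ℝ (Fin d) → Z → ℝ} {H : Z → ℝ} {σ μ L : ℝ}
  {xs : EuclideanSpace ℝ (Fin d)}

theorem norm_gradient_objective_sub_le (horacle : IsOracle F Q σ) (hnoise : IsRegularNoise F Q xs)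
    (hhess : HasHessianBound F Q H) (x y : EuclideanSpace ℝ (Fin d)) :
    ‖gradient (objective F Q) x - gradient (objective F Q) y‖ ≤ (∫ z, H z ∂Q) * ‖x - y‖ := by
  have hH : Integrable H Q := hhess.memLp.integrable (by norm_num)
  rw [← horacle.grad_unbiased, ← horacle.grad_unbiased,
    ← integral_sub (hnoise.grad_integrable x) (hnoise.grad_integrable y), ← integral_mul_const]
  exact norm_integral_le_of_norm_le (hH.mul_const _)
    (Filter.Eventually.of_forall fun z => norm_gradF_sub_le hhess x y z)

theorem integral_H_nonneg (hhess : HasHessianBound F Q H) : 0 ≤ ∫ z, H z ∂Q :=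
  integral_nonneg fun z => hhess.nonneg z

theorem norm_hessian_objective_le (horacle : IsOracle F Q σ) (hnoise : IsRegularNoise F Q xs)
    (hhess : HasHessianBound F Q H) (x : EuclideanSpace ℝ (Fin d)) :
    ‖hessian (objective F Q) x‖ ≤ ∫ z, H z ∂Q :=
  norm_hessian_le (integral_H_nonneg hhess) (norm_gradient_objective_sub_le horacle hnoise hhess) x

theorem measurable_gradEst_apply (horacle : IsOracle F Q σ) (hnoise : IsRegularNoise F Q xs) (ν : ℝ)
    (x : EuclideanSpace ℝ (Fin d)) :
    Measurable fun p : Z × EuclideanSpace ℝ (Fin d) => gradEst F ν x p.1 p.2 := by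
  have h : Measurable fun p : Z × EuclideanSpace ℝ (Fin d) => (x, p) := measurable_prodMk_left
  have h' := (measurable_gradEst horacle.measurable hnoise ν).comp h
  exact h'

theorem memLp_envelope (hhess : HasHessianBound F Q H) (hfourth : MemLp (gradF F xs) 4 Q) :
    MemLp (fun z => ‖gradF F xs z‖ + H z) 4 Q :=
  hfourth.norm.add hhess.memLp

/-- Fubini: integrating out `ζ` first shows that the surrogate is the Gaussian smoothing of `f`. The
joint integrability comes from `abs_increment_le`. -/
theorem surrogate_eq (horacle : IsOracle F Q σ) (hnoise : IsRegularNoise F Q xs)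
    (hhess : HasHessianBound F Q H) (hfourth : MemLp (gradF F xs) 4 Q) {ν : ℝ} (hν : 0 < ν)
    (x : EuclideanSpace ℝ (Fin d)) :
    surrogate F Q ν x
      = ∫ u, objective F Q (x + ν • u) ∂(stdGaussian (EuclideanSpace ℝ (Fin d))) := by
  have hb : Integrable (fun z => ‖gradF F xs z‖ + H z) Q :=
    (memLp_envelope hhess hfourth).integrable (by norm_num)
  have hF : Measurable (Function.uncurry F) :=
    measurable_uncurry_of_continuous_of_measurable (fun z => (hnoise.contDiff z).continuous)
      horacle.measurable
  have hm : Measurable fun p : Z × EuclideanSpace ℝ (Fin d) => F (x + ν • p.2) p.1 :=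
    hF.comp (((measurable_snd.const_smul ν).const_add x).prodMk measurable_fst)
  have h1 : Integrable (fun p : Z × EuclideanSpace ℝ (Fin d) => ‖F x p.1‖)
      (Q.prod (stdGaussian (EuclideanSpace ℝ (Fin d)))) := (horacle.integrable x).norm.comp_fst _
  have h2 : Integrable (fun p : Z × EuclideanSpace ℝ (Fin d) =>
      (‖gradF F xs p.1‖ + H p.1) * (1 + ‖p.2‖) ^ 2)
      (Q.prod (stdGaussian (EuclideanSpace ℝ (Fin d)))) :=
    hb.mul_prod (integrable_one_add_norm_pow_stdGaussian 2)
  unfold surrogate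
  rw [integral_prod_symm]
  · rfl
  · refine (h1.add (h2.const_mul (ν * (1 + ‖x - xs‖ + ν)))).mono' hm.aestronglyMeasurable
      (Filter.Eventually.of_forall fun p => ?_)
    have h3 := abs_increment_le hnoise hhess hν x p.1 p.2
    have h4 := norm_add_le (F x p.1) (F (x + ν • p.2) p.1 - F x p.1)
    rw [add_sub_cancel] at h4
    simp only [Pi.add_apply]
    linarith

theorem integrable_gradEst_pow_four (horacle : IsOracle F Q σ) (hnoise : IsRegularNoise F Q xs)
    (hhess : HasHessianBound F Q H) (hfourth : MemLp (gradF F xs) 4 Q) {ν : ℝ} (hν : 0 < ν)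
    (x : EuclideanSpace ℝ (Fin d)) :
    Integrable (fun p : Z × EuclideanSpace ℝ (Fin d) => ‖gradEst F ν x p.1 p.2‖ ^ 4)
      (Q.prod (stdGaussian (EuclideanSpace ℝ (Fin d)))) ∧
    ∫ p, ‖gradEst F ν x p.1 p.2‖ ^ 4 ∂(Q.prod (stdGaussian (EuclideanSpace ℝ (Fin d))))
      ≤ (1 + ‖x - xs‖ + ν) ^ 4 * ((∫ z, (‖gradF F xs z‖ + H z) ^ 4 ∂Q)
        * ∫ u, (1 + ‖u‖) ^ 12 ∂(stdGaussian (EuclideanSpace ℝ (Fin d)))) := by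
  have hb : Integrable (fun z => (‖gradF F xs z‖ + H z) ^ 4) Q := by
    have h4 : MemLp (fun z => ‖gradF F xs z‖ + H z) ((4 : ℕ) : ENNReal) Q := by
      exact_mod_cast memLp_envelope hhess hfourth
    have h := h4.integrable_norm_pow (by norm_num)
    refine h.congr (Filter.Eventually.of_forall fun z => ?_)
    have := hhess.nonneg z
    simp only
    rw [Real.norm_of_nonneg (by positivity)]
  have h2 : Integrable (fun p : Z × EuclideanSpace ℝ (Fin d) =>
      (‖gradF F xs p.1‖ + H p.1) ^ 4 * (1 + ‖p.2‖) ^ 12)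
      (Q.prod (stdGaussian (EuclideanSpace ℝ (Fin d)))) :=
    hb.mul_prod (integrable_one_add_norm_pow_stdGaussian 12)
  have hm : Measurable fun p : Z × EuclideanSpace ℝ (Fin d) => gradEst F ν x p.1 p.2 :=
    measurable_gradEst_apply horacle hnoise ν x
  have hle : ∀ p : Z × EuclideanSpace ℝ (Fin d), ‖gradEst F ν x p.1 p.2‖ ^ 4
      ≤ (1 + ‖x - xs‖ + ν) ^ 4 * ((‖gradF F xs p.1‖ + H p.1) ^ 4 * (1 + ‖p.2‖) ^ 12) := fun p => by
    calc _ ≤ ((1 + ‖x - xs‖ + ν) * (‖gradF F xs p.1‖ + H p.1) * (1 + ‖p.2‖) ^ 3) ^ 4 :=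
          pow_le_pow_left₀ (norm_nonneg _) (norm_gradEst_le hnoise hhess hν x p.1 p.2) 4
      _ = _ := by rw [mul_pow, mul_pow, ← pow_mul, mul_assoc]
  have hi : Integrable (fun p : Z × EuclideanSpace ℝ (Fin d) => ‖gradEst F ν x p.1 p.2‖ ^ 4)
      (Q.prod (stdGaussian (EuclideanSpace ℝ (Fin d)))) := by
    refine (h2.const_mul ((1 + ‖x - xs‖ + ν) ^ 4)).mono' (hm.norm.pow_const 4).aestronglyMeasurable
      (Filter.Eventually.of_forall fun p => ?_)
    rw [Real.norm_of_nonneg (by positivity)]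
    exact hle p
  refine ⟨hi, (integral_mono hi (h2.const_mul _) hle).trans (le_of_eq ?_)⟩
  rw [integral_const_mul, integral_prod_mul (fun z => (‖gradF F xs z‖ + H z) ^ 4)
    (fun u => (1 + ‖u‖) ^ 12)]

theorem integrable_gradEst_sub_pow_four (horacle : IsOracle F Q σ) (hnoise : IsRegularNoise F Q xs)
    (hhess : HasHessianBound F Q H) {ν : ℝ} (hν : 0 < ν) (x y : EuclideanSpace ℝ (Fin d)) :
    Integrable (fun p : Z × EuclideanSpace ℝ (Fin d) =>
      ‖gradEst F ν x p.1 p.2 - gradEst F ν y p.1 p.2‖ ^ 4)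
      (Q.prod (stdGaussian (EuclideanSpace ℝ (Fin d)))) ∧
    ∫ p, ‖gradEst F ν x p.1 p.2 - gradEst F ν y p.1 p.2‖ ^ 4
        ∂(Q.prod (stdGaussian (EuclideanSpace ℝ (Fin d))))
      ≤ ((∫ z, H z ^ 4 ∂Q) * ∫ u, (1 + ‖u‖) ^ 8 ∂(stdGaussian (EuclideanSpace ℝ (Fin d))))
        * ‖x - y‖ ^ 4 := by
  have hb : Integrable (fun z => H z ^ 4) Q := by
    have h4 : MemLp H ((4 : ℕ) : ENNReal) Q := by exact_mod_cast hhess.memLp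
    have h := h4.integrable_norm_pow (by norm_num)
    refine h.congr (Filter.Eventually.of_forall fun z => ?_)
    simp only
    rw [Real.norm_of_nonneg (hhess.nonneg z)]
  have h2 : Integrable (fun p : Z × EuclideanSpace ℝ (Fin d) => H p.1 ^ 4 * (1 + ‖p.2‖) ^ 8)
      (Q.prod (stdGaussian (EuclideanSpace ℝ (Fin d)))) :=
    hb.mul_prod (integrable_one_add_norm_pow_stdGaussian 8)
  have hm : ∀ x, Measurable fun p : Z × EuclideanSpace ℝ (Fin d) => gradEst F ν x p.1 p.2 :=
    fun x => measurable_gradEst_apply horacle hnoise ν x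
  have hle : ∀ p : Z × EuclideanSpace ℝ (Fin d),
      ‖gradEst F ν x p.1 p.2 - gradEst F ν y p.1 p.2‖ ^ 4
        ≤ H p.1 ^ 4 * (1 + ‖p.2‖) ^ 8 * ‖x - y‖ ^ 4 := fun p => by
    have := hhess.nonneg p.1
    calc _ ≤ (H p.1 * ‖p.2‖ ^ 2 * ‖x - y‖) ^ 4 :=
          pow_le_pow_left₀ (norm_nonneg _) (norm_gradEst_sub_le hnoise hhess hν x y p.1 p.2) 4
      _ ≤ (H p.1 * (1 + ‖p.2‖) ^ 2 * ‖x - y‖) ^ 4 := by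
          gcongr
          linarith
      _ = _ := by rw [mul_pow, mul_pow, ← pow_mul]
  have hi : Integrable (fun p : Z × EuclideanSpace ℝ (Fin d) =>
      ‖gradEst F ν x p.1 p.2 - gradEst F ν y p.1 p.2‖ ^ 4)
      (Q.prod (stdGaussian (EuclideanSpace ℝ (Fin d)))) := by
    refine (h2.mul_const (‖x - y‖ ^ 4)).mono'
      (((hm x).sub (hm y)).norm.pow_const 4).aestronglyMeasurable
      (Filter.Eventually.of_forall fun p => ?_)
    rw [Real.norm_of_nonneg (by positivity)]
    exact hle p
  refine ⟨hi, (integral_mono hi (h2.mul_const _) hle).trans (le_of_eq ?_)⟩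
  rw [integral_mul_const, integral_prod_mul (fun z => H z ^ 4) (fun u => (1 + ‖u‖) ^ 8)]

/-- Integrating out `ζ` leaves the two-point estimator of `f`, to which Stein's identity applies. -/
theorem integral_gradEst (horacle : IsOracle F Q σ)
    (hconv : IsSmoothStronglyConvex (objective F Q) μ L) (hnoise : IsRegularNoise F Q xs)
    (hhess : HasHessianBound F Q H) (hfourth : MemLp (gradF F xs) 4 Q) {ν : ℝ} (hν : 0 < ν)
    (x : EuclideanSpace ℝ (Fin d)) :
    ∫ p, gradEst F ν x p.1 p.2 ∂(Q.prod (stdGaussian (EuclideanSpace ℝ (Fin d))))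
      = ∫ u, gradient (objective F Q) (x + ν • u) ∂(stdGaussian (EuclideanSpace ℝ (Fin d))) := by
  have hm : Measurable fun p : Z × EuclideanSpace ℝ (Fin d) => gradEst F ν x p.1 p.2 :=
    measurable_gradEst_apply horacle hnoise ν x
  have hi : Integrable (fun p : Z × EuclideanSpace ℝ (Fin d) => gradEst F ν x p.1 p.2)
      (Q.prod (stdGaussian (EuclideanSpace ℝ (Fin d)))) :=
    (memLp_two_of_fourth hm.aestronglyMeasurable
      (integrable_gradEst_pow_four horacle hnoise hhess hfourth hν x).1).integrable (by norm_num)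
  rw [integral_prod_symm _ hi, ← (integral_two_point_eq
    (hasGradientAt_of_contDiff two_ne_zero hconv.contDiff) (hasFDerivAt_gradient hconv.contDiff)
    (norm_hessian_objective_le horacle hnoise hhess) hν.ne' x).2]
  refine integral_congr_ae (Filter.Eventually.of_forall fun u => ?_)
  simp only [gradEst]
  rw [integral_smul_const, integral_div, integral_sub (horacle.integrable _) (horacle.integrable _)]
  rfl

theorem hasGradientAt_surrogate (horacle : IsOracle F Q σ)
    (hconv : IsSmoothStronglyConvex (objective F Q) μ L) (hnoise : IsRegularNoise F Q xs)
    (hhess : HasHessianBound F Q H) (hfourth : MemLp (gradF F xs) 4 Q) {ν : ℝ} (hν : 0 < ν)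
    (x : EuclideanSpace ℝ (Fin d)) :
    HasGradientAt (surrogate F Q ν)
      (∫ u, gradient (objective F Q) (x + ν • u) ∂(stdGaussian (EuclideanSpace ℝ (Fin d)))) x := by
  rw [show surrogate F Q ν = _ from funext (surrogate_eq horacle hnoise hhess hfourth hν)]
  exact hasGradientAt_integral_comp_add_smul
    (hasGradientAt_of_contDiff two_ne_zero hconv.contDiff) (hasFDerivAt_gradient hconv.contDiff)
    (norm_hessian_objective_le horacle hnoise hhess) ν x

theorem hessian_surrogate (horacle : IsOracle F Q σ)
    (hconv : IsSmoothStronglyConvex (objective F Q) μ L) (hnoise : IsRegularNoise F Q xs)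
    (hhess : HasHessianBound F Q H) (hfourth : MemLp (gradF F xs) 4 Q) {ν : ℝ} (hν : 0 < ν)
    (x : EuclideanSpace ℝ (Fin d)) :
    hessian (surrogate F Q ν) x
      = ∫ u, hessian (objective F Q) (x + ν • u) ∂(stdGaussian (EuclideanSpace ℝ (Fin d))) := by
  unfold hessian
  rw [show gradient (surrogate F Q ν) = _ from
    funext fun y => (hasGradientAt_surrogate horacle hconv hnoise hhess hfourth hν y).gradient]
  exact (hasFDerivAt_integral_comp_add_smul (hasFDerivAt_gradient hconv.contDiff)
    (continuous_hessian hconv.contDiff) (norm_hessian_objective_le horacle hnoise hhess) ν x).fderiv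

theorem gradient_surrogate_eq_zero (horacle : IsOracle F Q σ)
    (hconv : IsSmoothStronglyConvex (objective F Q) μ L) (hnoise : IsRegularNoise F Q xs)
    (hhess : HasHessianBound F Q H) (hfourth : MemLp (gradF F xs) 4 Q) {ν : ℝ} (hν : 0 < ν)
    {xν : EuclideanSpace ℝ (Fin d)} (hmin : IsMinOn (surrogate F Q ν) Set.univ xν) :
    ∫ u, gradient (objective F Q) (xν + ν • u) ∂(stdGaussian (EuclideanSpace ℝ (Fin d))) = 0 := by
  have h := (hmin.isLocalMin Filter.univ_mem).hasFDerivAt_eq_zero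
    (hasGradientAt_surrogate horacle hconv hnoise hhess hfourth hν xν)
  exact (InnerProductSpace.toDual ℝ (EuclideanSpace ℝ (Fin d))).map_eq_zero_iff.1 h

/-- The minimizer of the surrogate is close to the minimizer of the objective. -/
theorem norm_minimizer_sub_le (horacle : IsOracle F Q σ) (hμ : 0 < μ)
    (hconv : IsSmoothStronglyConvex (objective F Q) μ L)
    (hxs : IsMinOn (objective F Q) Set.univ xs) (hnoise : IsRegularNoise F Q xs)
    (hhess : HasHessianBound F Q H) (hfourth : MemLp (gradF F xs) 4 Q) {ν : ℝ} (hν : 0 < ν)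
    {xν : EuclideanSpace ℝ (Fin d)} (hmin : IsMinOn (surrogate F Q ν) Set.univ xν) :
    ‖xν - xs‖ ≤ μ⁻¹ * ((∫ z, H z ∂Q)
      * ∫ u, ‖u‖ ∂(stdGaussian (EuclideanSpace ℝ (Fin d)))) * ν := by
  set γ := stdGaussian (EuclideanSpace ℝ (Fin d)) with hγ
  set g := gradient (objective F Q) with hg
  have hgd := hasFDerivAt_gradient hconv.contDiff
  have hM := norm_hessian_objective_le horacle hnoise hhess
  have h0 := gradient_surrogate_eq_zero horacle hconv hnoise hhess hfourth hν hmin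
  have hgs : g xs = 0 := by
    have h := (hxs.isLocalMin Filter.univ_mem).hasFDerivAt_eq_zero
      (hasGradientAt_of_contDiff two_ne_zero hconv.contDiff xs)
    exact (InnerProductSpace.toDual ℝ (EuclideanSpace ℝ (Fin d))).map_eq_zero_iff.1 h
  -- Strong monotonicity of the smoothed gradient between the two minimizers bounds their distance
  -- by the size of that gradient at `xs`.
  have h1 := inner_integral_gradient_sub_ge hgd hM hconv.lower ν xν xs
  rw [h0, zero_sub] at h1
  have hu : Integrable (fun u : EuclideanSpace ℝ (Fin d) => ‖u‖) γ :=
    integrable_of_le_pow_stdGaussian (by fun_prop) 1 1 fun u => by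
      rw [norm_norm]; linarith [norm_nonneg u]
  -- Since `g xs = 0`, smoothing changes the gradient at `xs` by at most the Lipschitz constant
  -- times `ν E‖u‖`.
  have h2 : ‖∫ u, g (xs + ν • u) ∂γ‖ ≤ (∫ z, H z ∂Q) * ν * ∫ u, ‖u‖ ∂γ := by
    rw [← integral_const_mul]
    refine norm_integral_le_of_norm_le (hu.const_mul _) (Filter.Eventually.of_forall fun u => ?_)
    have h3 := norm_gradient_objective_sub_le horacle hnoise hhess (xs + ν • u) xs
    rw [← hg, hgs, sub_zero, add_sub_cancel_left, norm_smul, Real.norm_of_nonneg hν.le] at h3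
    linarith
  have h4 := h1.trans (real_inner_le_norm _ _)
  rw [norm_neg] at h4
  have h5 : μ * ‖xν - xs‖ ≤ ‖∫ u, g (xs + ν • u) ∂γ‖ := by
    rcases (norm_nonneg (xν - xs)).eq_or_lt with h | h
    · rw [← h, mul_zero]
      exact norm_nonneg _
    · refine le_of_mul_le_mul_right ?_ h
      calc _ = μ * ‖xν - xs‖ ^ 2 := by ring
        _ ≤ _ := h4
  rw [mul_assoc, ← div_eq_inv_mul, le_div_iff₀' hμ]
  calc _ ≤ _ := h5.trans h2
    _ = _ := by ring

end Oracle

/-! ### The iterates as a centred descent, and the number of queries -/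

section Algorithm

variable {d : ℕ} {Z : Type*} {F : EuclideanSpace ℝ (Fin d) → Z → ℝ}

/-- `stepPow α k` is `(k+1)^{-α}`, so step `k` of the descent uses the step size of iteration `k +
1`. -/
theorem iterate_eq_add_descent (ν η α : ℝ) (x₀ xν : EuclideanSpace ℝ (Fin d)) {Ω : Type*}
    (ζ : ℕ → Ω → Z) (u : ℕ → Ω → EuclideanSpace ℝ (Fin d)) (ω : Ω) (k : ℕ) :
    iterate F ν η α x₀ (fun i => ζ i ω) (fun i => u i ω) k
      = xν + descent (fun y (p : Z × EuclideanSpace ℝ (Fin d)) => gradEst F ν (xν + y) p.1 p.2)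
        (fun k => η * stepPow α k) (x₀ - xν) (fun i ω => (ζ i ω, u i ω)) k ω := by
  induction k with
  | zero => simp [iterate, descent]
  | succ k ih =>
    simp only [iterate, descent, stepPow]
    rw [ih]
    push_cast
    abel

theorem length_queries (ν η α : ℝ) (x₀ : EuclideanSpace ℝ (Fin d)) (ζ : ℕ → Z)
    (u : ℕ → EuclideanSpace ℝ (Fin d)) (n : ℕ) : (queries F ν η α x₀ ζ u n).length = 2 * n := by
  induction n with
  | zero => rfl
  | succ n ih =>
    rw [queries, List.length_append, ih]
    rfl

end Algorithm

/-! ### The two-point estimator as a noisy field -/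

section Field

variable {d : ℕ} {Z : Type*} [MeasurableSpace Z] {Q : Measure Z} [IsProbabilityMeasure Q]
  {F : EuclideanSpace ℝ (Fin d) → Z → ℝ} {H : Z → ℝ} {σ μ L : ℝ}
  {xs : EuclideanSpace ℝ (Fin d)}

/-- Around the minimizer of the surrogate, the two-point estimator is a noisy field whose noise
level grows quadratically in the smoothing parameter. -/
theorem isNoisyField_gradEst (horacle : IsOracle F Q σ)
    (hconv : IsSmoothStronglyConvex (objective F Q) μ L) (hnoise : IsRegularNoise F Q xs)
    (hhess : HasHessianBound F Q H) (hfourth : MemLp (gradF F xs) 4 Q) {ν : ℝ} (hν : 0 < ν)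
    {xν : EuclideanSpace ℝ (Fin d)} (hmin : IsMinOn (surrogate F Q ν) Set.univ xν) {D : ℝ}
    (hD : 0 ≤ D) (hxν : ‖xν - xs‖ ≤ D * ν) :
    IsNoisyField (fun y (p : Z × EuclideanSpace ℝ (Fin d)) => gradEst F ν (xν + y) p.1 p.2)
      (Q.prod (stdGaussian (EuclideanSpace ℝ (Fin d)))) μ
      (√√((∫ z, H z ^ 4 ∂Q) * ∫ u, (1 + ‖u‖) ^ 8 ∂(stdGaussian (EuclideanSpace ℝ (Fin d)))))
      (2 * (1 + D) ^ 2 * (√((∫ z, (‖gradF F xs z‖ + H z) ^ 4 ∂Q)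
        * ∫ u, (1 + ‖u‖) ^ 12 ∂(stdGaussian (EuclideanSpace ℝ (Fin d)))) + 1) * (1 + ν ^ 2)) where
  measurable := by
    have h : Measurable fun q : EuclideanSpace ℝ (Fin d) × Z × EuclideanSpace ℝ (Fin d) =>
        (xν + q.1, q.2) := (measurable_fst.const_add xν).prodMk measurable_snd
    have h' := (measurable_gradEst horacle.measurable hnoise ν).comp h
    exact h'
  -- The `+ 1` next to the square root keeps the noise level positive even if the moments vanish.
  s_pos := by positivity
  integrable_zero := (integrable_gradEst_pow_four horacle hnoise hhess hfourth hν _).1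
  fourth_zero := by
    refine (integrable_gradEst_pow_four horacle hnoise hhess hfourth hν _).2.trans ?_
    set m := (∫ z, (‖gradF F xs z‖ + H z) ^ 4 ∂Q)
      * ∫ u, (1 + ‖u‖) ^ 12 ∂(stdGaussian (EuclideanSpace ℝ (Fin d))) with hm
    have hm0 : 0 ≤ m := mul_nonneg (integral_nonneg fun z => by positivity)
      (integral_nonneg fun u => by positivity)
    rw [add_zero]
    -- The envelope is centred at `xs`, which does not depend on `ν`; moving to `xν` costs `D ν`,
    -- whence the growth `1 + ν²`.
    have h1 : (1 + ‖xν - xs‖ + ν) ^ 2 ≤ 2 * (1 + D) ^ 2 * (1 + ν ^ 2) := by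
      calc _ ≤ ((1 + D) * (1 + ν)) ^ 2 := by
            gcongr
            linarith
        _ = (1 + D) ^ 2 * (1 + ν) ^ 2 := mul_pow _ _ _
        _ ≤ (1 + D) ^ 2 * (2 * 1 ^ 2 + 2 * ν ^ 2) := by
            gcongr
            exact add_sq_le_two 1 ν
        _ = _ := by ring
    have h2 : m ≤ (√m + 1) ^ 2 := by
      have := Real.sq_sqrt hm0
      nlinarith [Real.sqrt_nonneg m]
    calc _ = ((1 + ‖xν - xs‖ + ν) ^ 2) ^ 2 * m := by rw [← pow_mul]
      _ ≤ (2 * (1 + D) ^ 2 * (1 + ν ^ 2)) ^ 2 * (√m + 1) ^ 2 := by gcongr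
      _ = _ := by rw [← mul_pow]; congr 1; ring
  integrable_sub y := (integrable_gradEst_sub_pow_four horacle hnoise hhess hν _ _).1
  fourth_sub y := by
    refine (integrable_gradEst_sub_pow_four horacle hnoise hhess hν _ _).2.trans (le_of_eq ?_)
    rw [add_zero, add_sub_cancel_left, Real.sq_sqrt (Real.sqrt_nonneg _), mul_pow,
      Real.sq_sqrt, ← pow_mul]
    exact mul_nonneg (integral_nonneg fun z => by positivity)
      (integral_nonneg fun u => by positivity)
  mean_zero := by
    rw [integral_gradEst horacle hconv hnoise hhess hfourth hν, add_zero]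
    exact gradient_surrogate_eq_zero horacle hconv hnoise hhess hfourth hν hmin
  mono y := by
    rw [integral_gradEst horacle hconv hnoise hhess hfourth hν]
    have h := inner_integral_gradient_sub_ge (hasFDerivAt_gradient hconv.contDiff)
      (norm_hessian_objective_le horacle hnoise hhess) hconv.lower ν (xν + y) xν
    rwa [gradient_surrogate_eq_zero horacle hconv hnoise hhess hfourth hν hmin, sub_zero,
      add_sub_cancel_left] at h

end Field

end ZOSGD

end

/-! ### The main estimate -/

theorem corollary1 {d : ℕ} {Z : Type*} [MeasurableSpace Z] {Ω : Type*} [MeasurableSpace Ω]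
    (P : Measure Ω) [IsProbabilityMeasure P] (Q : Measure Z) [IsProbabilityMeasure Q]
    (F : EuclideanSpace ℝ (Fin d) → Z → ℝ) (H : Z → ℝ) (σ μ L : ℝ)
    (xs x₀ : EuclideanSpace ℝ (Fin d)) (η α C : ℝ)
    (ζ : ℕ → Ω → Z) (u : ℕ → Ω → EuclideanSpace ℝ (Fin d))
    -- the problem
    (horacle : ZOSGD.IsOracle F Q σ)
    (hμ : 0 < μ) (hL : 0 < L)
    (hconv : ZOSGD.IsSmoothStronglyConvex (ZOSGD.objective F Q) μ L)
    (hxs : IsMinOn (ZOSGD.objective F Q) Set.univ xs)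
    (hnoise : ZOSGD.IsRegularNoise F Q xs)
    (hhess : ZOSGD.HasHessianBound F Q H)
    (hfourth : MemLp (ZOSGD.gradF F xs) 4 Q)
    -- the randomness: the pairs `(ζ_i, u_i)` are i.i.d. with law `Q ⊗ N(0, I_d)`
    (hζ : ∀ i, Measurable (ζ i)) (hu : ∀ i, Measurable (u i))
    (hindep : iIndepFun (fun i ω => (ζ i ω, u i ω)) P)
    (hlaw : ∀ i, HasLaw (fun ω => (ζ i ω, u i ω))
      (Q.prod (stdGaussian (EuclideanSpace ℝ (Fin d)))) P)
    -- step sizes and batches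
    (hη : 0 < η) (hα : 1 / 2 < α) (hα' : α < 1) (hC : 0 < C)
    (hbatch : StrictMonoOn (ZOSGD.batchSeq C α) (Set.Ici 1)) :
    ∃ K : ℝ, 0 < K ∧ ∀ ν : ℝ, 0 < ν → ∀ xν : EuclideanSpace ℝ (Fin d),
      IsMinOn (ZOSGD.surrogate F Q ν) Set.univ xν →
      ∃ N : ℕ, ∀ n : ℕ, N ≤ n →
        let x : Ω → ℕ → EuclideanSpace ℝ (Fin d) := fun ω =>
          ZOSGD.iterate F ν η α x₀ (fun i => ζ i ω) (fun i => u i ω)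
        let err : Ω → ℝ := fun ω =>
          ‖ZOSGD.covEst (ZOSGD.batchSeq C α) (x ω) n - ZOSGD.asympCov F Q ν xν‖
        let calls : Ω → ℕ := fun ω =>
          (ZOSGD.queries F ν η α x₀ (fun i => ζ i ω) (fun i => u i ω) n).length
        Integrable err P ∧
        ∫ ω, err ω ∂P ≤
          K * (√(1 + ν ^ 2 + ν ^ 4) + √(1 + ν + ν ^ 2)) / (n : ℝ) ^ ((1 - α) / 4) ∧
        ∀ ω, ∫ ω', err ω' ∂P ≤
          K * (√(1 + ν ^ 2 + ν ^ 4) + √(1 + ν + ν ^ 2)) / (calls ω : ℝ) ^ ((1 - α) / 4) := by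
  classical
  set γ := stdGaussian (EuclideanSpace ℝ (Fin d)) with hγ
  set D := μ⁻¹ * ((∫ z, H z ∂Q) * ∫ v, ‖v‖ ∂γ) with hD
  have hD0 : 0 ≤ D := mul_nonneg (inv_nonneg.2 hμ.le)
    (mul_nonneg (ZOSGD.integral_H_nonneg hhess) (integral_nonneg fun _ => norm_nonneg _))
  set C₁ := 2 * (1 + D) ^ 2 * (√((∫ z, (‖ZOSGD.gradF F xs z‖ + H z) ^ 4 ∂Q)
    * ∫ v, (1 + ‖v‖) ^ 12 ∂γ) + 1) with hC₁
  have hC₁0 : 0 < C₁ := by positivity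
  -- The starting error satisfies `‖x₀ - xν‖² ≤ 2‖x₀ - xs‖² + 2D²ν²`, a multiple of `1 + ν²` and so
  -- of the noise level; thus `C₀` is independent of `ν`.
  set C₀ := (2 * ‖x₀ - xs‖ ^ 2 + 2 * D ^ 2) / C₁ with hC₀
  have hC₀0 : 0 ≤ C₀ := by positivity
  obtain ⟨K, hK, hmain⟩ := ZOSGD.exists_covEst_bound
    (κ := √√((∫ z, H z ^ 4 ∂Q) * ∫ v, (1 + ‖v‖) ^ 8 ∂γ))
    (fun i => (hζ i).prodMk (hu i)) hindep hlaw hμ hη hα hα' hC hbatch hC₀0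
  refine ⟨4 * (K * C₁), by positivity, fun ν hν xν hmin => ?_⟩
  have hgd := ZOSGD.hasFDerivAt_gradient hconv.contDiff
  have hcont := ZOSGD.continuous_hessian hconv.contDiff
  have hM := ZOSGD.norm_hessian_objective_le horacle hnoise hhess
  have hxν : ‖xν - xs‖ ≤ D * ν :=
    ZOSGD.norm_minimizer_sub_le horacle hμ hconv hxs hnoise hhess hfourth hν hmin
  have hfield := ZOSGD.isNoisyField_gradEst horacle hconv hnoise hhess hfourth hν hmin hD0 hxν
  have hy₀ : ‖x₀ - xν‖ ^ 2 ≤ C₀ * (C₁ * (1 + ν ^ 2)) := by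
    have e : C₀ * (C₁ * (1 + ν ^ 2)) = (2 * ‖x₀ - xs‖ ^ 2 + 2 * D ^ 2) * (1 + ν ^ 2) := by
      rw [hC₀]
      field_simp
    have h1 := ZOSGD.norm_add_sq_le_two (x₀ - xs) (xs - xν)
    rw [sub_add_sub_cancel, norm_sub_rev xs xν] at h1
    have h2 : ‖xν - xs‖ ^ 2 ≤ (D * ν) ^ 2 := by gcongr
    rw [e]
    nlinarith [mul_nonneg (sq_nonneg ‖x₀ - xs‖) (sq_nonneg ν), sq_nonneg D]
  have hA := ZOSGD.hessian_surrogate horacle hconv hnoise hhess hfourth hν xν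
  obtain ⟨N, hN1, hN⟩ := hmain _ _ hfield (x₀ - xν) hy₀ (ZOSGD.hessian (ZOSGD.surrogate F Q ν) xν)
    (fun v => by
      rw [hA]
      exact ZOSGD.inner_integral_hessian_ge hcont hM hconv.lower ν xν v)
    (fun v x => by
      rw [hA]
      exact ZOSGD.inner_integral_hessian_symm hcont hM (ZOSGD.inner_hessian_symm hconv.contDiff)
        ν xν v x)
    -- The linearization constant; `+ 1` only makes it positive.
    ((∫ z, H z ∂Q) * (∫ v, ‖v‖ ∂γ) / ν + 1)
    (add_pos_of_nonneg_of_pos (div_nonneg (mul_nonneg (ZOSGD.integral_H_nonneg hhess)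
      (integral_nonneg fun _ => norm_nonneg _)) hν.le) one_pos)
    (fun y => by
      have h := ZOSGD.norm_integral_gradient_sub_le hgd hcont hM hν xν y
      rw [ZOSGD.gradient_surrogate_eq_zero horacle hconv hnoise hhess hfourth hν hmin, sub_zero,
        ← hA] at h
      rw [ZOSGD.integral_gradEst horacle hconv hnoise hhess hfourth hν]
      refine h.trans ?_
      rw [add_mul, one_mul]
      exact le_add_of_nonneg_right (sq_nonneg _))
  refine ⟨N, fun n hn => ?_⟩
  have hn1 : 1 ≤ n := hN1.trans hn
  have hn0 : (0 : ℝ) < n := by exact_mod_cast hn1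
  obtain ⟨hi, hb⟩ := hN n hn
  intro x err calls
  have herr : err = fun ω => ‖ZOSGD.covEst (ZOSGD.batchSeq C α) (fun k => ZOSGD.descent
      (fun y (p : Z × EuclideanSpace ℝ (Fin d)) => ZOSGD.gradEst F ν (xν + y) p.1 p.2)
      (fun k => η * ZOSGD.stepPow α k) (x₀ - xν) (fun i ω => (ζ i ω, u i ω)) k ω) n
      - (ZOSGD.hessian (ZOSGD.surrogate F Q ν) xν).inverse
        ∘L (∫ p, ZOSGD.outer (ZOSGD.gradEst F ν (xν + 0) p.1 p.2) ∂(Q.prod γ))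
        ∘L (ZOSGD.hessian (ZOSGD.surrogate F Q ν) xν).inverse‖ := by
    funext ω
    simp only [err, x]
    rw [show ZOSGD.iterate F ν η α x₀ (fun i => ζ i ω) (fun i => u i ω) = _ from
      funext (ZOSGD.iterate_eq_add_descent ν η α x₀ xν ζ u ω), ZOSGD.covEst_const_add _ _ _ hn1,
      add_zero]
    rfl
  rw [← herr] at hi hb
  set p := (1 - α) / 4 with hp
  set V := √(1 + ν ^ 2 + ν ^ 4) + √(1 + ν + ν ^ 2) with hV
  have hV0 : 0 ≤ V := by positivity
  -- The first square root alone dominates: `(1 + ν²)² ≤ 4 (1 + ν² + ν⁴)`.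
  have hs : 1 + ν ^ 2 ≤ 2 * V := by
    have h1 : 1 + ν ^ 2 ≤ 2 * √(1 + ν ^ 2 + ν ^ 4) := by
      refine abs_le_of_sq_le_sq' ?_ (by positivity) |>.2
      rw [mul_pow, Real.sq_sqrt (by positivity)]
      nlinarith [sq_nonneg ν, sq_nonneg (ν ^ 2)]
    linarith [Real.sqrt_nonneg (1 + ν + ν ^ 2)]
  have hnp : 0 < (n : ℝ) ^ p := Real.rpow_pos_of_pos hn0 _
  have hbound : ∫ ω, err ω ∂P ≤ 2 * (K * C₁) * V / (n : ℝ) ^ p := by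
    have h1 : K * (C₁ * (1 + ν ^ 2)) ≤ 2 * (K * C₁) * V := by
      calc K * (C₁ * (1 + ν ^ 2)) ≤ K * (C₁ * (2 * V)) := by gcongr
        _ = 2 * (K * C₁) * V := by ring
    have h2 : ∫ ω, err ω ∂P ≤ K * (C₁ * (1 + ν ^ 2)) * (n : ℝ) ^ (-p) := hb
    rw [Real.rpow_neg hn0.le, ← div_eq_mul_inv] at h2
    exact h2.trans (div_le_div_of_nonneg_right h1 hnp.le)
  -- Two queries per iteration cost at most another factor `2`, since `p ≤ 1`; this is why the
  -- constant is `4 (K C₁)`.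
  have hcalls : ((2 * n : ℕ) : ℝ) ^ p ≤ 2 * (n : ℝ) ^ p := by
    push_cast
    rw [Real.mul_rpow zero_le_two hn0.le]
    gcongr
    exact (Real.rpow_le_rpow_of_exponent_le one_le_two (by rw [hp]; linarith)).trans_eq
      (Real.rpow_one 2)
  refine ⟨hi, hbound.trans ?_, fun ω => hbound.trans ?_⟩
  · gcongr
    norm_num
  · rw [show calls ω = 2 * n from ZOSGD.length_queries ν η α x₀ _ _ n]
    have h2n : 0 < ((2 * n : ℕ) : ℝ) ^ p := Real.rpow_pos_of_pos (by exact_mod_cast (by omega)) _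
    rw [div_le_div_iff₀ hnp h2n]
    calc _ ≤ 2 * (K * C₁) * V * (2 * (n : ℝ) ^ p) := by gcongr
      _ = _ := by ring
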